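/- Let $m,n,q$ be positive integers, $\Upsilon\subseteq\mathbb R^m$ and $\Theta\subseteq\mathbb R^q$ open, $y\in\mathbb R^n$, and let $G:\Upsilon\times\Theta\to\mathbb R^n$ be three times continuously differentiable such that at every $(u,\theta)\in\Upsilon\times\Theta$ the Jacobian $\nabla_uG(u,\theta)\in\mathbb R^{n\times m}$ has full row rank and $\nabla_\theta G(u,\theta)\in\mathbb R^{n\times q}$ has full column rank. Assume that for every $u\in\Upsilon$ the function $\vartheta\mapsto\|G(u,\vartheta)-y\|$ has a unique minimizer $\hat\theta(y,u)$ on $\Theta$. Put $$\mathcal G(y)=\{(u,\theta)\in\Upsilon\times\Theta: G(u,\theta)=y\},\quad \mathcal G^\varepsilon(y)=\{(u,\theta)\in\Upsilon\times\Theta:\|G(u,\theta)-y\|\le\varepsilon\},$$ $$\mathcal U(y)=\{u\in\Upsilon:\exists\,\theta\in\Theta,\ G(u,\theta)=y\},\quad \mathcal G_\theta(y)=\{u\in\Upsilon:G(u,\theta)=y\},$$ and let $\lambda_{\mathcal G(y)},\lambda_{\mathcal U(y)},\lambda_{\mathcal G_\theta(y)}$ be their Riemannian measures induced by the Euclidean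 metric, i.e. the normalized Hausdorff measures of dimensions $m+q-n$, $m+q-n$ and $m-n$ on these sets. Let $\rho:\Upsilon\to[0,\infty)$ be a probability density (of $U$) and $\pi:\Theta\to[0,\infty)$ a (possibly improper) prior density, and put $a(u,\theta)=\pi(\theta)\rho(u)$. Assume that $a$ is continuous on $\Upsilon\times\Theta$, that $\lambda_{\mathcal G(y)}\{(u,\theta)\in\mathcal G(y): a(u,\theta)>0\}>0$, and that $0<\int_{\mathcal G^\varepsilon(y)}a<\infty$ for all $\varepsilon>0$. Let $P_\varepsilon$ be the probability measure on $\Upsilon\times\Theta$ with density $a\,\mathbb I_{\mathcal G^\varepsilon(y)}/\int_{\mathcal G^\varepsilon(y)}a$, and assume that for some $\varepsilon_0>0$ the family $\{P_\varepsilon:0<\varepsilon<\varepsilon_0\}$ is tight on the space $\Upsilon\times\Theta$. For $y'\in\mathbb R^n$ and $\theta\in\Theta$ let $$f(y'|\theta)=\liminf_{\varepsilon\downarrow0}\frac{P\{\|G(U,\theta)-y'\|\le\varepsilon\}}{\mathrm{vol}\{w\in\mathbb R^n:\|w-y'\|\le\varepsilon\}}$$ be the likelihood. For every $\theta\in\Theta$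 the function $f(\cdot|\theta)$ is a Lebesgue density of $Y=G(U,\theta)$, and for Lebesgue-almost every $\theta\in\Theta$ with $\pi(\theta)>0$, $$f(y|\theta)=\int_{\mathcal G_\theta(y)}\rho(u)\det\big(\nabla_uG(u,\theta)\nabla_uG(u,\theta)^\top\big)^{-1/2}\lambda_{\mathcal G_\theta(y)}(du).$$ Then $P_\varepsilon$ converges weakly on $\Upsilon\times\Theta$, as $\varepsilon\downarrow0$, to a probability measure $P_0$ with the following properties (in each case the function given has a positive finite integral). 1. $P_0$ has a density with respect to $\lambda_{\mathcal G(y)}$ proportional to $$f_B(u,\theta)=\rho(u)\pi(\theta)\det\big(\nabla G(u,\theta)\nabla G(u,\theta)^\top\big)^{-1/2},\qquad \nabla G=(\nabla_uG:\nabla_\theta G).$$ 2. Equivalently, the $u$-marginal of $P_0$ has a density with respect to $\lambda_{\mathcal U(y)}$ proportional to $$\tilde f_B(u;y)=\frac{\rho(u)\,\pi(\theta)}{\det\big(\nabla_\theta G(u,\theta)^\top\nabla_\theta G(u,\theta)\big)^{1/2}}\det\Big(\overline{\nabla_\theta G}(u,\theta)^\top\nabla_uG(u,\theta)\nabla_uG(u,\theta)^\top\overline{\nabla_\theta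 G}(u,\theta)\Big)^{-1/2}\bigg|_{\theta=\hat\theta(y,u)},$$ where $\overline{\nabla_\theta G}(u,\theta)$ is any $n\times(n-q)$ matrix with orthonormal columns orthogonal to the columns of $\nabla_\theta G(u,\theta)$, and $P_0$ is the image of its $u$-marginal under $u\mapsto(u,\hat\theta(y,u))$. 3. The $\theta$-marginal of $P_0$, which is also the law of $\hat\theta(y,u)$ when $u$ follows the $u$-marginal of $P_0$, has a density with respect to Lebesgue measure on $\Theta$ proportional to $\pi(\theta)f(y|\theta)$. -/

import Mathlib

open MeasureTheory Filter Topology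
open scoped ENNReal Matrix

noncomputable section

namespace ABC

/-- `ℝᵏ` with its Euclidean norm. -/
abbrev E (k : ℕ) : Type := EuclideanSpace ℝ (Fin k)

/-- `ℝᵐ⁺ᑫ`, written as pairs `x = (u, θ)` with `‖x‖² = ‖u‖² + ‖θ‖²`. -/
abbrev Joint (m q : ℕ) : Type := WithLp 2 (E m × E q)

/-! ### Measures: truncation, tightness, weak limits, densities up to a constant -/

section Measures

variable {V : Type*} [MeasurableSpace V]

/-- The probability measure with `μ`-density `a 𝟙_A / ∫_A a dμ`
(meaningful when `0 < ∫_A a dμ < ∞`). -/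
def truncation (μ : Measure V) (a : V → ℝ) (A : Set V) : Measure V :=
  (∫⁻ x in A, ENNReal.ofReal (a x) ∂μ)⁻¹ •
    (μ.restrict A).withDensity fun x => ENNReal.ofReal (a x)

/-- `P` has a density with respect to `μ` that is proportional to `g`: the total integral of `g`
is positive and finite, and `P` has density `g / ∫ g dμ`. -/
def HasDensityPropTo (P μ : Measure V) (g : V → ℝ≥0∞) : Prop :=
  AEMeasurable g μ ∧ ∫⁻ x, g x ∂μ ≠ 0 ∧ ∫⁻ x, g x ∂μ ≠ ∞ ∧
    P = μ.withDensity fun x => g x / ∫⁻ z, g z ∂μ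

variable [TopologicalSpace V]

/-- The measures `P ε`, carried by `X`, form a tight family of measures on the space `X` (the
compact sets are subsets of `X`) when `ε` ranges over some interval `(0, ε₀)`. -/
def TightIn (X : Set V) (P : ℝ → Measure V) : Prop :=
  ∃ ε₀ : ℝ, 0 < ε₀ ∧ ∀ δ : ℝ≥0∞, 0 < δ →
    ∃ K ⊆ X, IsCompact K ∧ ∀ ε : ℝ, 0 < ε → ε < ε₀ → P ε Kᶜ ≤ δ

/-- Weak convergence `P ε ⇝ P₀` as `ε ↓ 0`, for measures carried by `X`, as measures on the
space `X`: convergence of the integrals of all bounded continuous functions on `X`. -/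
def WeakLimitIn (X : Set V) (P : ℝ → Measure V) (P₀ : Measure V) : Prop :=
  ∀ φ : V → ℝ, ContinuousOn φ X → (∃ C, ∀ x ∈ X, |φ x| ≤ C) →
    Tendsto (fun ε => ∫ x in X, φ x ∂(P ε)) (𝓝[>] 0) (𝓝 (∫ x in X, φ x ∂P₀))

end Measures

/-- The Riemannian (intrinsic) measure of a `k`-dimensional `C¹` submanifold `M` of a Euclidean
space, as a measure on the ambient space: the `k`-dimensional Hausdorff measure, normalized to
agree with Lebesgue measure on `ℝᵏ`, restricted to `M`. -/
def riemannianMeasure {V : Type*} [EMetricSpace V] [MeasurableSpace V] [BorelSpace V]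
    (k : ℕ) (M : Set V) : Measure V :=
  (Measure.euclideanHausdorffMeasure k).restrict M

/-! ### The data generating equation `Y = G(U, θ)` -/

section Model

variable {m n q : ℕ}

/-- The product `Υ × Θ` as a subset of `ℝᵐ⁺ᑫ`. -/
def jointSpace (Υ : Set (E m)) (Θ : Set (E q)) : Set (Joint m q) :=
  {x | x.fst ∈ Υ ∧ x.snd ∈ Θ}

/-- The `n × m` Jacobian matrix `∇ᵤG(u, θ)`. -/
def jacU (G : E m → E q → E n) (u : E m) (θ : E q) : Matrix (Fin n) (Fin m) ℝ :=
  Matrix.of fun i j => fderiv ℝ (fun u' => G u' θ) u (EuclideanSpace.single j 1) i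

/-- The `n × q` Jacobian matrix `∇_θ G(u, θ)`. -/
def jacTheta (G : E m → E q → E n) (u : E m) (θ : E q) : Matrix (Fin n) (Fin q) ℝ :=
  Matrix.of fun i j => fderiv ℝ (fun θ' => G u θ') θ (EuclideanSpace.single j 1) i

/-- The `n × (m + q)` Jacobian matrix `∇G(u, θ) = (∇ᵤG(u, θ) : ∇_θ G(u, θ))`. -/
def jac (G : E m → E q → E n) (u : E m) (θ : E q) : Matrix (Fin n) (Fin m ⊕ Fin q) ℝ :=
  Matrix.fromCols (jacU G u θ) (jacTheta G u θ)

/-- The data generating manifold `𝒢(y) = {(u, θ) ∈ Υ × Θ : G(u, θ) = y}`. -/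
def dgm (Υ : Set (E m)) (Θ : Set (E q)) (G : E m → E q → E n) (y : E n) : Set (Joint m q) :=
  {x ∈ jointSpace Υ Θ | G x.fst x.snd = y}

/-- The `ε`-fattening `𝒢^ε(y) = {(u, θ) ∈ Υ × Θ : ‖G(u, θ) - y‖ ≤ ε}`. -/
def dgmFat (Υ : Set (E m)) (Θ : Set (E q)) (G : E m → E q → E n) (y : E n) (ε : ℝ) :
    Set (Joint m q) :=
  {x ∈ jointSpace Υ Θ | ‖G x.fst x.snd - y‖ ≤ ε}

/-- The `u`-projection `𝒰(y)` of `𝒢(y)`. -/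
def uProj (Υ : Set (E m)) (Θ : Set (E q)) (G : E m → E q → E n) (y : E n) : Set (E m) :=
  {u ∈ Υ | ∃ θ ∈ Θ, G u θ = y}

/-- The `θ`-section `𝒢_θ(y) = {u ∈ Υ : G(u, θ) = y}`. -/
def thetaSection (Υ : Set (E m)) (G : E m → E q → E n) (y : E n) (θ : E q) : Set (E m) :=
  {u ∈ Υ | G u θ = y}

/-- `t` is the unique minimizer over `Θ` of `ϑ ↦ ‖G(u, ϑ) - y‖`. -/
def IsUniqueArgmin (Θ : Set (E q)) (G : E m → E q → E n) (y : E n) (u : E m) (t : E q) : Prop :=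
  t ∈ Θ ∧ IsMinOn (fun ϑ => ‖G u ϑ - y‖) Θ t ∧
    ∀ s ∈ Θ, IsMinOn (fun ϑ => ‖G u ϑ - y‖) Θ s → s = t

/-- `B` is an orthogonal complement, with orthonormal columns, of the column space of the
`n × q` matrix `A` of full column rank. -/
def IsOrthComplement (A : Matrix (Fin n) (Fin q) ℝ) (B : Matrix (Fin n) (Fin (n - q)) ℝ) : Prop :=
  Bᵀ * B = 1 ∧ Bᵀ * A = 0

/-- The ambient density `a(u, θ) = π(θ) ρ(u)`. -/
def ambient (ρ : E m → ℝ) (π : E q → ℝ) (x : Joint m q) : ℝ :=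
  π x.snd * ρ x.fst

/-- The law with density proportional to `π(θ) ρ(u) 𝟙{‖G(u, θ) - y‖ ≤ ε}` on `Υ × Θ`. -/
def abcLaw (Υ : Set (E m)) (Θ : Set (E q)) (G : E m → E q → E n) (y : E n)
    (ρ : E m → ℝ) (π : E q → ℝ) (ε : ℝ) : Measure (Joint m q) :=
  truncation volume (ambient ρ π) (dgmFat Υ Θ G y ε)

/-- The law of `Y = G(U, θ)` for given `θ`, where `U` has density `ρ` on `Υ`. -/
def dataLaw (Υ : Set (E m)) (G : E m → E q → E n) (ρ : E m → ℝ) (θ : E q) : Measure (E n) :=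
  ((volume.restrict Υ).withDensity fun u => ENNReal.ofReal (ρ u)).map fun u => G u θ

/-- The likelihood `f(y | θ) = lim_{ε ↓ 0} P(‖G(U, θ) - y‖ ≤ ε | θ) / vol{w : ‖w - y‖ ≤ ε}`;
the lower limit, which always exists, is the limit whenever there is one. -/
def likelihood (Υ : Set (E m)) (G : E m → E q → E n) (ρ : E m → ℝ) (y : E n) (θ : E q) : ℝ≥0∞ :=
  liminf (fun ε : ℝ => dataLaw Υ G ρ θ (Metric.closedBall y ε) /
    volume (Metric.closedBall y ε)) (𝓝[>] 0)

/-- `ρ(u) π(θ) det(∇G ∇Gᵀ)^{-1/2}`. -/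
def densG (G : E m → E q → E n) (ρ : E m → ℝ) (π : E q → ℝ) (x : Joint m q) : ℝ :=
  ρ x.fst * π x.snd * (jac G x.fst x.snd * (jac G x.fst x.snd)ᵀ).det ^ (-(1 / 2) : ℝ)

/-- `ρ(u) π(θ) det(∇_θGᵀ ∇_θG)^{-1/2} det(Bᵀ ∇ᵤG ∇ᵤGᵀ B)^{-1/2}`, where `B` stands for an
orthogonal complement of `∇_θG` at `(u, θ)`; it is used at `θ = θ̂(y, u)`. -/
def densU (G : E m → E q → E n) (ρ : E m → ℝ) (π : E q → ℝ)
    (B : Matrix (Fin n) (Fin (n - q)) ℝ) (u : E m) (θ : E q) : ℝ :=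
  ρ u * π θ / ((jacTheta G u θ)ᵀ * jacTheta G u θ).det ^ (1 / 2 : ℝ) *
    (Bᵀ * jacU G u θ * (jacU G u θ)ᵀ * B).det ^ (-(1 / 2) : ℝ)

/-- `ρ(u) det(∇ᵤG ∇ᵤGᵀ)^{-1/2}`, whose integral over `𝒢_θ(y)` is the geometric expression of the
likelihood. -/
def densSection (G : E m → E q → E n) (ρ : E m → ℝ) (θ : E q) (u : E m) : ℝ :=
  ρ u * (jacU G u θ * (jacU G u θ)ᵀ).det ^ (-(1 / 2) : ℝ)

end Model

end ABC

end

/-! The fattened set is the preimage under `F = jointMap G` of the closed ball of radius `ε` around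
`y`. On the open set `X = Υ × Θ` the map `F` is a submersion, because `∇ᵤG` alone has full row rank.
The coarea formula writes the `a`-mass of such a tube as the integral over the ball of `H(w) = ∫ a ·
det(F' F'ᵀ)^{-1/2}`, taken over the fiber above `w`. For continuous integrands with compact support
in `X` the function `H` is continuous, so mass divided by ball volume tends to `H(y)`
(`tendsto_tube_div_of_hasCompactSupport`). For general continuous `a ≥ 0`, cutoffs give the lower
bound, and tightness, which forbids mass from escaping to infinity or to the boundary of `X`, gives
the upper bound (`tendsto_tube_div_of_tight`). Dividing the limit for `aφ` by the limit for `a`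
yields the weak limit and its density on `𝒢(y)` (`weakLimitIn_truncation`).

The coarea formula comes from the area formula for immersions and Tonelli's theorem, in charts where
`F` is a projection; the Jacobians match by the linear identity `normDet_mul_normDet_adjoint`.

For the `u`-marginal: on `𝒢(y)` the minimum is zero, so the minimizer is `θ` itself and the
projection to `u` is injective, with inverse `u ↦ (u, θ̂(y, u))`. Full column rank makes it an
immersion, and its effect on tangent volumes is pure linear algebra (`setLIntegral_image_fiber`,
`det_gram_mul_borderedDet`, `det_mul_det_of_orthogonal`).

For the `θ`-marginal: the map `(u, θ) ↦ (G(u, θ), θ)` is also a submersion, whose fibers are the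
`θ`-sections. Comparing the two coarea formulas gives `H(y) = ∫ π(θ) s(θ) dθ`, where `s(θ)` is the
integral over the section (`fiberIntegral_eq_lintegral_fiberIntegral`). It remains to see that `s(θ)
= f(y|θ)` almost everywhere on `{π > 0}`. The inequality `s ≤ f` holds for every `θ ∈ Θ` by cutoffs.
Conversely, Fatou's lemma and the convergence of the total tube mass to `∫ π s < ∞` leave no room
for a strict inequality on a set of positive measure (`ae_likelihood_eq`). -/

/-! ### The area formula -/

section AreaFormula

open Module Set
open scoped NNReal

namespace ABC

/-- If `f` contracts distances, up to the factor `K`, more than `g` does, then the images under `f`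
are not larger than those under `g`, up to the factor `K ^ d`. -/
theorem euclideanHausdorffMeasure_image_le_of_edist_le {X Y Z : Type*}
    [EMetricSpace Y] [MeasurableSpace Y] [BorelSpace Y]
    [EMetricSpace Z] [MeasurableSpace Z] [BorelSpace Z] {f : X → Y} {g : X → Z} {s : Set X}
    {K : ℝ≥0} (h : ∀ x ∈ s, ∀ y ∈ s, edist (f x) (f y) ≤ K * edist (g x) (g y)) (d : ℕ) :
    Measure.euclideanHausdorffMeasure d (f '' s) ≤
      (K : ℝ≥0∞) ^ d * Measure.euclideanHausdorffMeasure d (g '' s) := by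
  rcases s.eq_empty_or_nonempty with rfl | ⟨x₀, hx₀⟩
  · simp
  have : Nonempty X := ⟨x₀⟩
  -- The hypothesis makes `f` constant on the fibers of `g` in `s`, so `f` factors through `g` by a
  -- map `k` that is `K`-Lipschitz on the image of `g`.
  set k : Z → Y := fun z => f (Function.invFunOn g s z)
  have hk : ∀ x ∈ s, k (g x) = f x := by
    intro x hx
    have hex : ∃ a ∈ s, g a = g x := ⟨x, hx, rfl⟩
    have h1 := Function.invFunOn_mem hex
    have h2 := Function.invFunOn_eq hex
    have h3 := h _ h1 _ hx
    rw [h2, edist_self, mul_zero, nonpos_iff_eq_zero, edist_eq_zero] at h3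
    exact h3
  have himg : f '' s = k '' (g '' s) := by
    rw [image_image]
    exact image_congr fun x hx => (hk x hx).symm
  have hlip : LipschitzOnWith K k (g '' s) := by
    rintro _ ⟨x, hx, rfl⟩ _ ⟨y, hy, rfl⟩
    rw [hk x hx, hk y hy]
    exact h x hx y hy
  have := hlip.hausdorffMeasure_image_le (Nat.cast_nonneg d)
  rw [himg]
  simp only [Measure.euclideanHausdorffMeasure_def, Measure.smul_apply, ENNReal.smul_def,
    smul_eq_mul]
  rw [ENNReal.rpow_natCast] at this
  calc _ ≤ _ := mul_le_mul_right this _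
    _ = _ := by ring

variable {U V : Type*} [NormedAddCommGroup U] [InnerProductSpace ℝ U] [FiniteDimensional ℝ U]
  [NormedAddCommGroup V] [InnerProductSpace ℝ V]

theorem normDet_pos {f : U →ₗ[ℝ] V} (hf : Function.Injective f) : 0 < f.normDet := by
  refine lt_of_le_of_ne f.normDet_nonneg fun h => ?_
  exact LinearMap.normDet_eq_zero_iff_ker_ne_bot.1 h.symm (LinearMap.ker_eq_bot.2 hf)

variable [FiniteDimensional ℝ V]

theorem normDet_eq_sqrt_det (f : U →L[ℝ] V) :
    f.toLinearMap.normDet = √(f.adjoint ∘L f).det := by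
  rw [← f.normDet_sq]
  simp [Real.sqrt_sq (LinearMap.normDet_nonneg _)]

theorem continuous_normDet : Continuous fun f : U →L[ℝ] V => f.toLinearMap.normDet := by
  simp_rw [normDet_eq_sqrt_det]
  refine Real.continuous_sqrt.comp (ContinuousLinearMap.continuous_det.comp ?_)
  exact (ContinuousLinearMap.adjoint (𝕜 := ℝ) (E := U) (F := V)).continuous.clm_comp continuous_id

variable [MeasurableSpace U] [BorelSpace U] [MeasurableSpace V] [BorelSpace V]

/-- Near `x` the map distorts distances as its derivative at `x` does, up to the factor `t`; this
costs `t ^ d` in `d`-dimensional measure. The Jacobian varies by at most one further factor `t`,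
hence the exponent `d + 1`. For the linear map the comparison is an equality. -/
theorem exists_isOpen_image_measure_comparable {f : U → V} {f' : U → U →L[ℝ] V} {s : Set U} {x : U}
    (hf : HasStrictFDerivAt f (f' x) x) (hc : ContinuousWithinAt f' s x)
    (hinj : Function.Injective (f' x)) {t : ℝ≥0} (ht : 1 < t) :
    ∃ o, IsOpen o ∧ x ∈ o ∧ ∀ w ⊆ s ∩ o, MeasurableSet w →
      Measure.euclideanHausdorffMeasure (finrank ℝ U) (f '' w) ≤
        (t : ℝ≥0∞) ^ (finrank ℝ U + 1) *
          ∫⁻ z in w, ENNReal.ofReal (f' z).toLinearMap.normDet ∧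
      ∫⁻ z in w, ENNReal.ofReal (f' z).toLinearMap.normDet ≤
        (t : ℝ≥0∞) ^ (finrank ℝ U + 1) *
          Measure.euclideanHausdorffMeasure (finrank ℝ U) (f '' w) := by
  set A := f' x with hA
  have ht0 : (0 : ℝ) < t := by exact_mod_cast zero_lt_one.trans ht
  have ht1 : (1 : ℝ) < t := by exact_mod_cast ht
  obtain ⟨c, hc0, hcA⟩ : ∃ c : ℝ, 0 < c ∧ ∀ v, c * ‖v‖ ≤ ‖A v‖ := by
    obtain ⟨K, hK0, hK⟩ := A.toLinearMap.exists_antilipschitzWith (LinearMap.ker_eq_bot.2 hinj)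
    refine ⟨(K : ℝ)⁻¹, by positivity, fun v => ?_⟩
    have := hK.le_mul_dist v 0
    simp only [dist_zero_right, map_zero] at this
    rw [inv_mul_le_iff₀ (by exact_mod_cast hK0)]
    exact this
  have htinv : 0 < 1 - (t : ℝ)⁻¹ := by
    rw [sub_pos]; exact inv_lt_one_of_one_lt₀ ht1
  -- The linearization error `r ‖a - b‖` is then at most `(1 - t⁻¹) ‖A (a - b)‖`, as needed for the
  -- lower distance bound, and also at most `(t - 1) ‖A (a - b)‖`, as needed for the upper one.
  set r : ℝ := c * (1 - (t : ℝ)⁻¹) with hr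
  have hr0 : 0 < r := mul_pos hc0 htinv
  have hrt : r ≤ c * (t - 1) := by
    rw [hr]
    refine mul_le_mul_of_nonneg_left ?_ hc0.le
    have : (t : ℝ) * (t : ℝ)⁻¹ = 1 := mul_inv_cancel₀ ht0.ne'
    have h2 : (t : ℝ)⁻¹ ≤ 1 := inv_le_one_of_one_le₀ ht1.le
    nlinarith [mul_nonneg (sub_nonneg.2 ht1.le) (sub_nonneg.2 h2)]
  obtain ⟨n₁, hn₁, happ⟩ := hf.approximates_deriv_on_nhds (c := ⟨r, hr0.le⟩)
    (Or.inr (by exact_mod_cast hr0))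
  have hJ : 0 < A.toLinearMap.normDet := normDet_pos hinj
  have hcont : ContinuousWithinAt (fun z => (f' z).toLinearMap.normDet) s x :=
    continuous_normDet.continuousAt.comp_continuousWithinAt hc
  have hev : ∀ᶠ z in 𝓝[s] x, (f' z).toLinearMap.normDet < t * A.toLinearMap.normDet ∧
      (t : ℝ)⁻¹ * A.toLinearMap.normDet < (f' z).toLinearMap.normDet := by
    refine (hcont.eventually_lt_const ?_).and (hcont.eventually_const_lt ?_)
    · exact lt_mul_of_one_lt_left hJ ht1
    · exact mul_lt_of_lt_one_left hJ (inv_lt_one_of_one_lt₀ ht1)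
  obtain ⟨o₂, ho₂, hxo₂, hsub⟩ := mem_nhdsWithin.1 hev
  obtain ⟨o₁, ho₁s, ho₁, hxo₁⟩ := mem_nhds_iff.1 hn₁
  refine ⟨o₁ ∩ o₂, ho₁.inter ho₂, ⟨hxo₁, hxo₂⟩, fun w hw hwm => ?_⟩
  have hd1 : ∀ a ∈ w, ∀ b ∈ w, ‖f a - f b‖ ≤ t * ‖A (a - b)‖ := by
    intro a ha b hb
    have h1 : ‖f a - f b - A (a - b)‖ ≤ r * ‖a - b‖ :=
      happ a (ho₁s (hw ha).2.1) b (ho₁s (hw hb).2.1)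
    have h2 := hcA (a - b)
    have h3 : ‖f a - f b‖ ≤ ‖f a - f b - A (a - b)‖ + ‖A (a - b)‖ := by
      simpa using norm_add_le (f a - f b - A (a - b)) (A (a - b))
    have h4 : r * ‖a - b‖ ≤ (t - 1) * (c * ‖a - b‖) := by
      calc r * ‖a - b‖ ≤ c * (t - 1) * ‖a - b‖ := by gcongr
        _ = _ := by ring
    nlinarith [mul_le_mul_of_nonneg_left h2 (sub_nonneg.2 ht1.le)]
  have hd2 : ∀ a ∈ w, ∀ b ∈ w, ‖A (a - b)‖ ≤ t * ‖f a - f b‖ := by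
    intro a ha b hb
    have h1 : ‖f a - f b - A (a - b)‖ ≤ r * ‖a - b‖ :=
      happ a (ho₁s (hw ha).2.1) b (ho₁s (hw hb).2.1)
    have h2 := hcA (a - b)
    have h3 : ‖A (a - b)‖ ≤ ‖f a - f b - A (a - b)‖ + ‖f a - f b‖ := by
      simpa using norm_sub_le (f a - f b) (f a - f b - A (a - b)) |>.trans_eq (add_comm _ _)
    have h4 : r * ‖a - b‖ ≤ (1 - (t : ℝ)⁻¹) * ‖A (a - b)‖ := by
      calc r * ‖a - b‖ = (1 - (t : ℝ)⁻¹) * (c * ‖a - b‖) := by rw [hr]; ring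
        _ ≤ _ := by gcongr
    have h5 : (t : ℝ)⁻¹ * ‖A (a - b)‖ ≤ ‖f a - f b‖ := by linarith
    rwa [inv_mul_le_iff₀ ht0] at h5
  have e1 := euclideanHausdorffMeasure_image_le_of_edist_le (f := f) (g := A) (s := w) (K := t)
    (fun a ha b hb => by
      have := hd1 a ha b hb
      rw [edist_dist, edist_dist, dist_eq_norm, dist_eq_norm, ← map_sub,
        ← ENNReal.ofReal_coe_nnreal, ← ENNReal.ofReal_mul ht0.le]
      exact ENNReal.ofReal_le_ofReal this) (finrank ℝ U)
  have e2 := euclideanHausdorffMeasure_image_le_of_edist_le (f := A) (g := f) (s := w) (K := t)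
    (fun a ha b hb => by
      have := hd2 a ha b hb
      rw [edist_dist, edist_dist, dist_eq_norm, dist_eq_norm, ← map_sub,
        ← ENNReal.ofReal_coe_nnreal, ← ENNReal.ofReal_mul ht0.le]
      exact ENNReal.ofReal_le_ofReal this) (finrank ℝ U)
  have e3 : Measure.euclideanHausdorffMeasure (finrank ℝ U) (A '' w) =
      ENNReal.ofReal A.toLinearMap.normDet * volume w :=
    A.toLinearMap.euclideanHausdorffMeasure_image_eq_normDet_mul_volume w
  have i1 : ENNReal.ofReal A.toLinearMap.normDet * volume w ≤
      t * ∫⁻ z in w, ENNReal.ofReal (f' z).toLinearMap.normDet := by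
    rw [← lintegral_const_mul' _ _ ENNReal.coe_ne_top, ← setLIntegral_const]
    refine setLIntegral_mono' hwm fun z hz => ?_
    have := (hsub ⟨(hw hz).2.2, (hw hz).1⟩).2
    rw [← ENNReal.ofReal_coe_nnreal, ← ENNReal.ofReal_mul ht0.le]
    refine ENNReal.ofReal_le_ofReal ?_
    rw [inv_mul_lt_iff₀ ht0] at this
    exact this.le
  have i2 : ∫⁻ z in w, ENNReal.ofReal (f' z).toLinearMap.normDet ≤
      t * (ENNReal.ofReal A.toLinearMap.normDet * volume w) := by
    rw [← mul_assoc, ← setLIntegral_const]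
    refine setLIntegral_mono' hwm fun z hz => ?_
    have := (hsub ⟨(hw hz).2.2, (hw hz).1⟩).1
    rw [← ENNReal.ofReal_coe_nnreal, ← ENNReal.ofReal_mul ht0.le]
    exact ENNReal.ofReal_le_ofReal this.le
  constructor
  · calc _ ≤ _ := e1
      _ ≤ (t : ℝ≥0∞) ^ finrank ℝ U *
          (t * ∫⁻ z in w, ENNReal.ofReal (f' z).toLinearMap.normDet) := by
        rw [e3]; gcongr
      _ = _ := by ring
  · calc _ ≤ _ := i2
      _ ≤ t * ((t : ℝ≥0∞) ^ finrank ℝ U *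
          Measure.euclideanHausdorffMeasure (finrank ℝ U) (f '' w)) := by
        rw [← e3]; gcongr
      _ = _ := by ring

/-- Area formula for an injective immersion, for sets. -/
theorem euclideanHausdorffMeasure_image_eq_lintegral_normDet {f : U → V} {f' : U → U →L[ℝ] V}
    {s : Set U} (hs : MeasurableSet s) (hf : ∀ x ∈ s, HasStrictFDerivAt f (f' x) x)
    (hc : ContinuousOn f' s) (hinj : ∀ x ∈ s, Function.Injective (f' x)) (hfs : InjOn f s) :
    Measure.euclideanHausdorffMeasure (finrank ℝ U) (f '' s) =
      ∫⁻ z in s, ENNReal.ofReal (f' z).toLinearMap.normDet := by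
  have hfc : ContinuousOn f s := fun x hx => (hf x hx).continuousAt.continuousWithinAt
  have key : ∀ t : ℝ≥0, 1 < t →
      Measure.euclideanHausdorffMeasure (finrank ℝ U) (f '' s) ≤
        (t : ℝ≥0∞) ^ (finrank ℝ U + 1) * ∫⁻ z in s, ENNReal.ofReal (f' z).toLinearMap.normDet ∧
      ∫⁻ z in s, ENNReal.ofReal (f' z).toLinearMap.normDet ≤
        (t : ℝ≥0∞) ^ (finrank ℝ U + 1) *
          Measure.euclideanHausdorffMeasure (finrank ℝ U) (f '' s) := by
    intro t ht
    rcases s.eq_empty_or_nonempty with rfl | hne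
    · simp
    have hloc := fun x : s => exists_isOpen_image_measure_comparable (hf x x.2) (hc x x.2)
      (hinj x x.2) ht
    choose o ho hxo hcmp using hloc
    -- By Lindelöf countably many of the good neighborhoods suffice; made disjoint, they let the
    -- local estimates be summed with a common factor.
    obtain ⟨T, hTc, hT⟩ := TopologicalSpace.isOpen_iUnion_countable o ho
    have hTne : T.Nonempty := by
      obtain ⟨x, hx⟩ := hne
      have : x ∈ ⋃ i ∈ T, o i := hT ▸ mem_iUnion.2 ⟨⟨x, hx⟩, hxo _⟩
      obtain ⟨i, hi, -⟩ := mem_iUnion₂.1 this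
      exact ⟨i, hi⟩
    obtain ⟨e, rfl⟩ := hTc.exists_eq_range hTne
    have hcov : s ⊆ ⋃ n, o (e n) := by
      intro x hx
      have : x ∈ ⋃ i ∈ range e, o i := hT ▸ mem_iUnion.2 ⟨⟨x, hx⟩, hxo _⟩
      simpa using this
    set w : ℕ → Set U := fun n => s ∩ disjointed (fun n => o (e n)) n with hw
    have hwm : ∀ n, MeasurableSet (w n) := fun n =>
      hs.inter (MeasurableSet.disjointed (fun n => (ho (e n)).measurableSet) n)
    have hws : ⋃ n, w n = s := by
      rw [hw, ← inter_iUnion, iUnion_disjointed]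
      exact inter_eq_left.2 hcov
    have hwd : Pairwise (Function.onFun Disjoint w) := fun i j hij =>
      (disjoint_disjointed _ hij).mono inter_subset_right inter_subset_right
    have hwsub : ∀ n, w n ⊆ s := fun n => inter_subset_left
    have hwo : ∀ n, w n ⊆ s ∩ o (e n) := fun n =>
      inter_subset_inter_right _ (disjointed_subset _ _)
    have e1 : Measure.euclideanHausdorffMeasure (finrank ℝ U) (f '' s) =
        ∑' n, Measure.euclideanHausdorffMeasure (finrank ℝ U) (f '' w n) := by
      conv_lhs => rw [← hws, image_iUnion]
      refine measure_iUnion (fun i j hij => ?_) fun n =>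
        (hwm n).image_of_continuousOn_injOn (hfc.mono (hwsub n)) (hfs.mono (hwsub n))
      have := hfs.image_inter (hwsub i) (hwsub j)
      rw [Function.onFun, disjoint_iff_inter_eq_empty, ← this,
        disjoint_iff_inter_eq_empty.1 (hwd hij), image_empty]
    have e2 : ∫⁻ z in s, ENNReal.ofReal (f' z).toLinearMap.normDet =
        ∑' n, ∫⁻ z in w n, ENNReal.ofReal (f' z).toLinearMap.normDet := by
      conv_lhs => rw [← hws]
      exact lintegral_iUnion hwm hwd _
    rw [e1, e2, ← ENNReal.tsum_mul_left, ← ENNReal.tsum_mul_left]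
    exact ⟨ENNReal.tsum_le_tsum fun n => (hcmp (e n) (w n) (hwo n) (hwm n)).1,
      ENNReal.tsum_le_tsum fun n => (hcmp (e n) (w n) (hwo n) (hwm n)).2⟩
  -- The factor `t ^ (d + 1)` disappears as `t` decreases to `1`.
  have lim : ∀ a b : ℝ≥0∞, (∀ t : ℝ≥0, 1 < t → a ≤ (t : ℝ≥0∞) ^ (finrank ℝ U + 1) * b) → a ≤ b := by
    intro a b hab
    have h1 : Tendsto (fun t : ℝ≥0 => ((t : ℝ≥0∞) ^ (finrank ℝ U + 1)) * b) (𝓝[>] 1)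
        (𝓝 (1 * b)) := by
      refine ENNReal.Tendsto.mul_const ?_ (Or.inl one_ne_zero)
      have : Tendsto (fun t : ℝ≥0 => ((t ^ (finrank ℝ U + 1) : ℝ≥0) : ℝ≥0∞)) (𝓝 1)
          (𝓝 ((1 ^ (finrank ℝ U + 1) : ℝ≥0) : ℝ≥0∞)) :=
        ENNReal.tendsto_coe.2 ((continuous_pow _).tendsto 1)
      simpa using this.mono_left nhdsWithin_le_nhds
    rw [one_mul] at h1
    have : (𝓝[>] (1 : ℝ≥0)).NeBot := nhdsGT_neBot_of_exists_gt ⟨2, one_lt_two⟩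
    exact ge_of_tendsto h1 (eventually_nhdsWithin_of_forall fun t ht => hab t ht)
  exact le_antisymm (lim _ _ fun t ht => (key t ht).1) (lim _ _ fun t ht => (key t ht).2)

/-- Area formula for an injective immersion, for integrals. -/
theorem lintegral_image_eq_lintegral_normDet_mul {f : U → V} {f' : U → U →L[ℝ] V}
    {s : Set U} (hs : MeasurableSet s) (hf : ∀ x ∈ s, HasStrictFDerivAt f (f' x) x)
    (hc : ContinuousOn f' s) (hinj : ∀ x ∈ s, Function.Injective (f' x)) (hfs : InjOn f s)
    (g : V → ℝ≥0∞) :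
    ∫⁻ z in f '' s, g z ∂(Measure.euclideanHausdorffMeasure (finrank ℝ U)) =
      ∫⁻ x in s, ENNReal.ofReal (f' x).toLinearMap.normDet * g (f x) := by
  have hfc : ContinuousOn f s := fun x hx => (hf x hx).continuousAt.continuousWithinAt
  have hJc : ContinuousOn (fun x => ENNReal.ofReal (f' x).toLinearMap.normDet) s :=
    ENNReal.continuous_ofReal.comp_continuousOn (continuous_normDet.comp_continuousOn hc)
  have hemb : MeasurableEmbedding (s.domRestrict f) := hfc.measurableEmbedding hs hfs
  -- The restricted map is a measurable embedding, and the version for sets identifies the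
  -- pushforward of the Jacobian measure. Integrals of arbitrary functions, measurable or not, can
  -- then be transported.
  have hmap : Measure.map (s.domRestrict f) (Measure.comap (↑)
      (volume.withDensity fun x => ENNReal.ofReal (f' x).toLinearMap.normDet)) =
      (Measure.euclideanHausdorffMeasure (finrank ℝ U)).restrict (f '' s) := by
    ext t ht
    have hpre : MeasurableSet ((s.domRestrict f) ⁻¹' t) := hemb.measurable ht
    have himg : ((↑) : s → U) '' ((s.domRestrict f) ⁻¹' t) = s ∩ f ⁻¹' t := by
      ext x
      simp only [mem_image, mem_preimage, domRestrict_apply, Subtype.exists, exists_and_right,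
        exists_eq_right, mem_inter_iff]
      constructor
      · rintro ⟨h1, h2⟩; exact ⟨h1, h2⟩
      · rintro ⟨h1, h2⟩; exact ⟨h1, h2⟩
    have hm : MeasurableSet (s ∩ f ⁻¹' t) := himg ▸ hs.subtype_image hpre
    rw [Measure.map_apply hemb.measurable ht, comap_subtype_coe_apply hs, himg,
      withDensity_apply _ hm, Measure.restrict_apply ht,
      ← euclideanHausdorffMeasure_image_eq_lintegral_normDet hm (fun x hx => hf x hx.1)
        (hc.mono inter_subset_left) (fun x hx => hinj x hx.1) (hfs.mono inter_subset_left),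
      image_inter_preimage, inter_comm]
  rw [← hmap, hemb.lintegral_map]
  simp only [Set.domRestrict_apply, ← Function.comp_apply (f := g)]
  rw [← (MeasurableEmbedding.subtype_coe hs).lintegral_map, map_comap_subtype_coe hs,
    setLIntegral_withDensity_eq_setLIntegral_mul_non_measurable₀ _ _ _ hs]
  · simp only [Pi.mul_apply]
  · simp
  · exact hJc.aemeasurable hs

end ABC

end AreaFormula

/-! ### Submersions: straightening charts and their Jacobians -/

section Charts

open Module Set

namespace ABC

variable {V W D : Type*} [NormedAddCommGroup V] [InnerProductSpace ℝ V]
  [NormedAddCommGroup W] [InnerProductSpace ℝ W] [NormedAddCommGroup D] [InnerProductSpace ℝ D]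

/-- The inclusion `k ↦ (0, k)` of the second factor of an `L²` product. -/
noncomputable def sndIncl (W D : Type*) [NormedAddCommGroup W] [InnerProductSpace ℝ W]
    [NormedAddCommGroup D] [InnerProductSpace ℝ D] : D →L[ℝ] WithLp 2 (W × D) :=
  (WithLp.prodContinuousLinearEquiv 2 ℝ W D).symm.toContinuousLinearMap ∘L
    ContinuousLinearMap.inr ℝ W D

@[simp]
theorem sndIncl_apply (k : D) : sndIncl W D k = WithLp.toLp 2 (0, k) := rfl

theorem sndIncl_injective : Function.Injective (sndIncl W D) := by
  intro a b h
  simpa using h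

variable [FiniteDimensional ℝ V] [FiniteDimensional ℝ W] [FiniteDimensional ℝ D]

/-- The Jacobians of a chart `A` that straightens the submersion `S`: the volume distortion of `A`
is the volume distortion along the fiber divided by the Jacobian of `S`. -/
theorem normDet_mul_normDet_adjoint (A : WithLp 2 (W × D) ≃L[ℝ] V) (S : V →L[ℝ] W)
    (hS : ∀ p, S (A p) = p.fst) :
    A.toContinuousLinearMap.toLinearMap.normDet * S.adjoint.toLinearMap.normDet =
      (A.toContinuousLinearMap ∘L sndIncl W D).toLinearMap.normDet := by
  set bW := stdOrthonormalBasis ℝ W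
  set bD := stdOrthonormalBasis ℝ D
  set L : D →L[ℝ] V := A.toContinuousLinearMap ∘L sndIncl W D with hL
  have hSL : ∀ k, S (L k) = 0 := fun k => by simp [hL, hS]
  have hSsurj : Function.Surjective S := fun w => ⟨A (WithLp.toLp 2 (w, 0)), hS _⟩
  have hadj : Function.Injective S.adjoint := by
    rw [injective_iff_map_eq_zero]
    intro w hw
    obtain ⟨v, rfl⟩ := hSsurj w
    have : inner ℝ (S v) (S v) = 0 := by
      rw [← ContinuousLinearMap.adjoint_inner_right, hw, inner_zero_right]
    exact inner_self_eq_zero.1 this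
  have hpos : 0 < S.adjoint.toLinearMap.normDet := normDet_pos hadj
  -- The auxiliary map `Y (w, k) = S* w + L k` has a block diagonal Gram matrix, since the range of
  -- `S*` is orthogonal to the kernel of `S`, which contains the range of `L`. So its volume factor
  -- is the product of those of `S*` and `L`.
  set Y : WithLp 2 (W × D) →L[ℝ] V :=
    S.adjoint ∘L WithLp.fstL 2 ℝ W D + L ∘L WithLp.sndL 2 ℝ W D with hY
  set C : WithLp 2 (W × D) →L[ℝ] WithLp 2 (W × D) := A.symm.toContinuousLinearMap ∘L Y with hC
  have hYC : Y.toLinearMap = A.toContinuousLinearMap.toLinearMap ∘ₗ C.toLinearMap := by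
    ext p
    simp [hC]
  have hYn : Y.toLinearMap.normDet =
      A.toContinuousLinearMap.toLinearMap.normDet * C.toLinearMap.normDet := by
    rw [hYC]
    exact LinearMap.normDet_comp_of_finrank_eq _ _ rfl
  have hYsq : Y.toLinearMap.normDet ^ 2 =
      S.adjoint.toLinearMap.normDet ^ 2 * L.toLinearMap.normDet ^ 2 := by
    have h1 := Y.toLinearMap.normDet_sq_eq_det_gram (bW.prod bD)
    have h2 := S.adjoint.toLinearMap.normDet_sq_eq_det_gram bW
    have h3 := L.toLinearMap.normDet_sq_eq_det_gram bD
    simp only [RCLike.ofReal_real_eq_id, id_eq] at h1 h2 h3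
    rw [h1, h2, h3]
    have : Matrix.gram ℝ (fun i => Y.toLinearMap ((bW.prod bD) i)) =
        Matrix.fromBlocks (Matrix.gram ℝ fun i => S.adjoint.toLinearMap (bW i)) 0 0
          (Matrix.gram ℝ fun i => L.toLinearMap (bD i)) := by
      ext (i | i) (j | j)
      · simp [Matrix.gram, hY]
      · have : inner ℝ (S.adjoint (bW i)) (L (bD j)) = 0 := by
          rw [ContinuousLinearMap.adjoint_inner_left, hSL, inner_zero_right]
        simpa [Matrix.gram, hY] using this
      · have : inner ℝ (L (bD i)) (S.adjoint (bW j)) = 0 := by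
          rw [ContinuousLinearMap.adjoint_inner_right, hSL, inner_zero_left]
        simpa [Matrix.gram, hY] using this
      · simp [Matrix.gram, hY]
    rw [this, Matrix.det_fromBlocks_zero₁₂]
  have hYprod : Y.toLinearMap.normDet =
      S.adjoint.toLinearMap.normDet * L.toLinearMap.normDet := by
    rw [← mul_pow] at hYsq
    exact (sq_eq_sq₀ (LinearMap.normDet_nonneg _)
      (mul_nonneg (LinearMap.normDet_nonneg _) (LinearMap.normDet_nonneg _))).1 hYsq
  -- In the coordinates of `A` the map `Y` is the identity on `D` and has `W`-block `S S*`. It is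
  -- therefore block triangular with determinant `det (S S*)`, the square of the factor of `S*`; one
  -- power cancels at the end.
  have hCdet : C.toLinearMap.normDet = S.adjoint.toLinearMap.normDet ^ 2 := by
    have h2 := S.adjoint.toLinearMap.normDet_sq_eq_det_gram bW
    simp only [RCLike.ofReal_real_eq_id, id_eq] at h2
    have hC0 : ∀ k : D, C (WithLp.toLp 2 (0, k)) = WithLp.toLp 2 (0, k) := by
      intro k
      simp [hC, hY, hL]
    have hC1 : ∀ w : W, (C (WithLp.toLp 2 (w, 0))).fst = S (S.adjoint w) := by
      intro w
      rw [← hS]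
      simp [hC, hY]
    have hmat : LinearMap.toMatrixOrthonormal (bW.prod bD) C.toLinearMap =
        Matrix.fromBlocks (Matrix.gram ℝ fun i => S.adjoint.toLinearMap (bW i)) 0
          (Matrix.of fun i j => inner ℝ (bD i) (C (WithLp.toLp 2 (bW j, 0))).snd) 1 := by
      ext (i | i) (j | j)
      · rw [LinearMap.toMatrixOrthonormal_apply_apply]
        have : inner ℝ (bW i) (C (WithLp.toLp 2 (bW j, 0))).fst =
            inner ℝ (S.adjoint (bW i)) (S.adjoint (bW j)) := by
          rw [hC1, ContinuousLinearMap.adjoint_inner_left]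
        simpa [Matrix.gram] using this
      · rw [LinearMap.toMatrixOrthonormal_apply_apply]
        simp [hC0]
      · rw [LinearMap.toMatrixOrthonormal_apply_apply]
        simp
      · rw [LinearMap.toMatrixOrthonormal_apply_apply]
        have := orthonormal_iff_ite.1 bD.orthonormal i j
        simpa [hC0, Matrix.one_apply] using this
    have hdet : LinearMap.det C.toLinearMap = S.adjoint.toLinearMap.normDet ^ 2 := by
      rw [← LinearMap.det_toMatrix (bW.prod bD).toBasis]
      change (LinearMap.toMatrixOrthonormal (bW.prod bD) C.toLinearMap).det = _
      rw [hmat, Matrix.det_fromBlocks_zero₁₂, Matrix.det_one, mul_one, h2]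
    rw [LinearMap.normDet_eq_abs_det, hdet, abs_of_nonneg (sq_nonneg _)]
  rw [hYprod, hCdet] at hYn
  have : S.adjoint.toLinearMap.normDet * L.toLinearMap.normDet = S.adjoint.toLinearMap.normDet *
      (A.toContinuousLinearMap.toLinearMap.normDet * S.adjoint.toLinearMap.normDet) := by
    rw [hYn]; ring
  exact (mul_left_cancel₀ hpos.ne' this).symm

/-- `Ψ` is a `C¹` chart with image in `X` in which `F` becomes the first projection. -/
structure IsStraightening (F : V → W) (X : Set V)
    (Ψ : OpenPartialHomeomorph (WithLp 2 (W × D)) V) : Prop where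
  target_subset : Ψ.target ⊆ X
  apply_eq_fst : ∀ p ∈ Ψ.source, F (Ψ p) = p.fst
  contDiffAt : ∀ p ∈ Ψ.source, ContDiffAt ℝ 1 Ψ p
  exists_equiv : ∀ p ∈ Ψ.source,
    ∃ A : WithLp 2 (W × D) ≃L[ℝ] V, fderiv ℝ Ψ p = A.toContinuousLinearMap

/-- A submersion is straightened by a `C¹` chart around each point. -/
theorem exists_straightening_chart {F : V → W} {X : Set V} (hX : IsOpen X)
    (hF : ContDiffOn ℝ 1 F X) (hsurj : ∀ x ∈ X, Function.Surjective (fderiv ℝ F x)) {x₀ : V}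
    (hx₀ : x₀ ∈ X) (hdim : finrank ℝ V = finrank ℝ W + finrank ℝ D) :
    ∃ Ψ : OpenPartialHomeomorph (WithLp 2 (W × D)) V, x₀ ∈ Ψ.target ∧ IsStraightening F X Ψ := by
  have hFat : ∀ x ∈ X, ContDiffAt ℝ 1 F x := fun x hx => hF.contDiffAt (hX.mem_nhds hx)
  have hFd : ∀ x ∈ X, HasFDerivAt F (fderiv ℝ F x) x := fun x hx =>
    ((hFat x hx).differentiableAt one_ne_zero).hasFDerivAt
  -- Completing `F` by the orthogonal projection onto the kernel of its derivative at `x₀` gives a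
  -- map with invertible derivative there, to which the inverse function theorem applies.
  set K : Submodule ℝ V := LinearMap.ker (fderiv ℝ F x₀).toLinearMap with hK
  have hKdim : finrank ℝ K = finrank ℝ D := by
    have h1 := LinearMap.finrank_range_add_finrank_ker (fderiv ℝ F x₀).toLinearMap
    rw [LinearMap.range_eq_top.2 (hsurj x₀ hx₀), finrank_top, hdim] at h1
    exact Nat.add_left_cancel h1
  set e : K ≃L[ℝ] D := ContinuousLinearEquiv.ofFinrankEq hKdim
  set T : V →L[ℝ] D := e.toContinuousLinearMap ∘L K.orthogonalProjectionOnto with hT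
  set ι := (WithLp.prodContinuousLinearEquiv 2 ℝ W D).symm
  set Φ : V → WithLp 2 (W × D) := fun x => ι (F x, T x) with hΦ
  set Φ' : V → V →L[ℝ] WithLp 2 (W × D) := fun x =>
    ι.toContinuousLinearMap ∘L (fderiv ℝ F x).prod T with hΦ'
  have hΦd : ∀ x ∈ X, HasFDerivAt Φ (Φ' x) x := fun x hx =>
    ι.toContinuousLinearMap.hasFDerivAt.comp x ((hFd x hx).prodMk T.hasFDerivAt)
  have hΦc : ∀ x ∈ X, ContDiffAt ℝ 1 Φ x := fun x hx =>
    ι.contDiff.contDiffAt.comp x ((hFat x hx).prodMk T.contDiff.contDiffAt)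
  have hinj : Function.Injective (Φ' x₀) := by
    rw [injective_iff_map_eq_zero]
    intro v hv
    have hv2 : (fderiv ℝ F x₀ v, T v) = 0 := by
      apply ι.injective
      rw [map_zero]
      exact hv
    have h1 : fderiv ℝ F x₀ v = 0 := congrArg Prod.fst hv2
    have h2 : T v = 0 := congrArg Prod.snd hv2
    have hvK : v ∈ K := h1
    have h3 : K.orthogonalProjectionOnto v = 0 := by
      apply e.injective
      rw [map_zero]
      exact h2
    have h4 : K.orthogonalProjectionOnto ((⟨v, hvK⟩ : K) : V) = ⟨v, hvK⟩ :=
      K.orthogonalProjectionOnto_mem_subspace_eq_self _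
    have h5 : (⟨v, hvK⟩ : K) = 0 := h4.symm.trans h3
    exact congrArg Subtype.val h5
  have hfin : finrank ℝ V = finrank ℝ (WithLp 2 (W × D)) := by
    rw [hdim, LinearEquiv.finrank_eq (WithLp.linearEquiv 2 ℝ (W × D)), finrank_prod]
  set A₀ : V ≃L[ℝ] WithLp 2 (W × D) :=
    (LinearMap.linearEquivOfInjective (Φ' x₀).toLinearMap hinj hfin).toContinuousLinearEquiv
  have hA₀ : (A₀ : V →L[ℝ] WithLp 2 (W × D)) = Φ' x₀ := by
    ext v; rfl
  have hΦ₀ : HasFDerivAt Φ (A₀ : V →L[ℝ] WithLp 2 (W × D)) x₀ := hA₀ ▸ hΦd x₀ hx₀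
  set φ₀ := (hΦc x₀ hx₀).toOpenPartialHomeomorph Φ hΦ₀ one_ne_zero with hφ₀
  have hφ₀c : (φ₀ : V → WithLp 2 (W × D)) = Φ := rfl
  have hΦ'c : ContinuousOn Φ' X := by
    have : ContinuousOn (fderiv ℝ F) X := hF.continuousOn_fderiv_of_isOpen hX le_rfl
    have h2 : ContinuousOn (fun x => (fderiv ℝ F x).prod T) X := by
      have h3 : Continuous fun B : V →L[ℝ] W => B.prod T := by
        have : (fun B : V →L[ℝ] W => B.prod T) =
          fun B => ContinuousLinearMap.inl ℝ W D ∘L B + ContinuousLinearMap.inr ℝ W D ∘L T := by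
          ext B v <;> simp
        rw [this]
        fun_prop
      exact h3.comp_continuousOn this
    exact continuousOn_const.clm_comp h2
  -- The inverse function theorem gives invertibility only at `x₀`. Shrinking to this open set makes
  -- the derivative invertible, and the inverse `C¹`, at every point of the chart.
  set N : Set V := X ∩ Φ' ⁻¹' (range ((↑) : (V ≃L[ℝ] WithLp 2 (W × D)) → V →L[ℝ] _)) with hN
  have hNo : IsOpen N := hΦ'c.isOpen_inter_preimage hX ContinuousLinearEquiv.isOpen
  set φ := φ₀.restrOpen N hNo with hφ
  have hφc : (φ : V → WithLp 2 (W × D)) = Φ := rfl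
  have hφs : φ.source = φ₀.source ∩ N := rfl
  have hsymm : ∀ p ∈ φ.symm.source, φ.symm p ∈ φ.source := fun p hp => φ.map_target hp
  refine ⟨φ.symm, ?_, ?_, ?_, ?_, ?_⟩
  · exact ⟨(hΦc x₀ hx₀).mem_toOpenPartialHomeomorph_source hΦ₀ one_ne_zero, hx₀, A₀, hA₀⟩
  · exact fun x hx => hx.2.1
  · intro p hp
    have h1 : Φ (φ.symm p) = p := φ.right_inv hp
    have h2 : (F (φ.symm p), T (φ.symm p)) = ι.symm p := by
      rw [ContinuousLinearEquiv.eq_symm_apply]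
      exact h1
    exact congrArg Prod.fst h2
  · intro p hp
    obtain ⟨-, hx, A, hA⟩ := hsymm p hp
    exact φ.contDiffAt_symm hp (f₀' := A) (hA ▸ hΦd _ hx) (hΦc _ hx)
  · intro p hp
    obtain ⟨-, hx, A, hA⟩ := hsymm p hp
    exact ⟨A.symm, (φ.hasFDerivAt_symm hp (f' := A) (hA ▸ hΦd _ hx)).fderiv⟩

end ABC

end Charts

/-! ### Integration over the fibers of a submersion -/

section Coarea

open Module Set

set_option linter.unusedSectionVars false

namespace ABC

/-- A function that is continuous on an open set and vanishes there outside of a compact subset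
extends continuously by zero. -/
theorem continuous_indicator_of_isCompact {U Z : Type*} [TopologicalSpace U] [T2Space U]
    [TopologicalSpace Z] [Zero Z] {O K : Set U} {f : U → Z} (hO : IsOpen O) (hK : IsCompact K)
    (hKO : K ⊆ O) (hf : ContinuousOn f O) (h0 : ∀ x ∈ O, x ∉ K → f x = 0) :
    Continuous (O.indicator f) := by
  rw [continuous_iff_continuousAt]
  intro x
  by_cases hx : x ∈ O
  · refine (hf.continuousAt (hO.mem_nhds hx)).congr ?_
    filter_upwards [hO.mem_nhds hx] with z hz
    rw [indicator_of_mem hz]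
  · have : O.indicator f =ᶠ[𝓝 x] fun _ => 0 := by
      filter_upwards [hK.isClosed.isOpen_compl.mem_nhds (fun h => hx (hKO h))] with z hz
      by_cases hzO : z ∈ O
      · rw [indicator_of_mem hzO, h0 z hzO hz]
      · rw [indicator_of_notMem hzO]
    exact continuousAt_const.congr this.symm

variable {V W D : Type*} [NormedAddCommGroup V] [InnerProductSpace ℝ V] [FiniteDimensional ℝ V]
  [NormedAddCommGroup W] [InnerProductSpace ℝ W] [FiniteDimensional ℝ W]
  [NormedAddCommGroup D] [InnerProductSpace ℝ D] [FiniteDimensional ℝ D]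

/-- The Jacobian `det(F' F'ᵀ)^{1/2}` of a submersion `F`. -/
noncomputable def coareaFactor (F : V → W) (x : V) : ℝ :=
  (fderiv ℝ F x).adjoint.toLinearMap.normDet

theorem adjoint_injective_of_surjective {S : V →L[ℝ] W} (hS : Function.Surjective S) :
    Function.Injective S.adjoint := by
  rw [injective_iff_map_eq_zero]
  intro w hw
  obtain ⟨v, rfl⟩ := hS w
  have : inner ℝ (S v) (S v) = 0 := by
    rw [← ContinuousLinearMap.adjoint_inner_right, hw, inner_zero_right]
  exact inner_self_eq_zero.1 this

theorem coareaFactor_pos {F : V → W} {x : V} (h : Function.Surjective (fderiv ℝ F x)) :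
    0 < coareaFactor F x :=
  normDet_pos (adjoint_injective_of_surjective h)

theorem continuousOn_coareaFactor {F : V → W} {X : Set V} (hX : IsOpen X)
    (hF : ContDiffOn ℝ 1 F X) : ContinuousOn (coareaFactor F) X :=
  continuous_normDet.comp_continuousOn
    ((ContinuousLinearMap.adjoint (𝕜 := ℝ) (E := V) (F := W)).continuous.comp_continuousOn
      (hF.continuousOn_fderiv_of_isOpen hX le_rfl))

namespace IsStraightening

variable {F : V → W} {X : Set V} {Ψ : OpenPartialHomeomorph (WithLp 2 (W × D)) V}

theorem hasStrictFDerivAt (h : IsStraightening F X Ψ) {p : WithLp 2 (W × D)} (hp : p ∈ Ψ.source) :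
    HasStrictFDerivAt Ψ (fderiv ℝ Ψ p) p :=
  (h.contDiffAt p hp).hasStrictFDerivAt one_ne_zero

theorem continuousOn_fderiv (h : IsStraightening F X Ψ) :
    ContinuousOn (fderiv ℝ Ψ) Ψ.source := fun p hp =>
  ((h.contDiffAt p hp).continuousAt_fderiv one_ne_zero).continuousWithinAt

theorem fderiv_injective (h : IsStraightening F X Ψ) {p : WithLp 2 (W × D)} (hp : p ∈ Ψ.source) :
    Function.Injective (fderiv ℝ Ψ p) := by
  obtain ⟨A, hA⟩ := h.exists_equiv p hp
  rw [hA]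
  exact A.injective

theorem fderiv_apply_fderiv (h : IsStraightening F X Ψ) (hF : DifferentiableOn ℝ F X)
    (hX : IsOpen X) {p : WithLp 2 (W × D)} (hp : p ∈ Ψ.source) (v : WithLp 2 (W × D)) :
    fderiv ℝ F (Ψ p) (fderiv ℝ Ψ p v) = v.fst := by
  have hx : Ψ p ∈ X := h.target_subset (Ψ.map_source hp)
  have h1 : HasFDerivAt (F ∘ Ψ) ((fderiv ℝ F (Ψ p)) ∘L (fderiv ℝ Ψ p)) p :=
    ((hF _ hx).differentiableAt (hX.mem_nhds hx)).hasFDerivAt.comp p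
      (h.hasStrictFDerivAt hp).hasFDerivAt
  have h2 : HasFDerivAt (F ∘ Ψ) (WithLp.fstL 2 ℝ W D) p := by
    refine (WithLp.fstL 2 ℝ W D).hasFDerivAt.congr_of_eventuallyEq ?_
    filter_upwards [Ψ.open_source.mem_nhds hp] with z hz
    exact h.apply_eq_fst z hz
  exact congrArg (fun L => L v) (h1.unique h2)

/-- The linear identity for straightening charts, applied to the derivatives of `Ψ` and `F`; it
makes the fiber integral and the full integral carry the same density in chart coordinates. -/
theorem normDet_mul_coareaFactor (h : IsStraightening F X Ψ) (hF : DifferentiableOn ℝ F X)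
    (hX : IsOpen X) {p : WithLp 2 (W × D)} (hp : p ∈ Ψ.source) :
    (fderiv ℝ Ψ p).toLinearMap.normDet * coareaFactor F (Ψ p) =
      (fderiv ℝ Ψ p ∘L sndIncl W D).toLinearMap.normDet := by
  obtain ⟨A, hA⟩ := h.exists_equiv p hp
  have := normDet_mul_normDet_adjoint A (fderiv ℝ F (Ψ p)) fun v => by
    have := h.fderiv_apply_fderiv hF hX hp v
    rwa [hA] at this
  rw [hA]
  exact this

/-- The part of a chart that lies over `w`. -/
def slice (Ψ : OpenPartialHomeomorph (WithLp 2 (W × D)) V) (w : W) : Set D :=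
  {k | WithLp.toLp 2 (w, k) ∈ Ψ.source}

theorem continuous_toLp_right (w : W) : Continuous fun k : D => WithLp.toLp 2 (w, k) :=
  (WithLp.prodContinuousLinearEquiv 2 ℝ W D).symm.continuous.comp
    (continuous_const.prodMk continuous_id)

theorem isOpen_slice (w : W) : IsOpen (slice Ψ w) :=
  Ψ.open_source.preimage (continuous_toLp_right w)

theorem hasStrictFDerivAt_slice (h : IsStraightening F X Ψ) {w : W} {k : D} (hk : k ∈ slice Ψ w) :
    HasStrictFDerivAt (fun k => Ψ (WithLp.toLp 2 (w, k)))
      (fderiv ℝ Ψ (WithLp.toLp 2 (w, k)) ∘L sndIncl W D) k := by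
  have h1 : HasStrictFDerivAt (fun k : D => WithLp.toLp 2 (w, k)) (sndIncl W D) k := by
    have : (fun k : D => WithLp.toLp 2 (w, k)) =
        fun k => WithLp.toLp 2 (w, 0) + sndIncl W D k := by
      funext k
      rw [sndIncl_apply, ← WithLp.toLp_add]
      simp
    rw [this]
    exact (sndIncl W D).hasStrictFDerivAt.const_add _
  exact (h.hasStrictFDerivAt hk).comp k h1

theorem continuousOn_fderiv_slice (h : IsStraightening F X Ψ) (w : W) :
    ContinuousOn (fun k => fderiv ℝ Ψ (WithLp.toLp 2 (w, k)) ∘L sndIncl W D) (slice Ψ w) := by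
  refine ContinuousOn.clm_comp ?_ continuousOn_const
  exact h.continuousOn_fderiv.comp (continuous_toLp_right w).continuousOn fun k hk => hk

theorem fderiv_slice_injective (h : IsStraightening F X Ψ) {w : W} {k : D}
    (hk : k ∈ slice Ψ w) :
    Function.Injective (fderiv ℝ Ψ (WithLp.toLp 2 (w, k)) ∘L sndIncl W D) :=
  (h.fderiv_injective hk).comp sndIncl_injective

theorem injOn_slice (w : W) : InjOn (fun k => Ψ (WithLp.toLp 2 (w, k))) (slice Ψ w) := by
  intro a ha b hb hab
  have := Ψ.injOn ha hb hab
  simpa using this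

theorem image_slice (h : IsStraightening F X Ψ) (w : W) :
    (fun k => Ψ (WithLp.toLp 2 (w, k))) '' slice Ψ w = Ψ.target ∩ F ⁻¹' {w} := by
  ext x
  constructor
  · rintro ⟨k, hk, rfl⟩
    exact ⟨Ψ.map_source hk, h.apply_eq_fst _ hk⟩
  · rintro ⟨hx, hw⟩
    have hp := Ψ.map_target hx
    have h1 := h.apply_eq_fst _ hp
    rw [Ψ.right_inv hx, hw] at h1
    have h2 : WithLp.toLp 2 (w, (Ψ.symm x).snd) = Ψ.symm x := by
      rw [h1]; rfl
    refine ⟨(Ψ.symm x).snd, ?_, ?_⟩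
    · change _ ∈ Ψ.source
      rw [h2]
      exact hp
    · change Ψ _ = x
      rw [h2, Ψ.right_inv hx]

variable [MeasurableSpace V] [BorelSpace V] [MeasurableSpace W] [BorelSpace W]
  [MeasurableSpace D] [BorelSpace D]

/-- The area formula along a slice produces the Jacobian of the slice, which is the Jacobian of the
chart times the coarea factor. The weight `coareaFactor⁻¹` removes the latter. -/
theorem lintegral_fiber (h : IsStraightening F X Ψ) (hF : DifferentiableOn ℝ F X)
    (hX : IsOpen X) (hsurj : ∀ x ∈ X, Function.Surjective (fderiv ℝ F x)) (w : W)
    (g : V → ℝ≥0∞) :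
    ∫⁻ x in Ψ.target ∩ F ⁻¹' {w}, g x * (ENNReal.ofReal (coareaFactor F x))⁻¹
        ∂(Measure.euclideanHausdorffMeasure (finrank ℝ D)) =
      ∫⁻ k in slice Ψ w, ENNReal.ofReal (fderiv ℝ Ψ (WithLp.toLp 2 (w, k))).toLinearMap.normDet *
        g (Ψ (WithLp.toLp 2 (w, k))) := by
  rw [← h.image_slice w, lintegral_image_eq_lintegral_normDet_mul (isOpen_slice w).measurableSet
    (fun k hk => h.hasStrictFDerivAt_slice hk) (h.continuousOn_fderiv_slice w)
    (fun k hk => h.fderiv_slice_injective hk) (injOn_slice w)]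
  refine setLIntegral_congr_fun (isOpen_slice w).measurableSet fun k hk => ?_
  have hx : Ψ (WithLp.toLp 2 (w, k)) ∈ X := h.target_subset (Ψ.map_source hk)
  have hpos := coareaFactor_pos (hsurj _ hx)
  have hne : ENNReal.ofReal (coareaFactor F (Ψ (WithLp.toLp 2 (w, k)))) ≠ 0 := by simpa using hpos
  rw [← h.normDet_mul_coareaFactor hF hX hk, ENNReal.ofReal_mul (LinearMap.normDet_nonneg _),
    mul_comm (g _), ← mul_assoc, mul_assoc (ENNReal.ofReal _) (ENNReal.ofReal _),
    ENNReal.mul_inv_cancel hne ENNReal.ofReal_ne_top, mul_one]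

/-- The area formula in full dimension, where the normalized Hausdorff measure is the volume. -/
theorem lintegral_target (h : IsStraightening F X Ψ)
    (hdim : finrank ℝ V = finrank ℝ W + finrank ℝ D) (g : V → ℝ≥0∞) :
    ∫⁻ x in Ψ.target, g x =
      ∫⁻ p in Ψ.source, ENNReal.ofReal (fderiv ℝ Ψ p).toLinearMap.normDet * g (Ψ p) := by
  have hfin : finrank ℝ (WithLp 2 (W × D)) = finrank ℝ V := by
    rw [hdim, LinearEquiv.finrank_eq (WithLp.linearEquiv 2 ℝ (W × D)), finrank_prod]
  have := lintegral_image_eq_lintegral_normDet_mul Ψ.open_source.measurableSet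
    (fun p hp => h.hasStrictFDerivAt hp) h.continuousOn_fderiv
    (fun p hp => h.fderiv_injective hp) Ψ.injOn g
  rwa [Ψ.image_source_eq_target, hfin,
    InnerProductSpace.euclideanHausdorffMeasure_eq_volume] at this

end IsStraightening

/-- The integral of `h / coareaFactor F` over the fiber of `F` over `w`. -/
noncomputable def fiberIntegral [MeasurableSpace V] [BorelSpace V] (F : V → W) (X : Set V) (d : ℕ)
    (h : V → ℝ≥0∞) (w : W) : ℝ≥0∞ :=
  ∫⁻ x in X ∩ F ⁻¹' {w}, h x * (ENNReal.ofReal (coareaFactor F x))⁻¹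
    ∂(Measure.euclideanHausdorffMeasure d)

variable [MeasurableSpace V] [BorelSpace V] [MeasurableSpace W] [BorelSpace W]
  [MeasurableSpace D] [BorelSpace D]

/-- Integrating a compactly supported continuous function over one of two variables. -/
theorem continuous_lintegral_toLp {κ : WithLp 2 (W × D) → ℝ} (hκ : Continuous κ)
    (hc : HasCompactSupport κ) (h0 : ∀ p, 0 ≤ κ p) :
    (Continuous fun w => ∫⁻ k, ENNReal.ofReal (κ (WithLp.toLp 2 (w, k)))) ∧
      ∀ w, ∫⁻ k, ENNReal.ofReal (κ (WithLp.toLp 2 (w, k))) < ∞ := by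
  -- Outside this projection of the support the integrand vanishes for all `w` at once, so the
  -- parameter integral runs over one fixed compact set and depends continuously on `w`.
  set K : Set D := (WithLp.sndL 2 ℝ W D) '' tsupport κ with hK
  have hKc : IsCompact K := hc.isCompact.image (WithLp.sndL 2 ℝ W D).continuous
  have hcont : Continuous fun z : W × D => κ (WithLp.toLp 2 z) :=
    hκ.comp (WithLp.prodContinuousLinearEquiv 2 ℝ W D).symm.continuous
  have hz : ∀ w, ∀ k ∉ K, κ (WithLp.toLp 2 (w, k)) = 0 := by
    intro w k hk
    by_contra hne
    exact hk ⟨WithLp.toLp 2 (w, k), subset_tsupport κ hne, rfl⟩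
  have hint : ∀ w, IntegrableOn (fun k => κ (WithLp.toLp 2 (w, k))) K := fun w =>
    (hcont.comp (continuous_const.prodMk continuous_id)).continuousOn.integrableOn_compact hKc
  have heq : ∀ w, ∫⁻ k, ENNReal.ofReal (κ (WithLp.toLp 2 (w, k))) =
      ENNReal.ofReal (∫ k in K, κ (WithLp.toLp 2 (w, k))) := by
    intro w
    rw [ofReal_integral_eq_lintegral_ofReal (hint w) (Eventually.of_forall fun k => h0 _)]
    refine (setLIntegral_eq_of_support_subset fun k hk => ?_).symm
    by_contra hkK
    exact hk (by simp [hz w k hkK])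
  simp_rw [heq]
  exact ⟨ENNReal.continuous_ofReal.comp
    (continuous_parametric_integral_of_continuous (f := fun w k => κ (WithLp.toLp 2 (w, k)))
      hcont hKc), fun w => ENNReal.ofReal_lt_top⟩

/-- The coarea formula for a function supported in a chart. -/
theorem IsStraightening.coarea {F : V → W} {X : Set V}
    {Ψ : OpenPartialHomeomorph (WithLp 2 (W × D)) V} (h : IsStraightening F X Ψ)
    (hF : DifferentiableOn ℝ F X) (hX : IsOpen X)
    (hsurj : ∀ x ∈ X, Function.Surjective (fderiv ℝ F x))
    (hdim : finrank ℝ V = finrank ℝ W + finrank ℝ D) {ψ : V → ℝ} (hψ : Continuous ψ)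
    (hc : HasCompactSupport ψ) (hsupp : tsupport ψ ⊆ Ψ.target) (h0 : ∀ x, 0 ≤ ψ x) :
    Continuous (fiberIntegral F X (finrank ℝ D) fun x => ENNReal.ofReal (ψ x)) ∧
    (∀ w, fiberIntegral F X (finrank ℝ D) (fun x => ENNReal.ofReal (ψ x)) w < ∞) ∧
    ∀ g : W → ℝ≥0∞, Measurable g → ∫⁻ x in X, ENNReal.ofReal (ψ x) * g (F x) =
      ∫⁻ w, g w * fiberIntegral F X (finrank ℝ D) (fun x => ENNReal.ofReal (ψ x)) w := by
  have hψ0 : ∀ x ∉ Ψ.target, ψ x = 0 := fun x hx => image_eq_zero_of_notMem_tsupport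
    fun h' => hx (hsupp h')
  -- In chart coordinates all integrals are integrals of this function, extended by zero. Fiber
  -- integrals become integrals over the second variable, and the coarea formula becomes Tonelli's
  -- theorem.
  set κ₀ : WithLp 2 (W × D) → ℝ := fun p => (fderiv ℝ Ψ p).toLinearMap.normDet * ψ (Ψ p) with hκ₀
  set κ : WithLp 2 (W × D) → ℝ := Ψ.source.indicator κ₀ with hκ
  have hKc : IsCompact (Ψ.symm '' tsupport ψ) :=
    hc.isCompact.image_of_continuousOn (Ψ.continuousOn_symm.mono hsupp)
  have hKs : Ψ.symm '' tsupport ψ ⊆ Ψ.source := by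
    rintro _ ⟨x, hx, rfl⟩
    exact Ψ.map_target (hsupp hx)
  have hκ0 : ∀ p ∈ Ψ.source, p ∉ Ψ.symm '' tsupport ψ → κ₀ p = 0 := by
    intro p hp hpK
    have : Ψ p ∉ tsupport ψ := fun hx => hpK ⟨Ψ p, hx, Ψ.left_inv hp⟩
    simp [hκ₀, image_eq_zero_of_notMem_tsupport this]
  have hκcont : Continuous κ := by
    refine continuous_indicator_of_isCompact Ψ.open_source hKc hKs ?_ hκ0
    exact (continuous_normDet.comp_continuousOn h.continuousOn_fderiv).mul
      (hψ.comp_continuousOn Ψ.continuousOn)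
  have hκsupp : HasCompactSupport κ := by
    refine HasCompactSupport.intro hKc fun p hp => ?_
    by_cases hps : p ∈ Ψ.source
    · rw [hκ, indicator_of_mem hps, hκ0 p hps hp]
    · rw [hκ, indicator_of_notMem hps]
  have hκnn : ∀ p, 0 ≤ κ p := fun p =>
    indicator_nonneg (fun p _ => mul_nonneg (LinearMap.normDet_nonneg _) (h0 _)) p
  have hfib : ∀ w, fiberIntegral F X (finrank ℝ D) (fun x => ENNReal.ofReal (ψ x)) w =
      ∫⁻ k, ENNReal.ofReal (κ (WithLp.toLp 2 (w, k))) := by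
    intro w
    have h1 : fiberIntegral F X (finrank ℝ D) (fun x => ENNReal.ofReal (ψ x)) w =
        ∫⁻ x in Ψ.target ∩ F ⁻¹' {w}, ENNReal.ofReal (ψ x) *
          (ENNReal.ofReal (coareaFactor F x))⁻¹
          ∂(Measure.euclideanHausdorffMeasure (finrank ℝ D)) := by
      rw [fiberIntegral]
      have hsub : Ψ.target ∩ (X ∩ F ⁻¹' {w}) = Ψ.target ∩ F ⁻¹' {w} := by
        rw [← inter_assoc, inter_eq_left.2 h.target_subset]
      rw [← hsub, ← Measure.restrict_restrict Ψ.open_target.measurableSet]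
      refine (setLIntegral_eq_of_support_subset fun x hx => ?_).symm
      by_contra hxt
      exact hx (by simp [hψ0 x hxt])
    rw [h1, h.lintegral_fiber hF hX hsurj w]
    have hm : MeasurableSet (IsStraightening.slice Ψ w) :=
      (IsStraightening.isOpen_slice w).measurableSet
    rw [← lintegral_indicator hm]
    refine lintegral_congr fun k => ?_
    by_cases hk : k ∈ IsStraightening.slice Ψ w
    · have hk' : WithLp.toLp 2 (w, k) ∈ Ψ.source := hk
      rw [indicator_of_mem hk, hκ, indicator_of_mem hk', hκ₀,
        ENNReal.ofReal_mul (LinearMap.normDet_nonneg _)]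
    · have hk' : WithLp.toLp 2 (w, k) ∉ Ψ.source := hk
      rw [indicator_of_notMem hk, hκ, indicator_of_notMem hk', ENNReal.ofReal_zero]
  obtain ⟨c1, c2⟩ := continuous_lintegral_toLp hκcont hκsupp hκnn
  refine ⟨?_, ?_, ?_⟩
  · rw [funext hfib]
    exact c1
  · intro w
    rw [hfib]
    exact c2 w
  · intro g hg
    have hl : ∫⁻ x in X, ENNReal.ofReal (ψ x) * g (F x) =
        ∫⁻ x in Ψ.target, ENNReal.ofReal (ψ x) * g (F x) := by
      rw [← inter_eq_left.2 h.target_subset,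
        ← Measure.restrict_restrict Ψ.open_target.measurableSet]
      refine (setLIntegral_eq_of_support_subset fun x hx => ?_).symm
      by_contra hxt
      exact hx (by simp [hψ0 x hxt])
    have hr : ∫⁻ p in Ψ.source, ENNReal.ofReal (fderiv ℝ Ψ p).toLinearMap.normDet *
        (ENNReal.ofReal (ψ (Ψ p)) * g (F (Ψ p))) = ∫⁻ p, ENNReal.ofReal (κ p) * g p.fst := by
      rw [← lintegral_indicator Ψ.open_source.measurableSet]
      refine lintegral_congr fun p => ?_
      by_cases hp : p ∈ Ψ.source
      · rw [indicator_of_mem hp, hκ, indicator_of_mem hp, hκ₀, h.apply_eq_fst p hp,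
          ENNReal.ofReal_mul (LinearMap.normDet_nonneg _), mul_assoc]
      · rw [indicator_of_notMem hp, hκ, indicator_of_notMem hp, ENNReal.ofReal_zero, zero_mul]
    have hmeas : Measurable fun z : W × D => ENNReal.ofReal (κ (WithLp.toLp 2 z)) * g z.1 := by
      refine Measurable.mul ?_ (hg.comp measurable_fst)
      exact (ENNReal.continuous_ofReal.comp (hκcont.comp
        (WithLp.prodContinuousLinearEquiv 2 ℝ W D).symm.continuous)).measurable
    rw [hl, h.lintegral_target hdim, hr]
    have hpres := WithLp.volume_preserving_toLp W D
    have hemb : MeasurableEmbedding (WithLp.toLp 2 : W × D → WithLp 2 (W × D)) :=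
      (MeasurableEquiv.toLp 2 (W × D)).measurableEmbedding
    rw [← hpres.map_eq, hemb.lintegral_map, Measure.volume_eq_prod]
    refine (lintegral_prod _ hmeas.aemeasurable).trans ?_
    refine lintegral_congr fun w => ?_
    rw [hfib w, mul_comm, ← lintegral_mul_const]
    exact (ENNReal.continuous_ofReal.comp (hκcont.comp
      (IsStraightening.continuous_toLp_right w))).measurable

theorem aemeasurable_fiberIntegrand {F : V → W} {X : Set V} (hX : IsOpen X)
    (hF : ContDiffOn ℝ 1 F X) {h : V → ℝ≥0∞} (hh : Measurable h) (d : ℕ) (w : W) :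
    AEMeasurable (fun x => h x * (ENNReal.ofReal (coareaFactor F x))⁻¹)
      ((Measure.euclideanHausdorffMeasure d).restrict (X ∩ F ⁻¹' {w})) := by
  have h1 : AEMeasurable (fun x => h x * (ENNReal.ofReal (coareaFactor F x))⁻¹)
      ((Measure.euclideanHausdorffMeasure d).restrict X) :=
    hh.aemeasurable.mul (((continuousOn_coareaFactor hX hF).aemeasurable
      hX.measurableSet).ennreal_ofReal.inv)
  exact h1.mono_measure (Measure.restrict_mono inter_subset_left le_rfl)

/-- The coarea formula for compactly supported continuous functions; the integrals over the fibers
are finite and depend continuously on the fiber. -/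
theorem coarea_of_hasCompactSupport {F : V → W} {X : Set V} (hX : IsOpen X)
    (hF : ContDiffOn ℝ 1 F X) (hsurj : ∀ x ∈ X, Function.Surjective (fderiv ℝ F x)) {d : ℕ}
    (hdim : finrank ℝ V = finrank ℝ W + d) {ψ : V → ℝ} (hψ : Continuous ψ)
    (hc : HasCompactSupport ψ) (hsupp : tsupport ψ ⊆ X) (h0 : ∀ x, 0 ≤ ψ x) :
    Continuous (fiberIntegral F X d fun x => ENNReal.ofReal (ψ x)) ∧
    (∀ w, fiberIntegral F X d (fun x => ENNReal.ofReal (ψ x)) w < ∞) ∧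
    ∀ g : W → ℝ≥0∞, Measurable g → ∫⁻ x in X, ENNReal.ofReal (ψ x) * g (F x) =
      ∫⁻ w, g w * fiberIntegral F X d (fun x => ENNReal.ofReal (ψ x)) w := by
  have hD : finrank ℝ (EuclideanSpace ℝ (Fin d)) = d := finrank_euclideanSpace_fin
  have hdim' : finrank ℝ V = finrank ℝ W + finrank ℝ (EuclideanSpace ℝ (Fin d)) := by rw [hD, hdim]
  have hFd : DifferentiableOn ℝ F X := hF.differentiableOn one_ne_zero
  have hchart := fun x : tsupport ψ =>
    exists_straightening_chart (D := EuclideanSpace ℝ (Fin d)) hX hF hsurj (hsupp x.2) hdim'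
  choose Ψ hxΨ hΨ using hchart
  obtain ⟨T, hT⟩ := hc.isCompact.elim_finite_subcover (fun x => (Ψ x).target)
    (fun x => (Ψ x).open_target) fun x hx => mem_iUnion.2 ⟨⟨x, hx⟩, hxΨ _⟩
  set e := T.equivFin.symm with he
  -- A partition of unity on the support of `ψ` splits it into finitely many functions, each
  -- supported in one chart.
  obtain ⟨η, hη1, hη2, hη3, hη4⟩ := exists_continuous_sum_one_of_isOpen_isCompact
    (s := fun i => (Ψ (e i)).target) (fun i => (Ψ (e i)).open_target) hc.isCompact
    (by
      intro x hx
      obtain ⟨i, hi, hxi⟩ := mem_iUnion₂.1 (hT hx)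
      refine mem_iUnion.2 ⟨e.symm ⟨i, hi⟩, ?_⟩
      simpa using hxi)
  have hloc := fun i => (hΨ (e i)).coarea (ψ := fun x => η i x * ψ x) hFd hX hsurj hdim'
    ((η i).continuous.mul hψ) hc.mul_left
    ((tsupport_mul_subset_left).trans (hη1 i)) fun x => mul_nonneg (hη3 i x).1 (h0 x)
  rw [hD] at hloc
  have hsum : ∀ x, ENNReal.ofReal (ψ x) = ∑ i, ENNReal.ofReal (η i x * ψ x) := by
    intro x
    rw [← ENNReal.ofReal_sum_of_nonneg fun i _ => mul_nonneg (hη3 i x).1 (h0 x), ← Finset.sum_mul]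
    by_cases hx : x ∈ tsupport ψ
    · have := hη2 hx
      simp only [Finset.sum_apply, Pi.one_apply] at this
      rw [this, one_mul]
    · rw [image_eq_zero_of_notMem_tsupport hx, mul_zero]
  have hmeas : ∀ i, Measurable fun x => ENNReal.ofReal (η i x * ψ x) := fun i =>
    (ENNReal.continuous_ofReal.comp ((η i).continuous.mul hψ)).measurable
  have hfib : ∀ w, fiberIntegral F X d (fun x => ENNReal.ofReal (ψ x)) w =
      ∑ i, fiberIntegral F X d (fun x => ENNReal.ofReal (η i x * ψ x)) w := by
    intro w
    simp only [fiberIntegral]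
    rw [← lintegral_finsetSum' _ fun i _ => aemeasurable_fiberIntegrand hX hF (hmeas i) d w]
    refine lintegral_congr fun x => ?_
    rw [hsum, Finset.sum_mul]
  refine ⟨?_, ?_, ?_⟩
  · rw [funext hfib]
    exact continuous_finsetSum _ fun i _ => (hloc i).1
  · intro w
    rw [hfib]
    exact ENNReal.sum_lt_top.2 fun i _ => (hloc i).2.1 w
  · intro g hg
    have hgF : AEMeasurable (fun x => g (F x)) (volume.restrict X) :=
      hg.comp_aemeasurable (hF.continuousOn.aemeasurable hX.measurableSet)
    simp_rw [hfib, hsum, Finset.sum_mul, Finset.mul_sum]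
    refine (lintegral_finsetSum' _ fun i _ => (hmeas i).aemeasurable.mul hgF).trans ?_
    refine Eq.trans ?_ (lintegral_finsetSum _ fun i _ => hg.mul (hloc i).1.measurable).symm
    exact Finset.sum_congr rfl fun i _ => (hloc i).2.2 g hg

end ABC

end Coarea

/-! ### Consequences of the coarea formula -/

section CoareaConsequences

open Module Set

set_option linter.unusedSectionVars false

namespace ABC

/-- A sequence of continuous cutoff functions that exhausts the open set `X`. -/
structure IsCutoffSeq {V : Type*} [TopologicalSpace V] (X : Set V) (χ : ℕ → V → ℝ) : Prop where
  continuous : ∀ k, Continuous (χ k)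
  hasCompactSupport : ∀ k, HasCompactSupport (χ k)
  tsupport_subset : ∀ k, tsupport (χ k) ⊆ X
  nonneg : ∀ k x, 0 ≤ χ k x
  le_one : ∀ k x, χ k x ≤ 1
  mono : ∀ x, Monotone fun k => χ k x
  eq_one : ∀ K, IsCompact K → K ⊆ X → ∃ k, ∀ x ∈ K, χ k x = 1

/-- Urysohn functions for a compact exhaustion: the `n`-th is `1` on `K n` and `0` off the interior
of `K (n + 1)`. Monotonicity follows, because the next one is already `1` wherever this one can be
nonzero. -/
theorem exists_isCutoffSeq {V : Type*} [TopologicalSpace V] [LocallyCompactSpace V] [T2Space V]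
    [SecondCountableTopology V] {X : Set V} (hX : IsOpen X) :
    ∃ χ : ℕ → V → ℝ, IsCutoffSeq X χ := by
  have : LocallyCompactSpace X := hX.locallyCompactSpace
  set E : CompactExhaustion X := CompactExhaustion.choice X
  set K : ℕ → Set V := fun n => (↑) '' E n with hK
  have hKc : ∀ n, IsCompact (K n) := fun n => (E.isCompact n).image continuous_subtype_val
  have hKX : ∀ n, K n ⊆ X := fun n => by rintro _ ⟨x, -, rfl⟩; exact x.2
  have hKint : ∀ n, K n ⊆ interior (K (n + 1)) := fun n => by
    rintro _ ⟨x, hx, rfl⟩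
    exact hX.isOpenMap_subtype_val.image_interior_subset _ ⟨x, E.subset_interior_succ n hx, rfl⟩
  have hex := fun n => exists_continuous_one_zero_of_isCompact (hKc n)
    (isOpen_interior (s := K (n + 1))).isClosed_compl
    (disjoint_compl_right_iff_subset.2 (hKint n))
  choose χ h1 h0 hc hI using hex
  have hts : ∀ n, tsupport (χ n) ⊆ K (n + 1) := fun n => by
    refine closure_minimal (fun x hx => ?_) (hKc (n + 1)).isClosed
    by_contra hxK
    exact hx (h0 n fun h => hxK (interior_subset h))
  refine ⟨fun n => χ n, fun n => (χ n).continuous, hc, fun n => (hts n).trans (hKX _),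
    fun n x => (hI n x).1, fun n x => (hI n x).2, fun x => monotone_nat_of_le_succ fun n => ?_, ?_⟩
  · by_cases hx : x ∈ K (n + 1)
    · have := h1 (n + 1) hx
      simp only [Pi.one_apply] at this
      simp only [this]
      exact (hI n x).2
    · have := h0 n fun h => hx (interior_subset h)
      simp only [Pi.zero_apply] at this
      simp only [this]
      exact (hI (n + 1) x).1
  · intro C hC hCX
    have hC' : IsCompact ((↑) ⁻¹' C : Set X) :=
      (IsInducing.subtypeVal.isCompact_preimage_iff (by simpa using hCX)).2 hC
    obtain ⟨n, hn⟩ := E.exists_superset_of_isCompact hC'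
    exact ⟨n, fun x hx => h1 n ⟨⟨x, hCX hx⟩, hn hx, rfl⟩⟩

namespace IsCutoffSeq

variable {V : Type*} [TopologicalSpace V] {X : Set V} {χ : ℕ → V → ℝ}

theorem eventually_eq_one (h : IsCutoffSeq X χ) {x : V} (hx : x ∈ X) : ∃ k, χ k x = 1 := by
  obtain ⟨k, hk⟩ := h.eq_one {x} isCompact_singleton (singleton_subset_iff.2 hx)
  exact ⟨k, hk x rfl⟩

theorem eq_zero_of_notMem (h : IsCutoffSeq X χ) {k : ℕ} {x : V} (hx : x ∉ X) : χ k x = 0 :=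
  image_eq_zero_of_notMem_tsupport fun hx' => hx (h.tsupport_subset k hx')

theorem continuous_mul [T2Space V] (h : IsCutoffSeq X χ) (hX : IsOpen X) {b : V → ℝ}
    (hb : ContinuousOn b X) (k : ℕ) : Continuous fun x => χ k x * b x := by
  have : (fun x => χ k x * b x) = X.indicator fun x => χ k x * b x := by
    funext x
    by_cases hx : x ∈ X
    · rw [indicator_of_mem hx]
    · rw [indicator_of_notMem hx, h.eq_zero_of_notMem hx, zero_mul]
  rw [this]
  refine continuous_indicator_of_isCompact hX (h.hasCompactSupport k) (h.tsupport_subset k)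
    ((h.continuous k).continuousOn.mul hb) fun x _ hx => ?_
  rw [image_eq_zero_of_notMem_tsupport hx, zero_mul]

theorem hasCompactSupport_mul (h : IsCutoffSeq X χ) (b : V → ℝ) (k : ℕ) :
    HasCompactSupport fun x => χ k x * b x :=
  (h.hasCompactSupport k).mul_right

theorem tsupport_mul_subset (h : IsCutoffSeq X χ) (b : V → ℝ) (k : ℕ) :
    tsupport (fun x => χ k x * b x) ⊆ X :=
  tsupport_mul_subset_left.trans (h.tsupport_subset k)

theorem mul_nonneg (h : IsCutoffSeq X χ) {b : V → ℝ} (hb : ∀ x ∈ X, 0 ≤ b x) (k : ℕ) (x : V) :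
    0 ≤ χ k x * b x := by
  by_cases hx : x ∈ X
  · exact _root_.mul_nonneg (h.nonneg k x) (hb x hx)
  · rw [h.eq_zero_of_notMem hx, zero_mul]

theorem iSup_ofReal (h : IsCutoffSeq X χ) {x : V} (hx : x ∈ X) :
    ⨆ k, ENNReal.ofReal (χ k x) = 1 := by
  refine le_antisymm (iSup_le fun k => ENNReal.ofReal_le_one.2 (h.le_one k x)) ?_
  obtain ⟨k, hk⟩ := h.eventually_eq_one hx
  exact le_iSup_of_le k (by simp [hk])

/-- Monotone convergence; it reduces statements about measures carried by `X` to compactly supported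
integrands. -/
theorem lintegral_eq_iSup [MeasurableSpace V] [OpensMeasurableSpace V] (h : IsCutoffSeq X χ)
    {μ : Measure V} (hμ : ∀ᵐ x ∂μ, x ∈ X) {f : V → ℝ≥0∞} (hf : AEMeasurable f μ) :
    ∫⁻ x, f x ∂μ = ⨆ k, ∫⁻ x, ENNReal.ofReal (χ k x) * f x ∂μ := by
  refine Eq.trans ?_ (lintegral_iSup'
    (fun k => (h.continuous k).measurable.ennreal_ofReal.aemeasurable.mul hf)
    (Eventually.of_forall fun x i j hij => mul_le_mul_left
      (ENNReal.ofReal_le_ofReal (h.mono x hij)) _))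
  refine lintegral_congr_ae (hμ.mono fun x hx => ?_)
  change f x = ⨆ k, ENNReal.ofReal (χ k x) * f x
  rw [← ENNReal.iSup_mul, h.iSup_ofReal hx, one_mul]

end IsCutoffSeq

section Average

variable {W : Type*} [NormedAddCommGroup W] [InnerProductSpace ℝ W] [FiniteDimensional ℝ W]
  [MeasurableSpace W] [BorelSpace W]

theorem volume_closedBall_pos_lt_top (y : W) {ε : ℝ} (hε : 0 < ε) :
    volume (Metric.closedBall y ε) ≠ 0 ∧ volume (Metric.closedBall y ε) ≠ ∞ :=
  ⟨(Metric.measure_closedBall_pos volume y hε).ne', measure_closedBall_lt_top.ne⟩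

/-- The averages of a continuous function over small balls converge to its value. -/
theorem tendsto_setLIntegral_closedBall_div {H : W → ℝ≥0∞} {y : W} (hH : ContinuousAt H y) :
    Tendsto (fun ε : ℝ => (∫⁻ w in Metric.closedBall y ε, H w) / volume (Metric.closedBall y ε))
      (𝓝[>] 0) (𝓝 (H y)) := by
  have hball : ∀ {p : W → Prop}, (∀ᶠ w in 𝓝 y, p w) →
      ∀ᶠ ε : ℝ in 𝓝[>] 0, ∀ w ∈ Metric.closedBall y ε, p w := by
    intro p hp
    obtain ⟨r, hr, hr'⟩ := Metric.nhds_basis_closedBall.eventually_iff.1 hp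
    filter_upwards [Ioo_mem_nhdsGT hr] with ε hε w hw
    exact hr' (Metric.closedBall_subset_closedBall hε.2.le hw)
  refine tendsto_order.2 ⟨fun c hc => ?_, fun c hc => ?_⟩
  · obtain ⟨c', hcc', hc'⟩ := exists_between hc
    filter_upwards [hball (hH.eventually (lt_mem_nhds hc')), self_mem_nhdsWithin] with ε h1 hε
    obtain ⟨v0, vt⟩ := volume_closedBall_pos_lt_top y hε
    refine hcc'.trans_le ?_
    rw [ENNReal.le_div_iff_mul_le (Or.inl v0) (Or.inl vt), ← setLIntegral_const]
    exact setLIntegral_mono' Metric.isClosed_closedBall.measurableSet fun w hw => (h1 w hw).le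
  · obtain ⟨c', hcc', hc'⟩ := exists_between hc
    filter_upwards [hball (hH.eventually (gt_mem_nhds hcc')), self_mem_nhdsWithin] with ε h1 hε
    obtain ⟨v0, vt⟩ := volume_closedBall_pos_lt_top y hε
    refine lt_of_le_of_lt ?_ hc'
    rw [ENNReal.div_le_iff v0 vt, ← setLIntegral_const]
    exact setLIntegral_mono' Metric.isClosed_closedBall.measurableSet fun w hw => (h1 w hw).le

end Average

variable {V W : Type*} [NormedAddCommGroup V] [InnerProductSpace ℝ V] [FiniteDimensional ℝ V]
  [NormedAddCommGroup W] [InnerProductSpace ℝ W] [FiniteDimensional ℝ W]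
  [MeasurableSpace V] [BorelSpace V] [MeasurableSpace W] [BorelSpace W]
  {F : V → W} {X : Set V} {d : ℕ}

theorem measurableSet_inter_preimage (hX : IsOpen X) (hF : ContDiffOn ℝ 1 F X) {s : Set W}
    (hs : MeasurableSet s) : MeasurableSet (X ∩ F ⁻¹' s) := by
  have : Measurable (X.domRestrict F) := (hF.continuousOn.domRestrict).measurable
  have h2 := hX.measurableSet.subtype_image (this hs)
  convert h2 using 1
  ext x
  simp only [mem_inter_iff, mem_preimage, mem_image, Subtype.exists, domRestrict_apply,
    exists_and_right, exists_eq_right]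
  exact ⟨fun ⟨h1, h2⟩ => ⟨h1, h2⟩, fun ⟨h1, h2⟩ => ⟨h1, h2⟩⟩

/-- The coarea formula for the part of the space that lies over a measurable set. -/
theorem setLIntegral_preimage_eq_fiberIntegral (hX : IsOpen X) (hF : ContDiffOn ℝ 1 F X)
    (hsurj : ∀ x ∈ X, Function.Surjective (fderiv ℝ F x)) (hdim : finrank ℝ V = finrank ℝ W + d)
    {ψ : V → ℝ} (hψ : Continuous ψ) (hc : HasCompactSupport ψ) (hsupp : tsupport ψ ⊆ X)
    (h0 : ∀ x, 0 ≤ ψ x) {s : Set W} (hs : MeasurableSet s) :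
    ∫⁻ x in X ∩ F ⁻¹' s, ENNReal.ofReal (ψ x) =
      ∫⁻ w in s, fiberIntegral F X d (fun x => ENNReal.ofReal (ψ x)) w := by
  have h1 := (coarea_of_hasCompactSupport hX hF hsurj hdim hψ hc hsupp h0).2.2 (s.indicator 1)
    (measurable_one.indicator hs)
  have hm := measurableSet_inter_preimage hX hF hs
  rw [← lintegral_indicator hX.measurableSet] at h1
  rw [← lintegral_indicator hm, ← lintegral_indicator hs]
  convert h1 using 1
  · refine lintegral_congr fun x => ?_
    by_cases hx : x ∈ X <;> by_cases hxs : F x ∈ s <;> simp [hx, hxs, indicator]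
  · refine lintegral_congr fun w => ?_
    by_cases hw : w ∈ s <;> simp [hw]

/-- The mass that `ψ` gives to a thin tube around a fiber. -/
theorem tendsto_tube_div_of_hasCompactSupport (hX : IsOpen X) (hF : ContDiffOn ℝ 1 F X)
    (hsurj : ∀ x ∈ X, Function.Surjective (fderiv ℝ F x)) (hdim : finrank ℝ V = finrank ℝ W + d)
    {ψ : V → ℝ} (hψ : Continuous ψ) (hc : HasCompactSupport ψ) (hsupp : tsupport ψ ⊆ X)
    (h0 : ∀ x, 0 ≤ ψ x) (y : W) :
    Tendsto (fun ε : ℝ => (∫⁻ x in X ∩ F ⁻¹' Metric.closedBall y ε, ENNReal.ofReal (ψ x)) /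
      volume (Metric.closedBall y ε)) (𝓝[>] 0)
      (𝓝 (fiberIntegral F X d (fun x => ENNReal.ofReal (ψ x)) y)) := by
  simp_rw [setLIntegral_preimage_eq_fiberIntegral hX hF hsurj hdim hψ hc hsupp h0
    Metric.isClosed_closedBall.measurableSet]
  exact tendsto_setLIntegral_closedBall_div
    (coarea_of_hasCompactSupport hX hF hsurj hdim hψ hc hsupp h0).1.continuousAt

theorem aemeasurable_ofReal_fiber (hX : IsOpen X) (hF : ContDiffOn ℝ 1 F X) {b : V → ℝ}
    (hb : ContinuousOn b X) (y : W) :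
    AEMeasurable (fun x => ENNReal.ofReal (b x) * (ENNReal.ofReal (coareaFactor F x))⁻¹)
      ((Measure.euclideanHausdorffMeasure d).restrict (X ∩ F ⁻¹' {y})) := by
  have h1 : AEMeasurable (fun x => ENNReal.ofReal (b x) * (ENNReal.ofReal (coareaFactor F x))⁻¹)
      ((Measure.euclideanHausdorffMeasure d).restrict X) :=
    (hb.aemeasurable hX.measurableSet).ennreal_ofReal.mul
      (((continuousOn_coareaFactor hX hF).aemeasurable hX.measurableSet).ennreal_ofReal.inv)
  exact h1.mono_measure (Measure.restrict_mono inter_subset_left le_rfl)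

theorem ae_mem_of_fiber (hX : IsOpen X) (hF : ContDiffOn ℝ 1 F X) (y : W) :
    ∀ᵐ x ∂((Measure.euclideanHausdorffMeasure d).restrict (X ∩ F ⁻¹' {y})), x ∈ X :=
  (ae_restrict_mem (measurableSet_inter_preimage hX hF (measurableSet_singleton y))).mono
    fun _ hx => hx.1

theorem fiberIntegral_eq_iSup (hX : IsOpen X) (hF : ContDiffOn ℝ 1 F X) {χ : ℕ → V → ℝ}
    (hχ : IsCutoffSeq X χ) {b : V → ℝ} (hb : ContinuousOn b X) (y : W) :
    fiberIntegral F X d (fun x => ENNReal.ofReal (b x)) y =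
      ⨆ k, fiberIntegral F X d (fun x => ENNReal.ofReal (χ k x * b x)) y := by
  simp only [fiberIntegral]
  rw [hχ.lintegral_eq_iSup (ae_mem_of_fiber hX hF y) (aemeasurable_ofReal_fiber hX hF hb y)]
  refine iSup_congr fun k => lintegral_congr fun x => ?_
  rw [ENNReal.ofReal_mul (hχ.nonneg k x), mul_assoc]

theorem fiberIntegral_mono (hX : IsOpen X) (hF : ContDiffOn ℝ 1 F X) {f g : V → ℝ≥0∞} (y : W)
    (h : ∀ x ∈ X, f x ≤ g x) : fiberIntegral F X d f y ≤ fiberIntegral F X d g y := by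
  refine lintegral_mono_ae ((ae_mem_of_fiber hX hF y).mono fun x hx => ?_)
  exact mul_le_mul_left (h x hx) _

/-- The mass of a thin tube around a fiber is asymptotically at least that of the fiber. -/
theorem fiberIntegral_le_liminf_tube_div (hX : IsOpen X) (hF : ContDiffOn ℝ 1 F X)
    (hsurj : ∀ x ∈ X, Function.Surjective (fderiv ℝ F x)) (hdim : finrank ℝ V = finrank ℝ W + d)
    {b : V → ℝ} (hb : ContinuousOn b X) (h0 : ∀ x ∈ X, 0 ≤ b x) (y : W) :
    fiberIntegral F X d (fun x => ENNReal.ofReal (b x)) y ≤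
      liminf (fun ε : ℝ => (∫⁻ x in X ∩ F ⁻¹' Metric.closedBall y ε, ENNReal.ofReal (b x)) /
        volume (Metric.closedBall y ε)) (𝓝[>] 0) := by
  -- Each cut-off integrand lies below `b` and has an exact tube limit; the supremum of these limits
  -- is the fiber integral of `b`.
  obtain ⟨χ, hχ⟩ := exists_isCutoffSeq hX
  rw [fiberIntegral_eq_iSup hX hF hχ hb]
  refine iSup_le fun k => ?_
  rw [← (tendsto_tube_div_of_hasCompactSupport hX hF hsurj hdim (hχ.continuous_mul hX hb k)
    (hχ.hasCompactSupport_mul b k) (hχ.tsupport_mul_subset b k) (hχ.mul_nonneg h0 k)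
    y).liminf_eq]
  refine liminf_le_liminf (Eventually.of_forall fun ε => ?_)
  refine ENNReal.div_le_div_right (setLIntegral_mono' (measurableSet_inter_preimage hX hF
    Metric.isClosed_closedBall.measurableSet) fun x hx => ENNReal.ofReal_le_ofReal ?_) _
  exact mul_le_of_le_one_left (h0 x hx.1) (hχ.le_one k x)

/-- Preimages of null sets under a submersion are null sets. -/
theorem volume_inter_preimage_eq_zero (hX : IsOpen X) (hF : ContDiffOn ℝ 1 F X)
    (hsurj : ∀ x ∈ X, Function.Surjective (fderiv ℝ F x)) (hdim : finrank ℝ V = finrank ℝ W + d)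
    {s : Set W} (hs : MeasurableSet s) (hs0 : volume s = 0) : volume (X ∩ F ⁻¹' s) = 0 := by
  -- The volume is the supremum of integrals of cutoffs, each of which the coarea formula turns into
  -- an integral over the null set `s`.
  obtain ⟨χ, hχ⟩ := exists_isCutoffSeq hX
  have hm := measurableSet_inter_preimage hX hF hs
  rw [← setLIntegral_one, hχ.lintegral_eq_iSup ((ae_restrict_mem hm).mono fun x hx => hx.1)
    aemeasurable_const]
  simp only [mul_one, ENNReal.iSup_eq_zero]
  intro k
  rw [setLIntegral_preimage_eq_fiberIntegral hX hF hsurj hdim (hχ.continuous k)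
    (hχ.hasCompactSupport k) (hχ.tsupport_subset k) (hχ.nonneg k) hs]
  exact setLIntegral_measure_zero _ _ hs0

/-- If the restrictions of the density `a` to the tubes around the fiber over `y` are tight, then
the mass of thin tubes is asymptotically that of the fiber. -/
theorem tendsto_tube_div_of_tight (hX : IsOpen X) (hF : ContDiffOn ℝ 1 F X)
    (hsurj : ∀ x ∈ X, Function.Surjective (fderiv ℝ F x)) (hdim : finrank ℝ V = finrank ℝ W + d)
    {a : V → ℝ} (ha : ContinuousOn a X) (h0 : ∀ x ∈ X, 0 ≤ a x) {y : W}
    (hfin : ∀ ε : ℝ, 0 < ε →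
      ∫⁻ x in X ∩ F ⁻¹' Metric.closedBall y ε, ENNReal.ofReal (a x) ≠ ∞)
    (htight : ∃ ε₀ : ℝ, 0 < ε₀ ∧ ∀ δ : ℝ≥0∞, 0 < δ → ∃ K ⊆ X, IsCompact K ∧
      ∀ ε : ℝ, 0 < ε → ε < ε₀ →
        ∫⁻ x in (X ∩ F ⁻¹' Metric.closedBall y ε) ∩ Kᶜ, ENNReal.ofReal (a x) ≤
          δ * ∫⁻ x in X ∩ F ⁻¹' Metric.closedBall y ε, ENNReal.ofReal (a x)) :
    fiberIntegral F X d (fun x => ENNReal.ofReal (a x)) y ≠ ∞ ∧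
    ∀ b : V → ℝ, ContinuousOn b X → (∀ x ∈ X, 0 ≤ b x) → (∀ x ∈ X, b x ≤ a x) →
      Tendsto (fun ε : ℝ => (∫⁻ x in X ∩ F ⁻¹' Metric.closedBall y ε, ENNReal.ofReal (b x)) /
        volume (Metric.closedBall y ε)) (𝓝[>] 0)
        (𝓝 (fiberIntegral F X d (fun x => ENNReal.ofReal (b x)) y)) := by
  obtain ⟨χ, hχ⟩ := exists_isCutoffSeq hX
  obtain ⟨ε₀, hε₀, htight⟩ := htight
  set T : ℝ → Set V := fun ε => X ∩ F ⁻¹' Metric.closedBall y ε with hT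
  have hTm : ∀ ε, MeasurableSet (T ε) := fun ε =>
    measurableSet_inter_preimage hX hF Metric.isClosed_closedBall.measurableSet
  set v : ℝ → ℝ≥0∞ := fun ε => volume (Metric.closedBall y ε)
  set R : (V → ℝ) → ℝ → ℝ≥0∞ := fun b ε => (∫⁻ x in T ε, ENNReal.ofReal (b x)) / v ε with hR
  set L : (V → ℝ) → ℝ≥0∞ := fun b => fiberIntegral F X d (fun x => ENNReal.ofReal (b x)) y with hL
  have hcut : ∀ (b : V → ℝ), ContinuousOn b X → (∀ x ∈ X, 0 ≤ b x) → ∀ k,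
      Tendsto (R fun x => χ k x * b x) (𝓝[>] 0) (𝓝 (L fun x => χ k x * b x)) := fun b hb hb0 k =>
    tendsto_tube_div_of_hasCompactSupport hX hF hsurj hdim (hχ.continuous_mul hX hb k)
      (hχ.hasCompactSupport_mul b k) (hχ.tsupport_mul_subset b k) (hχ.mul_nonneg hb0 k) y
  have hLcut : ∀ (b : V → ℝ), (∀ x ∈ X, 0 ≤ b x) → ∀ k, (L fun x => χ k x * b x) ≤ L b :=
    fun b hb0 k => fiberIntegral_mono hX hF y fun x hx =>
      ENNReal.ofReal_le_ofReal (mul_le_of_le_one_left (hb0 x hx) (hχ.le_one k x))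
  -- Split the tube along the compact set `K`. On `K` a late cutoff equals `1`; off `K` the mass of
  -- `b ≤ a` is a fraction `δ` of the mass of `a`. The index `k` depends on `δ` but not on `b` or
  -- `ε`.
  have hupper : ∀ δ : ℝ≥0∞, 0 < δ → ∃ k, ∀ b : V → ℝ, (∀ x ∈ X, 0 ≤ b x) →
      (∀ x ∈ X, b x ≤ a x) → ∀ ε : ℝ, 0 < ε → ε < ε₀ →
      R b ε ≤ R (fun x => χ k x * b x) ε + δ * R a ε := by
    intro δ hδ
    obtain ⟨K, hKX, hKc, hK⟩ := htight δ hδ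
    obtain ⟨k, hk⟩ := hχ.eq_one K hKc hKX
    refine ⟨k, fun b hb0 hba ε hε hε' => ?_⟩
    have hsplit : ∫⁻ x in T ε, ENNReal.ofReal (b x) ≤
        (∫⁻ x in T ε, ENNReal.ofReal (χ k x * b x)) + δ * ∫⁻ x in T ε, ENNReal.ofReal (a x) := by
      rw [← lintegral_inter_add_sdiff _ (T ε) hKc.measurableSet]
      refine add_le_add ?_ ?_
      · calc ∫⁻ x in T ε ∩ K, ENNReal.ofReal (b x)
            = ∫⁻ x in T ε ∩ K, ENNReal.ofReal (χ k x * b x) :=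
              setLIntegral_congr_fun ((hTm ε).inter hKc.measurableSet) fun x hx => by
                simp only [hk x hx.2, one_mul]
          _ ≤ _ := lintegral_mono_set inter_subset_left
      · refine le_trans ?_ (hK ε hε hε')
        exact setLIntegral_mono' ((hTm ε).inter hKc.measurableSet.compl) fun x hx =>
          ENNReal.ofReal_le_ofReal (hba x hx.1.1)
    calc R b ε ≤ _ := ENNReal.div_le_div_right hsplit _
      _ = _ := by rw [ENNReal.add_div, mul_div_assoc]
  have hsmall : ∀ᶠ ε : ℝ in 𝓝[>] 0, 0 < ε ∧ ε < ε₀ := Ioo_mem_nhdsGT hε₀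
  -- With `δ = 1/2` the error term is absorbed on the left, so `R a` is at most twice a convergent
  -- cut-off quantity. The absorption requires `R a ε` to be finite.
  obtain ⟨M, hM, hMev⟩ : ∃ M : ℝ≥0∞, M ≠ ∞ ∧ ∀ᶠ ε : ℝ in 𝓝[>] 0, R a ε ≤ M := by
    obtain ⟨k, hk⟩ := hupper 2⁻¹ (by simp)
    have hlt : (L fun x => χ k x * a x) ≠ ∞ :=
      ((coarea_of_hasCompactSupport hX hF hsurj hdim (hχ.continuous_mul hX ha k)
        (hχ.hasCompactSupport_mul a k) (hχ.tsupport_mul_subset a k)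
        (hχ.mul_nonneg h0 k)).2.1 y).ne
    refine ⟨2 * ((L fun x => χ k x * a x) + 1), ENNReal.mul_ne_top (by simp)
      (ENNReal.add_ne_top.2 ⟨hlt, by simp⟩), ?_⟩
    have hev := (hcut a ha h0 k).eventually (gt_mem_nhds (ENNReal.lt_add_right hlt one_ne_zero))
    filter_upwards [hsmall, hev] with ε hε h1
    have h2 := hk a h0 (fun x _ => le_rfl) ε hε.1 hε.2
    have hRfin : R a ε ≠ ∞ :=
      ENNReal.div_ne_top (hfin ε hε.1) (volume_closedBall_pos_lt_top y hε.1).1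
    have h3 : R a ε = 2⁻¹ * R a ε + 2⁻¹ * R a ε := by
      rw [← add_mul, ENNReal.inv_two_add_inv_two, one_mul]
    have h4 : 2⁻¹ * R a ε ≤ R (fun x => χ k x * a x) ε := by
      have hne : 2⁻¹ * R a ε ≠ ∞ := ENNReal.mul_ne_top (by simp) hRfin
      exact (ENNReal.add_le_add_iff_right hne).1 (h3.symm.trans_le h2)
    calc R a ε = 2 * (2⁻¹ * R a ε) := by
          rw [← mul_assoc, ENNReal.mul_inv_cancel two_ne_zero ENNReal.ofNat_ne_top, one_mul]
      _ ≤ _ := by gcongr; exact h4.trans h1.le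
  have hlow : ∀ b : V → ℝ, ContinuousOn b X → (∀ x ∈ X, 0 ≤ b x) → L b ≤ liminf (R b) (𝓝[>] 0) :=
    fun b hb hb0 => fiberIntegral_le_liminf_tube_div hX hF hsurj hdim hb hb0 y
  refine ⟨?_, fun b hb hb0 hba => ?_⟩
  · refine ne_top_of_le_ne_top hM ((hlow a ha h0).trans ?_)
    exact (liminf_le_limsup).trans (limsup_le_of_le (by isBoundedDefault) hMev)
  · refine tendsto_of_le_liminf_of_limsup_le (hlow b hb hb0) ?_
    -- The cut-off part converges to a limit below `L b`, and the remainder is at most `δ M`; then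
    -- `δ` tends to `0`.
    have hδ : ∀ δ : ℝ≥0∞, 0 < δ → limsup (R b) (𝓝[>] 0) ≤ L b + δ * M := by
      intro δ hδ
      obtain ⟨k, hk⟩ := hupper δ hδ
      calc limsup (R b) (𝓝[>] 0)
          ≤ limsup (fun ε => R (fun x => χ k x * b x) ε + δ * M) (𝓝[>] 0) := by
            refine limsup_le_limsup ?_
            filter_upwards [hsmall, hMev] with ε hε hεM
            refine (hk b hb0 hba ε hε.1 hε.2).trans ?_
            gcongr
        _ = (L fun x => χ k x * b x) + δ * M :=
            ((hcut b hb hb0 k).add tendsto_const_nhds).limsup_eq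
        _ ≤ _ := by gcongr; exact hLcut b hb0 k
    have hlim : Tendsto (fun δ : ℝ≥0∞ => L b + δ * M) (𝓝[>] 0) (𝓝 (L b + 0 * M)) :=
      (tendsto_const_nhds.add (ENNReal.Tendsto.mul_const tendsto_id (Or.inr hM))).mono_left
        nhdsWithin_le_nhds
    rw [zero_mul, add_zero] at hlim
    exact ge_of_tendsto hlim (eventually_nhdsWithin_of_forall fun δ hδ' => hδ δ hδ')

/-- Integrating over the fibers of a submersion `F` in two steps. -/
theorem fiberIntegral_eq_lintegral_fiberIntegral {T : Type*} [NormedAddCommGroup T]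
    [InnerProductSpace ℝ T] [FiniteDimensional ℝ T] [MeasurableSpace T] [BorelSpace T]
    {F₂ : V → WithLp 2 (W × T)} {d₂ : ℕ} (hX : IsOpen X) (hF : ContDiffOn ℝ 1 F X)
    (hsurj : ∀ x ∈ X, Function.Surjective (fderiv ℝ F x)) (hdim : finrank ℝ V = finrank ℝ W + d)
    (hF₂ : ContDiffOn ℝ 1 F₂ X) (hsurj₂ : ∀ x ∈ X, Function.Surjective (fderiv ℝ F₂ x))
    (hdim₂ : finrank ℝ V = finrank ℝ (WithLp 2 (W × T)) + d₂) (hfst : ∀ x, (F₂ x).fst = F x)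
    {ψ : V → ℝ} (hψ : Continuous ψ) (hc : HasCompactSupport ψ) (hsupp : tsupport ψ ⊆ X)
    (h0 : ∀ x, 0 ≤ ψ x) (w : W) :
    fiberIntegral F X d (fun x => ENNReal.ofReal (ψ x)) w =
      ∫⁻ t, fiberIntegral F₂ X d₂ (fun x => ENNReal.ofReal (ψ x)) (WithLp.toLp 2 (w, t)) := by
  obtain ⟨c1, c2, c3⟩ := coarea_of_hasCompactSupport hX hF hsurj hdim hψ hc hsupp h0
  obtain ⟨e1, e2, e3⟩ := coarea_of_hasCompactSupport hX hF₂ hsurj₂ hdim₂ hψ hc hsupp h0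
  set H₁ := fiberIntegral F X d fun x => ENNReal.ofReal (ψ x) with hH₁
  set H₂ := fiberIntegral F₂ X d₂ fun x => ENNReal.ofReal (ψ x) with hH₂
  set κ : WithLp 2 (W × T) → ℝ := fun p => (H₂ p).toReal with hκ
  have hκc : Continuous κ :=
    continuous_iff_continuousAt.2 fun p =>
      (ENNReal.tendsto_toReal (e2 p).ne).comp e1.continuousAt
  have hκs : HasCompactSupport κ := by
    refine HasCompactSupport.intro
      (hc.isCompact.image_of_continuousOn (hF₂.continuousOn.mono hsupp)) fun p hp => ?_
    have : H₂ p = 0 := by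
      rw [hH₂, fiberIntegral]
      refine (setLIntegral_congr_fun (measurableSet_inter_preimage hX hF₂
        (measurableSet_singleton p)) (g := fun _ => 0) fun x hx => ?_).trans (by simp)
      have hx' : x ∉ tsupport ψ := fun hxs => hp ⟨x, hxs, hx.2⟩
      simp [image_eq_zero_of_notMem_tsupport hx']
    simp [hκ, this]
  have hκe : ∀ p, ENNReal.ofReal (κ p) = H₂ p := fun p => ENNReal.ofReal_toReal (e2 p).ne
  have hI := continuous_lintegral_toLp hκc hκs fun p => ENNReal.toReal_nonneg
  simp_rw [hκe] at hI
  have hemb : MeasurableEmbedding (WithLp.toLp 2 : W × T → WithLp 2 (W × T)) :=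
    (MeasurableEquiv.toLp 2 (W × T)).measurableEmbedding
  -- Both sides have the same integral over every measurable set `s` of values `w`: apply the coarea
  -- formulas of `F` and of `F₂`, with the indicator of `s` in the first coordinate, to the same
  -- integral of `ψ`.
  have hae : H₁ =ᵐ[volume] fun w => ∫⁻ t, H₂ (WithLp.toLp 2 (w, t)) := by
    refine ae_eq_of_forall_setLIntegral_eq_of_sigmaFinite c1.measurable hI.1.measurable
      fun s hs _ => ?_
    have hind : Measurable (s.indicator (1 : W → ℝ≥0∞)) := measurable_one.indicator hs
    have h1 := c3 (s.indicator 1) hind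
    have h2 := e3 (fun p => s.indicator 1 p.fst)
      (hind.comp (WithLp.fstL 2 ℝ W T).continuous.measurable)
    simp only [hfst] at h2
    rw [h1, ← (WithLp.volume_preserving_toLp W T).map_eq, hemb.lintegral_map,
      Measure.volume_eq_prod] at h2
    have hmeas : Measurable fun z : W × T => s.indicator 1 z.1 * H₂ (WithLp.toLp 2 z) :=
      (hind.comp measurable_fst).mul (e1.measurable.comp hemb.measurable)
    have h3 := h2.trans (lintegral_prod _ hmeas.aemeasurable)
    rw [← lintegral_indicator hs, ← lintegral_indicator hs]
    convert h3 using 1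
    · refine lintegral_congr fun w => ?_
      by_cases hw : w ∈ s <;> simp [hw]
    · refine lintegral_congr fun w => ?_
      by_cases hw : w ∈ s <;> simp [hw]
  -- Both sides are continuous in `w`, so almost everywhere equality gives equality at the
  -- prescribed `w`.
  exact congrFun ((c1.ae_eq_iff_eq volume hI.1).1 hae) w

end ABC

end CoareaConsequences

/-! ### Linear images of fibers -/

section LinearImage

open Module Set

namespace ABC

variable {V V' W : Type*} [NormedAddCommGroup V] [InnerProductSpace ℝ V] [FiniteDimensional ℝ V]
  [NormedAddCommGroup V'] [InnerProductSpace ℝ V'] [FiniteDimensional ℝ V']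
  [NormedAddCommGroup W] [InnerProductSpace ℝ W] [FiniteDimensional ℝ W]
  [MeasurableSpace V] [BorelSpace V] [MeasurableSpace V'] [BorelSpace V']
  [MeasurableSpace W] [BorelSpace W] {F : V → W} {X : Set V} {d : ℕ}

/-- Change of variables for a linear map that is an injective immersion on a fiber of `F`. -/
theorem setLIntegral_image_fiber (hX : IsOpen X) (hF : ContDiffOn ℝ 1 F X)
    (hsurj : ∀ x ∈ X, Function.Surjective (fderiv ℝ F x)) (hdim : finrank ℝ V = finrank ℝ W + d)
    (P : V →L[ℝ] V') (y : W) (hP : InjOn P (X ∩ F ⁻¹' {y})) {g : V → ℝ≥0∞} {h : V' → ℝ≥0∞}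
    (hgh : ∀ x ∈ X ∩ F ⁻¹' {y}, ∀ L : EuclideanSpace ℝ (Fin d) →L[ℝ] V, Function.Injective L →
      (∀ v, fderiv ℝ F x v = 0 ↔ ∃ k, L k = v) → Function.Injective (P ∘L L) ∧
        ENNReal.ofReal L.toLinearMap.normDet * g x =
          ENNReal.ofReal (P ∘L L).toLinearMap.normDet * h (P x))
    {t : Set V} (ht : MeasurableSet t) :
    ∫⁻ z in P '' ((X ∩ F ⁻¹' {y}) ∩ t), h z ∂(Measure.euclideanHausdorffMeasure d) =
      ∫⁻ x in (X ∩ F ⁻¹' {y}) ∩ t, g x ∂(Measure.euclideanHausdorffMeasure d) := by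
  set M := X ∩ F ⁻¹' {y} with hM
  have hMm : MeasurableSet M := measurableSet_inter_preimage hX hF (measurableSet_singleton y)
  have hD : finrank ℝ (EuclideanSpace ℝ (Fin d)) = d := finrank_euclideanSpace_fin
  have hdim' : finrank ℝ V = finrank ℝ W + finrank ℝ (EuclideanSpace ℝ (Fin d)) := by rw [hD, hdim]
  have hFd : DifferentiableOn ℝ F X := hF.differentiableOn one_ne_zero
  have hloc : ∀ Ψ : OpenPartialHomeomorph (WithLp 2 (W × EuclideanSpace ℝ (Fin d))) V,
      IsStraightening F X Ψ → ∀ t, MeasurableSet t →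
      ∫⁻ z in P '' (Ψ.target ∩ F ⁻¹' {y} ∩ t), h z ∂(Measure.euclideanHausdorffMeasure d) =
        ∫⁻ x in Ψ.target ∩ F ⁻¹' {y} ∩ t, g x ∂(Measure.euclideanHausdorffMeasure d) := by
    intro Ψ hΨ t ht
    set γ : EuclideanSpace ℝ (Fin d) → V := fun k => Ψ (WithLp.toLp 2 (y, k)) with hγ
    set γ' := fun k => fderiv ℝ Ψ (WithLp.toLp 2 (y, k)) ∘L sndIncl W (EuclideanSpace ℝ (Fin d))
      with hγ'
    set S := IsStraightening.slice Ψ y with hS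
    have hγc : ContinuousOn γ S := fun k hk =>
      (hΨ.hasStrictFDerivAt_slice hk).continuousAt.continuousWithinAt
    have hSm : MeasurableSet (S ∩ γ ⁻¹' t) := by
      have h1 : Measurable (S.domRestrict γ) := hγc.domRestrict.measurable
      have h2 := (IsStraightening.isOpen_slice (Ψ := Ψ) y).measurableSet.subtype_image (h1 ht)
      convert h2 using 1
      ext x
      simp only [mem_inter_iff, mem_preimage, mem_image, Subtype.exists, domRestrict_apply,
        exists_and_right, exists_eq_right]
      exact ⟨fun ⟨h1, h2⟩ => ⟨h1, h2⟩, fun ⟨h1, h2⟩ => ⟨h1, h2⟩⟩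
    have himg : γ '' (S ∩ γ ⁻¹' t) = Ψ.target ∩ F ⁻¹' {y} ∩ t := by
      rw [image_inter_preimage, hΨ.image_slice y]
    have hMsub : ∀ k ∈ S, γ k ∈ M := fun k hk =>
      ⟨hΨ.target_subset (Ψ.map_source hk), hΨ.apply_eq_fst _ hk⟩
    -- The derivative of the slice parametrizes the kernel of `F'`, so the tangent space hypothesis
    -- `hgh` applies to it. The area formula for the slice and for its image under `P` then have
    -- equal integrands.
    have hker : ∀ k ∈ S, ∀ v, fderiv ℝ F (γ k) v = 0 ↔ ∃ j, γ' k j = v := by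
      intro k hk v
      obtain ⟨A, hA⟩ := hΨ.exists_equiv _ hk
      constructor
      · intro hv
        have h1 := hΨ.fderiv_apply_fderiv hFd hX hk (A.symm v)
        have h2 : fderiv ℝ Ψ (WithLp.toLp 2 (y, k)) (A.symm v) = v := by
          rw [hA]; exact A.apply_symm_apply v
        rw [h2, hv] at h1
        refine ⟨(A.symm v).snd, ?_⟩
        have h3 : sndIncl W (EuclideanSpace ℝ (Fin d)) (A.symm v).snd = A.symm v := by
          rw [sndIncl_apply, h1]; rfl
        simp only [hγ', ContinuousLinearMap.comp_apply, h3, h2]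
      · rintro ⟨j, rfl⟩
        exact hΨ.fderiv_apply_fderiv hFd hX hk _
    have hboth := fun k (hk : k ∈ S) =>
      hgh (γ k) (hMsub k hk) (γ' k) (hΨ.fderiv_slice_injective hk) (hker k hk)
    have a1 := lintegral_image_eq_lintegral_normDet_mul hSm
      (fun k hk => hΨ.hasStrictFDerivAt_slice hk.1)
      ((hΨ.continuousOn_fderiv_slice y).mono inter_subset_left)
      (fun k hk => hΨ.fderiv_slice_injective hk.1)
      ((IsStraightening.injOn_slice y).mono inter_subset_left) g
    have a2 := lintegral_image_eq_lintegral_normDet_mul (f := fun k => P (γ k))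
      (f' := fun k => P ∘L γ' k) hSm
      (fun k hk => P.hasStrictFDerivAt.comp k (hΨ.hasStrictFDerivAt_slice hk.1))
      (continuousOn_const.clm_comp ((hΨ.continuousOn_fderiv_slice y).mono inter_subset_left))
      (fun k hk => (hboth k hk.1).1)
      (hP.comp ((IsStraightening.injOn_slice y).mono inter_subset_left) fun k hk => hMsub k hk.1) h
    have himg2 : (fun k => P (γ k)) '' (S ∩ γ ⁻¹' t) = P '' (Ψ.target ∩ F ⁻¹' {y} ∩ t) := by
      rw [← himg, image_image]
    rw [himg2, hD] at a2
    rw [hD] at a1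
    change ∫⁻ z in γ '' (S ∩ γ ⁻¹' t), g z ∂_ = _ at a1
    rw [himg] at a1
    rw [a1, a2]
    exact setLIntegral_congr_fun hSm fun k hk => (hboth k hk.1).2.symm
  rcases M.eq_empty_or_nonempty with hMe | hMne
  · simp [hMe]
  have hchart := fun x : M => exists_straightening_chart (D := EuclideanSpace ℝ (Fin d)) hX hF hsurj
    x.2.1 hdim'
  choose Ψ hxΨ hΨ using hchart
  obtain ⟨T, hTc, hT⟩ := TopologicalSpace.isOpen_iUnion_countable (fun x => (Ψ x).target)
    fun x => (Ψ x).open_target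
  have hTne : T.Nonempty := by
    obtain ⟨x, hx⟩ := hMne
    have : x ∈ ⋃ i ∈ T, (Ψ i).target := hT ▸ mem_iUnion.2 ⟨⟨x, hx⟩, hxΨ _⟩
    obtain ⟨i, hi, -⟩ := mem_iUnion₂.1 this
    exact ⟨i, hi⟩
  obtain ⟨e, rfl⟩ := hTc.exists_eq_range hTne
  have hcov : M ⊆ ⋃ n, (Ψ (e n)).target := by
    intro x hx
    have : x ∈ ⋃ i ∈ range e, (Ψ i).target := hT ▸ mem_iUnion.2 ⟨⟨x, hx⟩, hxΨ _⟩
    simpa using this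
  -- Disjoint pieces, each inside one chart; injectivity of `P` on the fiber keeps their images
  -- disjoint too.
  set o : ℕ → Set V := disjointed fun n => (Ψ (e n)).target with ho
  have hom : ∀ n, MeasurableSet (o n) :=
    MeasurableSet.disjointed fun n => (Ψ (e n)).open_target.measurableSet
  have hosub : ∀ n, o n ⊆ (Ψ (e n)).target := fun n => disjointed_subset _ _
  set w : ℕ → Set V := fun n => M ∩ t ∩ o n with hw
  have hwm : ∀ n, MeasurableSet (w n) := fun n => (hMm.inter ht).inter (hom n)
  have hwU : ⋃ n, w n = M ∩ t := by
    rw [hw, ← inter_iUnion, ho, iUnion_disjointed]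
    exact inter_eq_left.2 (inter_subset_left.trans hcov)
  have hwd : Pairwise (Function.onFun Disjoint w) := fun i j hij =>
    (disjoint_disjointed _ hij).mono inter_subset_right inter_subset_right
  have hwM : ∀ n, w n ⊆ M := fun n => inter_subset_left.trans inter_subset_left
  have hweq : ∀ n, w n = (Ψ (e n)).target ∩ F ⁻¹' {y} ∩ (t ∩ o n) := by
    intro n
    ext x
    constructor
    · rintro ⟨⟨⟨-, h2⟩, h3⟩, h4⟩
      exact ⟨⟨hosub n h4, h2⟩, h3, h4⟩
    · rintro ⟨⟨h1, h2⟩, h3, h4⟩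
      exact ⟨⟨⟨(hΨ (e n)).target_subset h1, h2⟩, h3⟩, h4⟩
  rw [← hwU, image_iUnion, lintegral_iUnion hwm hwd, lintegral_iUnion]
  · refine tsum_congr fun n => ?_
    rw [hweq n]
    exact hloc _ (hΨ (e n)) _ (ht.inter (hom n))
  · exact fun n => (hwm n).image_of_continuousOn_injOn P.continuous.continuousOn (hP.mono (hwM n))
  · intro i j hij
    have := hP.image_inter (hwM i) (hwM j)
    rw [Function.onFun, disjoint_iff_inter_eq_empty, ← this,
      disjoint_iff_inter_eq_empty.1 (hwd hij), image_empty]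

end ABC

end LinearImage

/-! ### Determinant identities -/

section Determinants

namespace ABC

/-- The determinant `det Σ · det (Aᵀ Σ⁻¹ A)` with `Σ = M Mᵀ`. -/
noncomputable def borderedDet {ν μ τ : Type*} [Fintype ν] [Fintype μ] [Fintype τ] [DecidableEq ν]
    [DecidableEq τ] (M : Matrix ν μ ℝ) (A : Matrix ν τ ℝ) : ℝ :=
  (Matrix.fromBlocks (M * Mᵀ) A (-Aᵀ) 0).det

variable {ν μ τ δ σ : Type*} [Fintype ν] [Fintype μ] [Fintype τ] [Fintype δ] [Fintype σ]
  [DecidableEq ν] [DecidableEq τ] [DecidableEq δ] [DecidableEq σ]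

/-- The Schur complement of the block `M Mᵀ`. -/
theorem borderedDet_eq {M : Matrix ν μ ℝ} (hM : IsUnit (M * Mᵀ).det) (A : Matrix ν τ ℝ) :
    borderedDet M A = (M * Mᵀ).det * (Aᵀ * (M * Mᵀ)⁻¹ * A).det := by
  have : Invertible (M * Mᵀ) := Matrix.invertibleOfIsUnitDet _ hM
  rw [borderedDet, Matrix.det_fromBlocks₁₁, Matrix.invOf_eq_nonsing_inv]
  simp [Matrix.neg_mul]

/-- With `S = M Mᵀ`, `C = (A : B)` and `D = (S⁻¹ A : B)`, both `Cᵀ S D` and `Cᵀ D` are block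
triangular. The equivalence `e` makes `C` and `D` square, so the two determinants differ by the
factor `det S`. The right side is free of `B`. -/
theorem det_mul_det_of_orthogonal {M : Matrix ν μ ℝ} (hM : IsUnit (M * Mᵀ).det)
    {A : Matrix ν τ ℝ} {B : Matrix ν σ ℝ} (e : τ ⊕ σ ≃ ν) (hB : Bᵀ * B = 1) (hBA : Bᵀ * A = 0) :
    (Aᵀ * A).det * (Bᵀ * M * Mᵀ * B).det = borderedDet M A := by
  have hAB : Aᵀ * B = 0 := by
    have := congrArg Matrix.transpose hBA
    simpa using this
  rw [borderedDet_eq hM]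
  set S := M * Mᵀ with hS
  have hSi : S * S⁻¹ = 1 := Matrix.mul_nonsing_inv _ hM
  set C : Matrix ν (τ ⊕ σ) ℝ := Matrix.fromCols A B
  set D : Matrix ν (τ ⊕ σ) ℝ := Matrix.fromCols (S⁻¹ * A) B
  have h1 : Cᵀ * S * D = Matrix.fromBlocks (Aᵀ * A) (Aᵀ * S * B) 0 (Bᵀ * S * B) := by
    rw [Matrix.transpose_fromCols, Matrix.fromRows_mul, Matrix.fromRows_mul_fromCols]
    congr 1
    · rw [Matrix.mul_assoc, ← Matrix.mul_assoc S, hSi, Matrix.one_mul]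
    · rw [Matrix.mul_assoc, ← Matrix.mul_assoc S, hSi, Matrix.one_mul, hBA]
  have h2 : Cᵀ * D = Matrix.fromBlocks (Aᵀ * S⁻¹ * A) 0 (Bᵀ * (S⁻¹ * A)) 1 := by
    rw [Matrix.transpose_fromCols, Matrix.fromRows_mul_fromCols, hAB, hB, Matrix.mul_assoc]
  have h3 : (Cᵀ * S * D).det = S.det * (Cᵀ * D).det := by
    have e1 : (Cᵀ * S * D).submatrix e.symm e.symm =
        (Cᵀ.submatrix e.symm id) * S * (D.submatrix id e.symm) := by
      ext i j; simp [Matrix.mul_apply]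
    have e2 : (Cᵀ * D).submatrix e.symm e.symm =
        (Cᵀ.submatrix e.symm id) * (D.submatrix id e.symm) := by
      ext i j; simp [Matrix.mul_apply]
    rw [← Matrix.det_submatrix_equiv_self e.symm, ← Matrix.det_submatrix_equiv_self e.symm (Cᵀ * D),
      e1, e2, Matrix.det_mul, Matrix.det_mul, Matrix.det_mul]
    ring
  rw [h1, h2, Matrix.det_fromBlocks_zero₂₁, Matrix.det_fromBlocks_zero₁₂, Matrix.det_one,
    mul_one] at h3
  rw [← h3, hS]
  simp only [Matrix.mul_assoc]

/-- The columns of `P` stacked on `Q` span the kernel of `(M : A)`. With `N = Pᵀ P`, `S = M Mᵀ` and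
`H = Aᵀ S⁻¹ A`, this forces `Q N⁻¹ Qᵀ = H⁻¹`. Sylvester's identity reduces `det (N + Qᵀ Q)` and `det
(S + A Aᵀ)` to `det (1 + H⁻¹)` and `det (1 + H)`, whose quotient is `det H`. -/
theorem det_gram_mul_borderedDet {M : Matrix ν μ ℝ} (hM : IsUnit (M * Mᵀ).det)
    {A : Matrix ν τ ℝ} {P : Matrix μ δ ℝ} {Q : Matrix τ δ ℝ} (hP : IsUnit (Pᵀ * P).det)
    (hrel : M * P + A * Q = 0)
    (hex : ∀ (v : μ → ℝ) (s : τ → ℝ), M *ᵥ v + A *ᵥ s = 0 → ∃ k, P *ᵥ k = v ∧ Q *ᵥ k = s) :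
    (Pᵀ * P + Qᵀ * Q).det * borderedDet M A = (Pᵀ * P).det * (M * Mᵀ + A * Aᵀ).det := by
  rw [borderedDet_eq hM]
  set S := M * Mᵀ with hS
  set N := Pᵀ * P with hN
  have hSi : S * S⁻¹ = 1 := Matrix.mul_nonsing_inv _ hM
  have hNi : N⁻¹ * N = 1 := Matrix.nonsing_inv_mul _ hP
  have hNi' : N * N⁻¹ = 1 := Matrix.mul_nonsing_inv _ hP
  set z : Matrix μ τ ℝ := Mᵀ * S⁻¹ * A with hz
  set H := Aᵀ * S⁻¹ * A with hH
  have hMz : M * z = A := by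
    rw [hz, ← Matrix.mul_assoc, ← Matrix.mul_assoc, ← hS, hSi, Matrix.one_mul]
  obtain ⟨Y, hY1, hY2⟩ : ∃ Y : Matrix δ τ ℝ, P * Y = z ∧ Q * Y = -1 := by
    have := fun j => hex (fun i => z i j) (fun i => -(1 : Matrix τ τ ℝ) i j) (by
      ext i
      have h1 := congrFun (congrFun hMz i) j
      simp only [Matrix.mul_apply] at h1
      simp only [Pi.add_apply, Matrix.mulVec, dotProduct, Pi.zero_apply, h1]
      simp [Matrix.one_apply])
    choose k hk1 hk2 using this
    refine ⟨Matrix.of fun i j => k j i, ?_, ?_⟩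
    · ext i j
      exact congrFun (hk1 j) i
    · ext i j
      exact congrFun (hk2 j) i
  have hPM : Pᵀ * Mᵀ = -(Qᵀ * Aᵀ) := by
    have h1 : M * P = -(A * Q) := eq_neg_of_add_eq_zero_left hrel
    rw [← Matrix.transpose_mul, h1, Matrix.transpose_neg, Matrix.transpose_mul]
  have hNY : N * Y = -(Qᵀ * H) := by
    rw [hN, Matrix.mul_assoc, hY1, hz, hH]
    simp only [← Matrix.mul_assoc]
    rw [hPM]
    simp [Matrix.neg_mul]
  have hYe : Y = -(N⁻¹ * (Qᵀ * H)) := by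
    rw [← Matrix.mul_neg, ← hNY, ← Matrix.mul_assoc, hNi, Matrix.one_mul]
  have hQH : Q * N⁻¹ * Qᵀ * H = 1 := by
    have := hY2
    rw [hYe, Matrix.mul_neg, neg_inj] at this
    simpa only [Matrix.mul_assoc] using this
  have d1 : (N + Qᵀ * Q).det = N.det * (1 + Q * N⁻¹ * Qᵀ).det := by
    have : N + Qᵀ * Q = N * (1 + N⁻¹ * Qᵀ * Q) := by
      rw [Matrix.mul_add, Matrix.mul_one, ← Matrix.mul_assoc, ← Matrix.mul_assoc, hNi',
        Matrix.one_mul]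
    rw [this, Matrix.det_mul, Matrix.det_one_add_mul_comm, ← Matrix.mul_assoc]
  have d2 : (S + A * Aᵀ).det = S.det * (1 + H).det := by
    have : S + A * Aᵀ = S * (1 + S⁻¹ * A * Aᵀ) := by
      rw [Matrix.mul_add, Matrix.mul_one, ← Matrix.mul_assoc, ← Matrix.mul_assoc, hSi,
        Matrix.one_mul]
    rw [this, Matrix.det_mul, Matrix.det_one_add_mul_comm, hH, ← Matrix.mul_assoc]
  have d3 : (1 + Q * N⁻¹ * Qᵀ).det * H.det = (1 + H).det := by
    rw [← Matrix.det_mul, Matrix.add_mul, Matrix.one_mul, hQH, add_comm]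
  rw [d1, d2, ← d3]
  ring

end ABC

end Determinants

/-! ### Jacobians in matrix form -/

section MatrixForm

open Module Set

namespace ABC

theorem continuousLinearMap_apply_eq_mulVec {k l : ℕ} (T : E k →L[ℝ] E l) (v : E k) (i : Fin l) :
    T v i = (Matrix.of fun i j => T (EuclideanSpace.single j 1) i : Matrix (Fin l) (Fin k) ℝ).mulVec
      v i := by
  have hv : v = ∑ j, v j • (EuclideanSpace.single j (1 : ℝ) : E k) := by
    have := (EuclideanSpace.basisFun (Fin k) ℝ).sum_repr v
    simpa using this.symm
  conv_lhs => rw [hv, map_sum]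
  simp [Matrix.mulVec, dotProduct, mul_comm]

theorem inner_basisFun_eq {k : ℕ} (v : E k) (i : Fin k) :
    inner ℝ (EuclideanSpace.basisFun (Fin k) ℝ i) v = v i := by
  simp [EuclideanSpace.inner_single_left]

section General

variable {V W : Type*} [NormedAddCommGroup V] [InnerProductSpace ℝ V] [FiniteDimensional ℝ V]
  [NormedAddCommGroup W] [InnerProductSpace ℝ W] [FiniteDimensional ℝ W]

theorem coareaFactor_sq {ι κ : Type*} [Fintype ι] [Fintype κ] [DecidableEq κ]
    (bV : OrthonormalBasis ι ℝ V) (bW : OrthonormalBasis κ ℝ W) {F : V → W} {x : V}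
    {J : Matrix κ ι ℝ} (hJ : ∀ i j, inner ℝ (bW i) (fderiv ℝ F x (bV j)) = J i j) :
    coareaFactor F x ^ 2 = (J * Jᵀ).det := by
  have h := (fderiv ℝ F x).adjoint.toLinearMap.normDet_sq_eq_det_gram bW
  simp only [RCLike.ofReal_real_eq_id, id_eq] at h
  rw [coareaFactor, h]
  congr 1
  ext i j
  change inner ℝ ((fderiv ℝ F x).adjoint (bW i)) ((fderiv ℝ F x).adjoint (bW j)) = _
  rw [← bV.sum_inner_mul_inner, Matrix.mul_apply]
  refine Finset.sum_congr rfl fun k _ => ?_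
  rw [ContinuousLinearMap.adjoint_inner_left, ContinuousLinearMap.adjoint_inner_right, hJ,
    real_inner_comm, hJ, Matrix.transpose_apply]

theorem rpow_neg_half_of_sq_eq {c D : ℝ} (hc : 0 < c) (h : c ^ 2 = D) :
    D ^ (-(1 / 2) : ℝ) = c⁻¹ := by
  rw [← h, Real.rpow_neg (sq_nonneg c), ← Real.sqrt_eq_rpow, Real.sqrt_sq hc.le]

theorem fderiv_toLp_prodMk_apply {V W T : Type*} [NormedAddCommGroup V] [NormedSpace ℝ V]
    [NormedAddCommGroup W] [NormedSpace ℝ W] [NormedAddCommGroup T] [NormedSpace ℝ T]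
    {F : V → W} {x : V} (hF : DifferentiableAt ℝ F x) (S : V →L[ℝ] T) (v : V) :
    fderiv ℝ (fun x => (WithLp.toLp 2 (F x, S x) : WithLp 2 (W × T))) x v =
      WithLp.toLp 2 (fderiv ℝ F x v, S v) := by
  have h := (WithLp.prodContinuousLinearEquiv 2 ℝ W T).symm.toContinuousLinearMap.hasFDerivAt.comp
    x (hF.hasFDerivAt.prodMk S.hasFDerivAt)
  exact congrArg (fun A => A v) h.fderiv

end General

variable {m n q : ℕ}

/-- The data generating map as a function of the pair `(u, θ)`. -/
def jointMap (G : E m → E q → E n) (x : Joint m q) : E n := G x.fst x.snd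

/-- The map `(u, θ) ↦ (G(u, θ), θ)`. -/
noncomputable def pairMap (G : E m → E q → E n) (x : Joint m q) : Joint n q :=
  WithLp.toLp 2 (G x.fst x.snd, x.snd)

/-- The inclusion `u ↦ (u, 0)`. -/
noncomputable def fstIncl (m q : ℕ) : E m →L[ℝ] Joint m q :=
  (WithLp.prodContinuousLinearEquiv 2 ℝ (E m) (E q)).symm.toContinuousLinearMap ∘L
    ContinuousLinearMap.inl ℝ (E m) (E q)

theorem toLp_eq_add (v : E m) (t : E q) :
    (WithLp.toLp 2 (v, t) : Joint m q) = WithLp.toLp 2 (v, 0) + WithLp.toLp 2 (0, t) := by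
  rw [← WithLp.toLp_add]
  simp

theorem isOpen_jointSpace {Υ : Set (E m)} {Θ : Set (E q)} (hΥ : IsOpen Υ) (hΘ : IsOpen Θ) :
    IsOpen (jointSpace Υ Θ) :=
  (hΥ.preimage (WithLp.fstL 2 ℝ (E m) (E q)).continuous).inter
    (hΘ.preimage (WithLp.sndL 2 ℝ (E m) (E q)).continuous)

/-- The bases of the coordinate spaces, put together. -/
noncomputable def jointBasis (m q : ℕ) : OrthonormalBasis (Fin m ⊕ Fin q) ℝ (Joint m q) :=
  (EuclideanSpace.basisFun (Fin m) ℝ).prod (EuclideanSpace.basisFun (Fin q) ℝ)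

theorem jointBasis_inl (i : Fin m) :
    jointBasis m q (Sum.inl i) = WithLp.toLp 2 (EuclideanSpace.single i 1, 0) := by
  simp [jointBasis]

theorem jointBasis_inr (i : Fin q) :
    jointBasis m q (Sum.inr i) = WithLp.toLp 2 (0, EuclideanSpace.single i 1) := by
  simp [jointBasis]

section Derivatives

variable {Υ : Set (E m)} {Θ : Set (E q)} {G : E m → E q → E n}

theorem fderiv_left {x : Joint m q} (h : DifferentiableAt ℝ (jointMap G) x) (v : E m) :
    fderiv ℝ (fun u => G u x.snd) x.fst v = fderiv ℝ (jointMap G) x (WithLp.toLp 2 (v, 0)) := by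
  have h1 : HasFDerivAt (fun u : E m => (WithLp.toLp 2 (u, x.snd) : Joint m q)) (fstIncl m q)
      x.fst := by
    have : (fun u : E m => (WithLp.toLp 2 (u, x.snd) : Joint m q)) =
        fun u => fstIncl m q u + WithLp.toLp 2 (0, x.snd) :=
      funext fun u => toLp_eq_add u x.snd
    rw [this]
    exact (fstIncl m q).hasFDerivAt.add_const _
  have h2 : HasFDerivAt (fun u => G u x.snd) (fderiv ℝ (jointMap G) x ∘L fstIncl m q) x.fst :=
    HasFDerivAt.comp (g := jointMap G) x.fst (f := fun u : E m => WithLp.toLp 2 (u, x.snd))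
      h.hasFDerivAt h1
  rw [h2.fderiv]
  rfl

theorem fderiv_right {x : Joint m q} (h : DifferentiableAt ℝ (jointMap G) x) (t : E q) :
    fderiv ℝ (fun θ => G x.fst θ) x.snd t = fderiv ℝ (jointMap G) x (WithLp.toLp 2 (0, t)) := by
  have h1 : HasFDerivAt (fun θ : E q => (WithLp.toLp 2 (x.fst, θ) : Joint m q))
      (sndIncl (E m) (E q)) x.snd := by
    have : (fun θ : E q => (WithLp.toLp 2 (x.fst, θ) : Joint m q)) =
        fun θ => WithLp.toLp 2 (x.fst, 0) + sndIncl (E m) (E q) θ :=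
      funext fun θ => toLp_eq_add x.fst θ
    rw [this]
    exact (sndIncl (E m) (E q)).hasFDerivAt.const_add _
  have h2 : HasFDerivAt (fun θ => G x.fst θ)
      (fderiv ℝ (jointMap G) x ∘L sndIncl (E m) (E q)) x.snd :=
    HasFDerivAt.comp (g := jointMap G) x.snd (f := fun θ : E q => WithLp.toLp 2 (x.fst, θ))
      h.hasFDerivAt h1
  rw [h2.fderiv]
  rfl

theorem fderiv_left_apply (u : E m) (θ : E q) (v : E m) (i : Fin n) :
    fderiv ℝ (fun u => G u θ) u v i = (jacU G u θ *ᵥ v) i :=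
  continuousLinearMap_apply_eq_mulVec _ v i

theorem fderiv_right_apply (u : E m) (θ : E q) (t : E q) (i : Fin n) :
    fderiv ℝ (fun θ => G u θ) θ t i = (jacTheta G u θ *ᵥ t) i :=
  continuousLinearMap_apply_eq_mulVec _ t i

theorem fderiv_jointMap_apply {x : Joint m q} (h : DifferentiableAt ℝ (jointMap G) x)
    (v : Joint m q) (i : Fin n) :
    fderiv ℝ (jointMap G) x v i =
      (jacU G x.fst x.snd *ᵥ v.fst + jacTheta G x.fst x.snd *ᵥ v.snd) i := by
  have hv : v = WithLp.toLp 2 (v.fst, 0) + WithLp.toLp 2 (0, v.snd) := toLp_eq_add v.fst v.snd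
  conv_lhs => rw [hv, map_add]
  rw [← fderiv_left h, ← fderiv_right h, PiLp.add_apply, fderiv_left_apply, fderiv_right_apply]
  rfl

theorem fderiv_left_surjective {u : E m} {θ : E q} (h : (jacU G u θ).rank = n) :
    Function.Surjective (fderiv ℝ (fun u => G u θ) u) := by
  have hs : Function.Surjective (jacU G u θ).mulVecLin := by
    rw [← LinearMap.range_eq_top]
    refine Submodule.eq_top_of_finrank_eq ?_
    rw [← Matrix.rank, h]
    simp
  intro w
  obtain ⟨v, hv⟩ := hs w
  refine ⟨WithLp.toLp 2 v, ?_⟩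
  ext i
  rw [fderiv_left_apply]
  exact congrFun hv i

theorem jacTheta_mulVec_injective {u : E m} {θ : E q} (h : (jacTheta G u θ).rank = q) {t : E q}
    (ht : jacTheta G u θ *ᵥ t = 0) : t = 0 := by
  have h1 := LinearMap.finrank_range_add_finrank_ker (jacTheta G u θ).mulVecLin
  rw [← Matrix.rank, h, Module.finrank_fin_fun] at h1
  have h2 : finrank ℝ (LinearMap.ker (jacTheta G u θ).mulVecLin) = 0 := by omega
  rw [Submodule.finrank_eq_zero] at h2
  have h3 : (t : Fin q → ℝ) ∈ LinearMap.ker (jacTheta G u θ).mulVecLin := ht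
  rw [h2, Submodule.mem_bot] at h3
  ext i
  exact congrFun h3 i

theorem fderiv_jointMap_surjective {x : Joint m q} (h : DifferentiableAt ℝ (jointMap G) x)
    (hr : (jacU G x.fst x.snd).rank = n) : Function.Surjective (fderiv ℝ (jointMap G) x) := by
  intro w
  obtain ⟨v, hv⟩ := fderiv_left_surjective hr w
  exact ⟨WithLp.toLp 2 (v, 0), by rw [← fderiv_left h, hv]⟩

theorem fderiv_pairMap_apply {x : Joint m q} (h : DifferentiableAt ℝ (jointMap G) x)
    (v : Joint m q) :
    fderiv ℝ (pairMap G) x v = WithLp.toLp 2 (fderiv ℝ (jointMap G) x v, v.snd) :=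
  fderiv_toLp_prodMk_apply h (WithLp.sndL 2 ℝ (E m) (E q)) v

theorem contDiffOn_pairMap {X : Set (Joint m q)} (h : ContDiffOn ℝ 1 (jointMap G) X) :
    ContDiffOn ℝ 1 (pairMap G) X :=
  (WithLp.prodContinuousLinearEquiv 2 ℝ (E n) (E q)).symm.contDiff.comp_contDiffOn
    (h.prodMk (WithLp.sndL 2 ℝ (E m) (E q)).contDiff.contDiffOn)

theorem fderiv_pairMap_surjective {x : Joint m q} (h : DifferentiableAt ℝ (jointMap G) x)
    (hr : (jacU G x.fst x.snd).rank = n) : Function.Surjective (fderiv ℝ (pairMap G) x) := by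
  intro w
  obtain ⟨v, hv⟩ := fderiv_left_surjective hr
    (w.fst - fderiv ℝ (jointMap G) x (WithLp.toLp 2 (0, w.snd)))
  refine ⟨WithLp.toLp 2 (v, w.snd), ?_⟩
  have : fderiv ℝ (jointMap G) x (WithLp.toLp 2 (v, w.snd)) = w.fst := by
    rw [toLp_eq_add v w.snd, map_add, ← fderiv_left h, hv, sub_add_cancel]
  rw [fderiv_pairMap_apply h, this]
  rfl

theorem coareaFactor_jointMap_sq {x : Joint m q} (h : DifferentiableAt ℝ (jointMap G) x) :
    coareaFactor (jointMap G) x ^ 2 = (jac G x.fst x.snd * (jac G x.fst x.snd)ᵀ).det := by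
  refine coareaFactor_sq (jointBasis m q) (EuclideanSpace.basisFun (Fin n) ℝ) ?_
  rintro i (j | j)
  · rw [inner_basisFun_eq, jointBasis_inl, ← fderiv_left h]
    rfl
  · rw [inner_basisFun_eq, jointBasis_inr, ← fderiv_right h]
    rfl

theorem coareaFactor_left_sq (u : E m) (θ : E q) :
    coareaFactor (fun u => G u θ) u ^ 2 = (jacU G u θ * (jacU G u θ)ᵀ).det := by
  refine coareaFactor_sq (EuclideanSpace.basisFun (Fin m) ℝ)
    (EuclideanSpace.basisFun (Fin n) ℝ) fun i j => ?_
  rw [inner_basisFun_eq, EuclideanSpace.basisFun_apply]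
  rfl

/-- The Jacobian has second block row `(0 : 1)`. In `J Jᵀ`, the Schur complement of the identity
block cancels the contribution of `∇_θG` and leaves `∇ᵤG ∇ᵤGᵀ`. -/
theorem coareaFactor_pairMap_sq {x : Joint m q} (h : DifferentiableAt ℝ (jointMap G) x) :
    coareaFactor (pairMap G) x ^ 2 =
      (jacU G x.fst x.snd * (jacU G x.fst x.snd)ᵀ).det := by
  have h1 := coareaFactor_sq (F := pairMap G) (x := x) (jointBasis m q) (jointBasis n q)
    (J := Matrix.fromBlocks (jacU G x.fst x.snd) (jacTheta G x.fst x.snd) 0 1) (by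
      rintro (i | i) (j | j)
      · rw [fderiv_pairMap_apply h, jointBasis_inl, jointBasis_inl, ← fderiv_left h]
        simp [EuclideanSpace.inner_single_left, jacU]
      · rw [fderiv_pairMap_apply h, jointBasis_inl, jointBasis_inr, ← fderiv_right h]
        simp [EuclideanSpace.inner_single_left, jacTheta]
      · rw [fderiv_pairMap_apply h, jointBasis_inr, jointBasis_inl]
        simp
      · rw [fderiv_pairMap_apply h, jointBasis_inr, jointBasis_inr]
        simp [EuclideanSpace.inner_single_left, Matrix.one_apply, PiLp.single_apply])
  rw [h1, Matrix.fromBlocks_transpose, Matrix.fromBlocks_multiply]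
  simp

theorem coareaFactor_pairMap {x : Joint m q} (h : DifferentiableAt ℝ (jointMap G) x) :
    coareaFactor (pairMap G) x = coareaFactor (fun u => G u x.snd) x.fst := by
  refine (sq_eq_sq₀ (LinearMap.normDet_nonneg _) (LinearMap.normDet_nonneg _)).1 ?_
  exact (coareaFactor_pairMap_sq h).trans (coareaFactor_left_sq _ _).symm

theorem ofReal_densG {ρ : E m → ℝ} {π : E q → ℝ} {x : Joint m q}
    (h : DifferentiableAt ℝ (jointMap G) x) (hr : (jacU G x.fst x.snd).rank = n)
    (ha : 0 ≤ ambient ρ π x) :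
    ENNReal.ofReal (densG G ρ π x) =
      ENNReal.ofReal (ambient ρ π x) * (ENNReal.ofReal (coareaFactor (jointMap G) x))⁻¹ := by
  have hpos := coareaFactor_pos (fderiv_jointMap_surjective h hr)
  rw [densG, rpow_neg_half_of_sq_eq hpos (coareaFactor_jointMap_sq h), mul_comm (ρ _),
    ← ENNReal.ofReal_inv_of_pos hpos]
  exact ENNReal.ofReal_mul ha

theorem ofReal_densSection {ρ : E m → ℝ} {u : E m} {θ : E q} (hr : (jacU G u θ).rank = n)
    (hρ : 0 ≤ ρ u) :
    ENNReal.ofReal (densSection G ρ θ u) =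
      ENNReal.ofReal (ρ u) * (ENNReal.ofReal (coareaFactor (fun u => G u θ) u))⁻¹ := by
  have hpos := coareaFactor_pos (fderiv_left_surjective hr)
  rw [densSection, rpow_neg_half_of_sq_eq hpos (coareaFactor_left_sq u θ),
    ← ENNReal.ofReal_inv_of_pos hpos]
  exact ENNReal.ofReal_mul hρ

theorem isUnit_det_jacU {u : E m} {θ : E q} (hr : (jacU G u θ).rank = n) :
    IsUnit (jacU G u θ * (jacU G u θ)ᵀ).det := by
  rw [← coareaFactor_left_sq, isUnit_iff_ne_zero]
  exact pow_ne_zero _ (coareaFactor_pos (fderiv_left_surjective hr)).ne'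

/-- The density on the `u`-projection, in a form that does not depend on the choice of an
orthogonal complement. -/
theorem densU_eq {ρ : E m → ℝ} {π : E q → ℝ} {u : E m} {θ : E q}
    {B : Matrix (Fin n) (Fin (n - q)) ℝ} (hqn : q ≤ n) (hr : (jacU G u θ).rank = n)
    (hB : IsOrthComplement (jacTheta G u θ) B) :
    densU G ρ π B u θ =
      ρ u * π θ * borderedDet (jacU G u θ) (jacTheta G u θ) ^ (-(1 / 2) : ℝ) := by
  have e : Fin q ⊕ Fin (n - q) ≃ Fin n :=
    finSumFinEquiv.trans (finCongr (Nat.add_sub_cancel' hqn))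
  have h1 : 0 ≤ ((jacTheta G u θ)ᵀ * jacTheta G u θ).det := by
    have := (Matrix.posSemidef_conjTranspose_mul_self (jacTheta G u θ)).det_nonneg
    simpa [Matrix.conjTranspose_eq_transpose_of_trivial] using this
  have h2 : 0 ≤ (Bᵀ * jacU G u θ * (jacU G u θ)ᵀ * B).det := by
    have := (Matrix.posSemidef_conjTranspose_mul_self ((jacU G u θ)ᵀ * B)).det_nonneg
    simpa [Matrix.conjTranspose_eq_transpose_of_trivial, Matrix.transpose_mul,
      Matrix.mul_assoc] using this
  rw [densU, ← det_mul_det_of_orthogonal (isUnit_det_jacU hr) e hB.1 hB.2,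
    Real.mul_rpow h1 h2, Real.rpow_neg h1, div_eq_mul_inv, mul_assoc]

/-- A tangent vector of the fiber with vanishing `u`-part has its `θ`-part in the kernel of `∇_θG`,
hence is zero. The volume ratio between the tangent space and its projection is the kernel identity
for the matrices of the two components of `L`. -/
theorem normDet_fst_comp {d : ℕ} {x : Joint m q} (h : DifferentiableAt ℝ (jointMap G) x)
    (hr : (jacU G x.fst x.snd).rank = n) (hcl : (jacTheta G x.fst x.snd).rank = q)
    (L : E d →L[ℝ] Joint m q) (hL : Function.Injective L)
    (hker : ∀ v, fderiv ℝ (jointMap G) x v = 0 ↔ ∃ k, L k = v) :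
    Function.Injective (WithLp.fstL 2 ℝ (E m) (E q) ∘L L) ∧
    L.toLinearMap.normDet ^ 2 * borderedDet (jacU G x.fst x.snd) (jacTheta G x.fst x.snd) =
      (WithLp.fstL 2 ℝ (E m) (E q) ∘L L).toLinearMap.normDet ^ 2 *
        coareaFactor (jointMap G) x ^ 2 := by
  set M := jacU G x.fst x.snd with hM
  set A := jacTheta G x.fst x.snd with hA
  set L₁ : E d →L[ℝ] E m := WithLp.fstL 2 ℝ (E m) (E q) ∘L L with hL₁
  set L₂ : E d →L[ℝ] E q := WithLp.sndL 2 ℝ (E m) (E q) ∘L L with hL₂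
  have hMA : ∀ k : E d, M *ᵥ (L₁ k) + A *ᵥ (L₂ k) = 0 := by
    intro k
    ext i
    have h1 := fderiv_jointMap_apply h (L k) i
    rw [(hker (L k)).2 ⟨k, rfl⟩] at h1
    exact h1.symm
  have hinj : Function.Injective L₁ := by
    rw [injective_iff_map_eq_zero]
    intro k hk
    have h1 := hMA k
    rw [hk] at h1
    have h2 : A *ᵥ (L₂ k) = 0 := by simpa using h1
    have h3 : L₂ k = 0 := jacTheta_mulVec_injective hcl h2
    apply hL
    rw [map_zero]
    have : L k = WithLp.toLp 2 (L₁ k, L₂ k) := rfl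
    rw [this, hk, h3]
    rfl
  refine ⟨hinj, ?_⟩
  set P : Matrix (Fin m) (Fin d) ℝ := Matrix.of fun i j => L₁ (EuclideanSpace.single j 1) i with hP
  set Q : Matrix (Fin q) (Fin d) ℝ := Matrix.of fun i j => L₂ (EuclideanSpace.single j 1) i with hQ
  have hPv : ∀ (k : E d) i, L₁ k i = (P *ᵥ k) i := continuousLinearMap_apply_eq_mulVec L₁
  have hQv : ∀ (k : E d) i, L₂ k i = (Q *ᵥ k) i := continuousLinearMap_apply_eq_mulVec L₂
  have g1 : L₁.toLinearMap.normDet ^ 2 = (Pᵀ * P).det := by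
    have h1 := L₁.toLinearMap.normDet_sq_eq_det_gram (EuclideanSpace.basisFun (Fin d) ℝ)
    simp only [RCLike.ofReal_real_eq_id, id_eq] at h1
    rw [h1]
    congr 1
    ext i j
    simp [Matrix.gram, Matrix.mul_apply, hP, PiLp.inner_apply, mul_comm]
  have g2 : L.toLinearMap.normDet ^ 2 = (Pᵀ * P + Qᵀ * Q).det := by
    have h1 := L.toLinearMap.normDet_sq_eq_det_gram (EuclideanSpace.basisFun (Fin d) ℝ)
    simp only [RCLike.ofReal_real_eq_id, id_eq] at h1
    rw [h1]
    congr 1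
    ext i j
    have : ∀ k, L k = WithLp.toLp 2 (L₁ k, L₂ k) := fun k => rfl
    simp [Matrix.gram, Matrix.mul_apply, hP, hQ, this, PiLp.inner_apply, mul_comm]
  have hPu : IsUnit (Pᵀ * P).det := by
    rw [← g1, isUnit_iff_ne_zero]
    exact pow_ne_zero _ (normDet_pos hinj).ne'
  have hrel : M * P + A * Q = 0 := by
    ext i j
    have := congrFun (hMA (EuclideanSpace.single j 1)) i
    simpa [Matrix.mul_apply, Matrix.mulVec, dotProduct, hP, hQ] using this
  have hex : ∀ (v : Fin m → ℝ) (s : Fin q → ℝ), M *ᵥ v + A *ᵥ s = 0 →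
      ∃ k, P *ᵥ k = v ∧ Q *ᵥ k = s := by
    intro v s hvs
    have h1 : fderiv ℝ (jointMap G) x (WithLp.toLp 2 (WithLp.toLp 2 v, WithLp.toLp 2 s)) = 0 := by
      ext i
      rw [fderiv_jointMap_apply h]
      exact congrFun hvs i
    obtain ⟨k, hk⟩ := (hker _).1 h1
    refine ⟨k, ?_, ?_⟩
    · ext i
      rw [← hPv, hL₁, ContinuousLinearMap.comp_apply, hk]
      rfl
    · ext i
      rw [← hQv, hL₂, ContinuousLinearMap.comp_apply, hk]
      rfl
  have key := det_gram_mul_borderedDet (isUnit_det_jacU hr) hPu hrel hex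
  have hc : coareaFactor (jointMap G) x ^ 2 = (M * Mᵀ + A * Aᵀ).det := by
    rw [coareaFactor_jointMap_sq h, jac, Matrix.transpose_fromCols, Matrix.fromCols_mul_fromRows]
  rw [g1, g2, hc]
  exact key

end Derivatives

end ABC

end MatrixForm

/-! ### Weak limits of truncated measures -/

section WeakLimit

open Module Set

namespace ABC

section Truncation

variable {V : Type*} [MeasurableSpace V] {μ : Measure V} {a : V → ℝ} {A X : Set V}

theorem lintegral_truncation (ha : AEMeasurable a (μ.restrict A))
    {f : V → ℝ≥0∞} (hf : AEMeasurable f (μ.restrict A)) :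
    ∫⁻ x, f x ∂(truncation μ a A) =
      (∫⁻ x in A, ENNReal.ofReal (a x) * f x ∂μ) / ∫⁻ x in A, ENNReal.ofReal (a x) ∂μ := by
  rw [truncation, lintegral_smul_measure,
    lintegral_withDensity_eq_lintegral_mul₀ ha.ennreal_ofReal hf, smul_eq_mul,
    ENNReal.div_eq_inv_mul]
  rfl

theorem truncation_restrict (hX : MeasurableSet X) (hAX : A ⊆ X) :
    (truncation μ a A).restrict X = truncation μ a A := by
  rw [truncation, Measure.restrict_smul, restrict_withDensity hX, Measure.restrict_restrict hX,
    inter_eq_self_of_subset_right hAX]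

theorem isProbabilityMeasure_truncation (h0 : ∫⁻ x in A, ENNReal.ofReal (a x) ∂μ ≠ 0)
    (ht : ∫⁻ x in A, ENNReal.ofReal (a x) ∂μ ≠ ∞) : IsProbabilityMeasure (truncation μ a A) := by
  refine ⟨?_⟩
  rw [truncation, Measure.smul_apply, withDensity_apply _ MeasurableSet.univ,
    Measure.restrict_univ, smul_eq_mul, ENNReal.inv_mul_cancel h0 ht]

/-- An affine change moves `φ` into `[0, 1]`, so weak convergence can be tested with nonnegative
integrals bounded by the total mass. -/
theorem setIntegral_eq_toReal_lintegral [TopologicalSpace V] [OpensMeasurableSpace V]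
    [SecondCountableTopology V] (hX : MeasurableSet X)
    {P : Measure V} [IsProbabilityMeasure P] (hPX : P.restrict X = P) {φ : V → ℝ}
    (hφ : ContinuousOn φ X) {c : ℝ} (hc : 0 < c) (hb : ∀ x ∈ X, |φ x| ≤ c) :
    ∫ x in X, φ x ∂P =
      2 * c * (∫⁻ x, ENNReal.ofReal ((φ x + c) / (2 * c)) ∂P).toReal - c := by
  have hm : AEStronglyMeasurable φ P := by
    rw [← hPX]
    exact hφ.aestronglyMeasurable hX
  have hX' : ∀ᵐ x ∂P, x ∈ X := by
    rw [← hPX]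
    exact ae_restrict_mem hX
  have hi : Integrable φ P := Integrable.of_bound hm c (hX'.mono fun x hx => hb x hx)
  rw [← integral_eq_lintegral_of_nonneg_ae
    (hX'.mono fun x hx => div_nonneg (by linarith [neg_abs_le (φ x), hb x hx]) (by positivity))
    ((hm.aemeasurable.add_const c).div_const (2 * c)).aestronglyMeasurable, integral_div,
    integral_add hi (integrable_const c), hPX]
  simp only [integral_const, probReal_univ, one_smul]
  field_simp
  ring

end Truncation

variable {V W : Type*} [NormedAddCommGroup V] [InnerProductSpace ℝ V] [FiniteDimensional ℝ V]
  [NormedAddCommGroup W] [InnerProductSpace ℝ W] [FiniteDimensional ℝ W]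
  [MeasurableSpace V] [BorelSpace V] [MeasurableSpace W] [BorelSpace W]
  {F : V → W} {X : Set V} {d : ℕ}

/-- The measure with density `a / coareaFactor F` on the fiber of `F` over `y`. -/
noncomputable def fiberMeasure (F : V → W) (X : Set V) (d : ℕ) (a : V → ℝ) (y : W) : Measure V :=
  ((Measure.euclideanHausdorffMeasure d).restrict (X ∩ F ⁻¹' {y})).withDensity
    fun x => ENNReal.ofReal (a x) * (ENNReal.ofReal (coareaFactor F x))⁻¹

theorem lintegral_fiberMeasure (hX : IsOpen X) (hF : ContDiffOn ℝ 1 F X) {a : V → ℝ}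
    (ha : ContinuousOn a X) (y : W) {f : V → ℝ≥0∞}
    (hf : AEMeasurable f ((Measure.euclideanHausdorffMeasure d).restrict (X ∩ F ⁻¹' {y}))) :
    ∫⁻ x, f x ∂(fiberMeasure F X d a y) =
      fiberIntegral F X d (fun x => ENNReal.ofReal (a x) * f x) y := by
  rw [fiberMeasure, lintegral_withDensity_eq_lintegral_mul₀
    (aemeasurable_ofReal_fiber hX hF ha y) hf, fiberIntegral]
  refine lintegral_congr fun x => ?_
  simp only [Pi.mul_apply]
  ring

omit [MeasurableSpace W] [BorelSpace W] in
theorem fiberMeasure_univ (F : V → W) (X : Set V) (d : ℕ) (a : V → ℝ) (y : W) :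
    fiberMeasure F X d a y univ = fiberIntegral F X d (fun x => ENNReal.ofReal (a x)) y := by
  rw [fiberMeasure, withDensity_apply _ MeasurableSet.univ, Measure.restrict_univ, fiberIntegral]

theorem ae_fiberMeasure_mem (hX : IsOpen X) (hF : ContDiffOn ℝ 1 F X) (a : V → ℝ) (y : W) :
    ∀ᵐ x ∂(fiberMeasure F X d a y), x ∈ X ∩ F ⁻¹' {y} :=
  (withDensity_absolutelyContinuous _ _).ae_le
    (ae_restrict_mem (measurableSet_inter_preimage hX hF (measurableSet_singleton y)))

/-- The weak limit of a measure conditioned on thin tubes around a fiber. -/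
theorem weakLimitIn_truncation (hX : IsOpen X) (hF : ContDiffOn ℝ 1 F X)
    (hsurj : ∀ x ∈ X, Function.Surjective (fderiv ℝ F x)) (hdim : finrank ℝ V = finrank ℝ W + d)
    {a : V → ℝ} (ha : ContinuousOn a X) (h0 : ∀ x ∈ X, 0 ≤ a x) {y : W}
    (hmass : ∀ ε : ℝ, 0 < ε →
      0 < ∫⁻ x in X ∩ F ⁻¹' Metric.closedBall y ε, ENNReal.ofReal (a x) ∧
      ∫⁻ x in X ∩ F ⁻¹' Metric.closedBall y ε, ENNReal.ofReal (a x) < ∞)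
    (htight : TightIn X fun ε => truncation volume a (X ∩ F ⁻¹' Metric.closedBall y ε))
    (hpos : fiberMeasure F X d a y univ ≠ 0) :
    fiberMeasure F X d a y univ ≠ ∞ ∧
    Tendsto (fun ε : ℝ => (∫⁻ x in X ∩ F ⁻¹' Metric.closedBall y ε, ENNReal.ofReal (a x)) /
      volume (Metric.closedBall y ε)) (𝓝[>] 0) (𝓝 (fiberMeasure F X d a y univ)) ∧
    WeakLimitIn X (fun ε => truncation volume a (X ∩ F ⁻¹' Metric.closedBall y ε))
      ((fiberMeasure F X d a y univ)⁻¹ • fiberMeasure F X d a y) := by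
  have hAm : ∀ ε, MeasurableSet (X ∩ F ⁻¹' Metric.closedBall y ε) := fun ε =>
    measurableSet_inter_preimage hX hF Metric.isClosed_closedBall.measurableSet
  have hae : ∀ {f : V → ℝ}, ContinuousOn f X → ∀ ε,
      AEMeasurable f (volume.restrict (X ∩ F ⁻¹' Metric.closedBall y ε)) := fun hf ε =>
    (hf.aemeasurable hX.measurableSet).mono_measure (Measure.restrict_mono inter_subset_left le_rfl)
  have htube := tendsto_tube_div_of_tight (d := d) hX hF hsurj hdim ha h0 (y := y)
    (fun ε hε => (hmass ε hε).2.ne) (by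
      obtain ⟨ε₀, hε₀, h⟩ := htight
      refine ⟨ε₀, hε₀, fun δ hδ => ?_⟩
      obtain ⟨K, hKX, hK, hle⟩ := h δ hδ
      refine ⟨K, hKX, hK, fun ε hε hεε₀ => ?_⟩
      have h1 := hle ε hε hεε₀
      simp only at h1
      rw [truncation, Measure.smul_apply, withDensity_apply _ hK.isClosed.measurableSet.compl,
        Measure.restrict_restrict hK.isClosed.measurableSet.compl, inter_comm Kᶜ, smul_eq_mul,
        ← ENNReal.div_eq_inv_mul] at h1
      rwa [ENNReal.div_le_iff_le_mul (Or.inl (hmass ε hε).1.ne')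
        (Or.inl (hmass ε hε).2.ne)] at h1)
  rw [← fiberMeasure_univ] at htube
  refine ⟨htube.1, fiberMeasure_univ F X d a y ▸ htube.2 a ha h0 fun x _ => le_rfl, ?_⟩
  intro φ hφ ⟨c₀, hc₀⟩
  -- The given bound may be zero, or even negative if `X` is empty; this one is always positive.
  set c := |c₀| + 1 with hc
  have hcpos : 0 < c := by positivity
  have hcb : ∀ x ∈ X, |φ x| ≤ c := fun x hx =>
    (hc₀ x hx).trans (by rw [hc]; linarith [le_abs_self c₀])
  set φ₁ : V → ℝ := fun x => (φ x + c) / (2 * c) with hφ₁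
  have hφ₁c : ContinuousOn φ₁ X := (hφ.add continuousOn_const).div_const _
  have hφ₁0 : ∀ x ∈ X, 0 ≤ φ₁ x := fun x hx =>
    div_nonneg (by linarith [neg_abs_le (φ x), hcb x hx]) (by positivity)
  have hφ₁1 : ∀ x ∈ X, φ₁ x ≤ 1 := fun x hx => by
    rw [hφ₁, div_le_one (by positivity)]
    linarith [le_abs_self (φ x), hcb x hx]
  set P₀ := (fiberMeasure F X d a y univ)⁻¹ • fiberMeasure F X d a y with hP₀
  have hP₀p : IsProbabilityMeasure P₀ :=
    ⟨by rw [hP₀, Measure.smul_apply, smul_eq_mul, ENNReal.inv_mul_cancel hpos htube.1]⟩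
  have hP₀X : P₀.restrict X = P₀ := by
    rw [hP₀, Measure.restrict_smul, Measure.restrict_eq_self_of_ae_mem
      ((ae_fiberMeasure_mem hX hF a y).mono fun x hx => hx.1)]
  have hlim : Tendsto (fun ε : ℝ => ∫⁻ x, ENNReal.ofReal (φ₁ x)
      ∂(truncation volume a (X ∩ F ⁻¹' Metric.closedBall y ε))) (𝓝[>] 0)
      (𝓝 (∫⁻ x, ENNReal.ofReal (φ₁ x) ∂P₀)) := by
    -- As `0 ≤ φ₁ ≤ 1`, the product `a φ₁` lies below `a` and has a tube limit. In the quotient with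
    -- the limit for `a`, the ball volumes cancel.
    have h1 := htube.2 (fun x => a x * φ₁ x) (ha.mul hφ₁c)
      (fun x hx => mul_nonneg (h0 x hx) (hφ₁0 x hx))
      (fun x hx => mul_le_of_le_one_right (h0 x hx) (hφ₁1 x hx))
    have h2 := htube.2 a ha h0 fun x _ => le_rfl
    rw [← fiberMeasure_univ] at h2
    have h3 := ENNReal.Tendsto.div h1 (Or.inr hpos) h2 (Or.inl htube.1)
    have e0 : ∫⁻ x, ENNReal.ofReal (φ₁ x) ∂P₀ =
        fiberIntegral F X d (fun x => ENNReal.ofReal (a x * φ₁ x)) y /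
          fiberMeasure F X d a y univ := by
      rw [hP₀, lintegral_smul_measure, lintegral_fiberMeasure hX hF ha y
        ((hφ₁c.aemeasurable hX.measurableSet).mono_measure
          (Measure.restrict_mono inter_subset_left le_rfl)).ennreal_ofReal, smul_eq_mul,
        ENNReal.div_eq_inv_mul]
      congr 1
      refine lintegral_congr_ae ((ae_mem_of_fiber hX hF y).mono fun x hx => ?_)
      simp only
      rw [ENNReal.ofReal_mul (h0 x hx)]
    rw [e0]
    refine h3.congr' ?_
    filter_upwards [self_mem_nhdsWithin] with ε hε
    obtain ⟨v0, vt⟩ := volume_closedBall_pos_lt_top y hε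
    rw [lintegral_truncation (hae ha ε) (hae hφ₁c ε).ennreal_ofReal]
    have e1 : ∫⁻ x in X ∩ F ⁻¹' Metric.closedBall y ε, ENNReal.ofReal (a x * φ₁ x) =
        ∫⁻ x in X ∩ F ⁻¹' Metric.closedBall y ε,
          ENNReal.ofReal (a x) * ENNReal.ofReal (φ₁ x) :=
      setLIntegral_congr_fun (hAm ε) fun x hx => ENNReal.ofReal_mul (h0 x hx.1)
    rw [e1, ENNReal.div_eq_inv_mul (b := volume _), ENNReal.div_eq_inv_mul (b := volume _),
      ENNReal.mul_div_mul_left _ _ (ENNReal.inv_ne_zero.2 vt) (ENNReal.inv_ne_top.2 v0)]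
  rw [setIntegral_eq_toReal_lintegral hX.measurableSet hP₀X hφ hcpos hcb]
  have hle : ∫⁻ x, ENNReal.ofReal (φ₁ x) ∂P₀ ≠ ∞ := by
    refine ((lintegral_mono_ae (g := fun _ => 1) ?_).trans_lt (by simp)).ne
    rw [← hP₀X]
    exact (ae_restrict_mem hX.measurableSet).mono fun x hx =>
      ENNReal.ofReal_le_one.2 (hφ₁1 x hx)
  have hlim' := (((ENNReal.tendsto_toReal hle).comp hlim).const_mul (2 * c)).sub_const c
  refine hlim'.congr' ?_
  filter_upwards [self_mem_nhdsWithin] with ε hε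
  have := isProbabilityMeasure_truncation (hmass ε hε).1.ne' (hmass ε hε).2.ne
  rw [setIntegral_eq_toReal_lintegral hX.measurableSet
    (truncation_restrict hX.measurableSet inter_subset_left) hφ hcpos hcb]
  rfl

end ABC

end WeakLimit

/-! ### The law of the data and the likelihood -/

section DataLaw

open Module Set

namespace ABC

variable {m n q : ℕ} {Υ : Set (E m)} {Θ : Set (E q)} {G : E m → E q → E n}

/-- A `C¹` data generating map on an open set whose partial Jacobians have full rank. -/
structure IsRegularModel (Υ : Set (E m)) (Θ : Set (E q)) (G : E m → E q → E n) : Prop where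
  isOpen_left : IsOpen Υ
  isOpen_right : IsOpen Θ
  contDiffOn : ContDiffOn ℝ 1 (jointMap G) (jointSpace Υ Θ)
  rank_left : ∀ u ∈ Υ, ∀ θ ∈ Θ, (jacU G u θ).rank = n
  rank_right : ∀ u ∈ Υ, ∀ θ ∈ Θ, (jacTheta G u θ).rank = q

theorem dgm_eq (y : E n) : dgm Υ Θ G y = jointSpace Υ Θ ∩ jointMap G ⁻¹' {y} := rfl

theorem dgmFat_eq (y : E n) (ε : ℝ) :
    dgmFat Υ Θ G y ε = jointSpace Υ Θ ∩ jointMap G ⁻¹' Metric.closedBall y ε := by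
  ext x
  simp [dgmFat, jointMap, dist_eq_norm]

theorem thetaSection_eq (y : E n) (θ : E q) :
    thetaSection Υ G y θ = Υ ∩ (fun u => G u θ) ⁻¹' {y} := rfl

theorem finrank_joint (hnm : n ≤ m) : finrank ℝ (Joint m q) = finrank ℝ (E n) + (m + q - n) := by
  rw [(WithLp.linearEquiv 2 ℝ (E m × E q)).finrank_eq, finrank_prod]
  simp only [finrank_euclideanSpace_fin]
  omega

theorem isometry_toLp_left (θ : E q) :
    Isometry fun u : E m => (WithLp.toLp 2 (u, θ) : Joint m q) := by
  refine Isometry.of_dist_eq fun u v => ?_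
  rw [WithLp.prod_dist_eq_of_L2]
  simp [Real.sqrt_sq dist_nonneg]

namespace IsRegularModel

variable (h : IsRegularModel Υ Θ G)

include h

theorem isOpen : IsOpen (jointSpace Υ Θ) := isOpen_jointSpace h.isOpen_left h.isOpen_right

theorem differentiableAt {x : Joint m q} (hx : x ∈ jointSpace Υ Θ) :
    DifferentiableAt ℝ (jointMap G) x :=
  (h.contDiffOn.differentiableOn one_ne_zero x hx).differentiableAt (h.isOpen.mem_nhds hx)

theorem surjective {x : Joint m q} (hx : x ∈ jointSpace Υ Θ) :
    Function.Surjective (fderiv ℝ (jointMap G) x) :=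
  fderiv_jointMap_surjective (h.differentiableAt hx) (h.rank_left _ hx.1 _ hx.2)

theorem surjective_left {u : E m} (hu : u ∈ Υ) {θ : E q} (hθ : θ ∈ Θ) :
    Function.Surjective (fderiv ℝ (fun u => G u θ) u) :=
  fderiv_left_surjective (h.rank_left u hu θ hθ)

theorem surjective_pairMap {x : Joint m q} (hx : x ∈ jointSpace Υ Θ) :
    Function.Surjective (fderiv ℝ (pairMap G) x) :=
  fderiv_pairMap_surjective (h.differentiableAt hx) (h.rank_left _ hx.1 _ hx.2)

theorem contDiffOn_left {θ : E q} (hθ : θ ∈ Θ) : ContDiffOn ℝ 1 (fun u => G u θ) Υ := by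
  have h1 : ContDiff ℝ 1 fun u : E m => (WithLp.toLp 2 (u, θ) : Joint m q) := by
    have : (fun u : E m => (WithLp.toLp 2 (u, θ) : Joint m q)) =
        fun u => fstIncl m q u + WithLp.toLp 2 (0, θ) := funext fun u => toLp_eq_add u θ
    rw [this]
    exact (fstIncl m q).contDiff.add contDiff_const
  exact h.contDiffOn.comp h1.contDiffOn fun u hu => ⟨hu, hθ⟩

theorem le_left {u : E m} (hu : u ∈ Υ) {θ : E q} (hθ : θ ∈ Θ) : n ≤ m :=
  h.rank_left u hu θ hθ ▸ Matrix.rank_le_width _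

theorem right_le {u : E m} (hu : u ∈ Υ) {θ : E q} (hθ : θ ∈ Θ) : q ≤ n := by
  have := (jacTheta G u θ).rank_le_card_height
  rwa [h.rank_right u hu θ hθ, Fintype.card_fin] at this

theorem aemeasurable_left {θ : E q} (hθ : θ ∈ Θ) (ρ : E m → ℝ) :
    AEMeasurable (fun u => G u θ)
      ((volume.restrict Υ).withDensity fun u => ENNReal.ofReal (ρ u)) :=
  ((h.contDiffOn_left hθ).continuousOn.aemeasurable h.isOpen_left.measurableSet).mono_ac
    (withDensity_absolutelyContinuous _ _)

theorem dataLaw_apply {θ : E q} (hθ : θ ∈ Θ) (ρ : E m → ℝ) {s : Set (E n)} (hs : MeasurableSet s) :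
    dataLaw Υ G ρ θ s = ∫⁻ u in Υ ∩ (fun u => G u θ) ⁻¹' s, ENNReal.ofReal (ρ u) := by
  rw [dataLaw, Measure.map_apply_of_aemeasurable (h.aemeasurable_left hθ ρ) hs,
    withDensity_apply', Measure.restrict_restrict' h.isOpen_left.measurableSet, inter_comm]

theorem isFiniteMeasure_dataLaw {ρ : E m → ℝ} (hρ1 : ∫⁻ u in Υ, ENNReal.ofReal (ρ u) = 1)
    {θ : E q} (hθ : θ ∈ Θ) : IsFiniteMeasure (dataLaw Υ G ρ θ) := by
  refine ⟨?_⟩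
  rw [h.dataLaw_apply hθ ρ MeasurableSet.univ, preimage_univ, inter_univ, hρ1]
  exact ENNReal.one_lt_top

/-- For fixed `θ` the map `u ↦ G(u, θ)` is a submersion, so null sets have null preimages. -/
theorem dataLaw_absolutelyContinuous {θ : E q} (hθ : θ ∈ Θ) (ρ : E m → ℝ) :
    dataLaw Υ G ρ θ ≪ volume := by
  rcases Υ.eq_empty_or_nonempty with hΥ | ⟨u₀, hu₀⟩
  · refine Measure.AbsolutelyContinuous.mk fun s hs _ => ?_
    rw [h.dataLaw_apply hθ ρ hs, hΥ]
    simp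
  · have hnm := h.le_left hu₀ hθ
    refine Measure.AbsolutelyContinuous.mk fun s hs hs0 => ?_
    rw [h.dataLaw_apply hθ ρ hs]
    refine setLIntegral_measure_zero _ _ (volume_inter_preimage_eq_zero (d := m - n) h.isOpen_left
      (h.contDiffOn_left hθ) (fun u hu => h.surjective_left hu hθ) ?_ hs hs0)
    simp only [finrank_euclideanSpace_fin]
    omega

/-- The likelihood is a density of the data. -/
theorem dataLaw_eq_withDensity_likelihood {ρ : E m → ℝ}
    (hρ1 : ∫⁻ u in Υ, ENNReal.ofReal (ρ u) = 1) {θ : E q} (hθ : θ ∈ Θ) :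
    dataLaw Υ G ρ θ = volume.withDensity fun y' => likelihood Υ G ρ y' θ := by
  have := h.isFiniteMeasure_dataLaw hρ1 hθ
  rw [← Measure.withDensity_rnDeriv_eq _ _ (h.dataLaw_absolutelyContinuous hθ ρ)]
  refine withDensity_congr_ae ?_
  -- Differentiation of measures along balls: the defining quotient converges almost everywhere to
  -- the Radon–Nikodym derivative, so its lower limit is that derivative.
  filter_upwards [Besicovitch.ae_tendsto_rnDeriv (dataLaw Υ G ρ θ) volume] with y hy
  exact hy.liminf_eq.symm

theorem lintegral_densSection {ρ : E m → ℝ} (hρ : ∀ u ∈ Υ, 0 ≤ ρ u) {θ : E q} (hθ : θ ∈ Θ)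
    (y : E n) :
    ∫⁻ u, ENNReal.ofReal (densSection G ρ θ u)
        ∂(riemannianMeasure (m - n) (thetaSection Υ G y θ)) =
      fiberIntegral (fun u => G u θ) Υ (m - n) (fun u => ENNReal.ofReal (ρ u)) y := by
  rw [riemannianMeasure, thetaSection_eq, fiberIntegral]
  refine lintegral_congr_ae ((ae_mem_of_fiber h.isOpen_left (h.contDiffOn_left hθ) y).mono
    fun u hu => ?_)
  exact ofReal_densSection (h.rank_left u hu θ hθ) (hρ u hu)

/-- The lower tube bound for the fixed-`θ` submersion. It holds for every `θ ∈ Θ`; no tightness of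
the tubes in `Υ` is available for the reverse inequality. -/
theorem fiberIntegral_le_likelihood {ρ : E m → ℝ} (hρ : ∀ u ∈ Υ, 0 ≤ ρ u)
    (hρc : ContinuousOn ρ Υ) (hnm : n ≤ m) {θ : E q} (hθ : θ ∈ Θ) (y : E n) :
    fiberIntegral (fun u => G u θ) Υ (m - n) (fun u => ENNReal.ofReal (ρ u)) y ≤
      likelihood Υ G ρ y θ := by
  rw [likelihood]
  simp_rw [h.dataLaw_apply hθ ρ Metric.isClosed_closedBall.measurableSet]
  refine fiberIntegral_le_liminf_tube_div h.isOpen_left (h.contDiffOn_left hθ)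
    (fun u hu => h.surjective_left hu hθ) ?_ hρc hρ y
  simp only [finrank_euclideanSpace_fin]
  omega

/-- The fiber over `(w, θ)` is the image of the `θ`-section under the isometry `u ↦ (u, θ)`, and the
coarea factors agree. -/
theorem fiberIntegral_pairMap {d : ℕ} {θ : E q} (hθ : θ ∈ Θ) (f : Joint m q → ℝ≥0∞) (w : E n) :
    fiberIntegral (pairMap G) (jointSpace Υ Θ) d f (WithLp.toLp 2 (w, θ)) =
      fiberIntegral (fun u => G u θ) Υ d (fun u => f (WithLp.toLp 2 (u, θ))) w := by
  set ι : E m → Joint m q := fun u => WithLp.toLp 2 (u, θ) with hι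
  have hiso : Isometry ι := isometry_toLp_left θ
  have hemb : MeasurableEmbedding ι := hiso.isClosedEmbedding.measurableEmbedding
  have hset : jointSpace Υ Θ ∩ pairMap G ⁻¹' {WithLp.toLp 2 (w, θ)} =
      ι '' (Υ ∩ (fun u => G u θ) ⁻¹' {w}) := by
    ext x
    constructor
    · rintro ⟨hx, hx'⟩
      have h1 : (G x.fst x.snd, x.snd) = (w, θ) := (WithLp.toLp_injective 2) hx'
      obtain ⟨h2, h3⟩ := Prod.mk.inj h1
      refine ⟨x.fst, ⟨hx.1, h3 ▸ h2⟩, ?_⟩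
      rw [hι, ← h3]
      rfl
    · rintro ⟨u, ⟨hu, hu'⟩, rfl⟩
      refine ⟨⟨hu, hθ⟩, ?_⟩
      change WithLp.toLp 2 (G u θ, θ) = WithLp.toLp 2 (w, θ)
      rw [show G u θ = w from hu']
  have hm : MeasurableSet (Υ ∩ (fun u => G u θ) ⁻¹' {w}) :=
    measurableSet_inter_preimage h.isOpen_left (h.contDiffOn_left hθ) (measurableSet_singleton w)
  rw [fiberIntegral, hset, ← inter_eq_left.2 (image_subset_range ι (Υ ∩ _)),
    ← Measure.restrict_restrict (hemb.measurableSet_image.2 hm),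
    ← hiso.map_euclideanHausdorffMeasure, hemb.restrict_map, preimage_image_eq _ hemb.injective,
    hemb.lintegral_map, fiberIntegral]
  refine setLIntegral_congr_fun hm fun u hu => ?_
  rw [coareaFactor_pairMap (h.differentiableAt (x := ι u) ⟨hu.1, hθ⟩)]
  rfl

omit h in
theorem fiberIntegral_pairMap_of_notMem {d : ℕ} {θ : E q} (hθ : θ ∉ Θ) (f : Joint m q → ℝ≥0∞)
    (w : E n) : fiberIntegral (pairMap G) (jointSpace Υ Θ) d f (WithLp.toLp 2 (w, θ)) = 0 := by
  have hset : jointSpace Υ Θ ∩ pairMap G ⁻¹' {WithLp.toLp 2 (w, θ)} = ∅ := by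
    refine eq_empty_of_forall_notMem fun x hx => hθ ?_
    have h1 : (G x.fst x.snd, x.snd) = (w, θ) := (WithLp.toLp_injective 2) hx.2
    rw [← (Prod.mk.inj h1).2]
    exact hx.1.2
  rw [fiberIntegral, hset, Measure.restrict_empty, lintegral_zero_measure]

end IsRegularModel

end ABC

end DataLaw

/-! ### The law of the parameter -/

section Parameter

open Module Set

namespace ABC

variable {m n q : ℕ} {Υ : Set (E m)} {Θ : Set (E q)} {G : E m → E q → E n}

theorem ambient_nonneg {ρ : E m → ℝ} (hρ : ∀ u ∈ Υ, 0 ≤ ρ u) {π : E q → ℝ}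
    (hπ : ∀ θ ∈ Θ, 0 ≤ π θ) (x : Joint m q) (hx : x ∈ jointSpace Υ Θ) : 0 ≤ ambient ρ π x :=
  mul_nonneg (hπ _ hx.2) (hρ _ hx.1)

namespace IsRegularModel

variable (h : IsRegularModel Υ Θ G) {ρ : E m → ℝ} {π : E q → ℝ} {y : E n}

include h

theorem fiberIntegral_pairMap_ambient (hπ : ∀ θ ∈ Θ, 0 ≤ π θ)
    {τ : E q → ℝ} (hτ : ∀ θ, 0 ≤ τ θ) (θ : E q) :
    fiberIntegral (pairMap G) (jointSpace Υ Θ) (m - n)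
        (fun x => ENNReal.ofReal (τ x.snd * ambient ρ π x)) (WithLp.toLp 2 (y, θ)) =
      Θ.indicator (fun θ => ENNReal.ofReal (τ θ) * (ENNReal.ofReal (π θ) *
        fiberIntegral (fun u => G u θ) Υ (m - n) (fun u => ENNReal.ofReal (ρ u)) y)) θ := by
  by_cases hθ : θ ∈ Θ
  · rw [indicator_of_mem hθ, h.fiberIntegral_pairMap hθ, fiberIntegral, fiberIntegral,
      ← lintegral_const_mul' _ _ ENNReal.ofReal_ne_top,
      ← lintegral_const_mul' _ _ ENNReal.ofReal_ne_top]
    refine lintegral_congr_ae ((ae_mem_of_fiber h.isOpen_left (h.contDiffOn_left hθ) y).mono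
      fun u hu => ?_)
    change ENNReal.ofReal (τ θ * (π θ * ρ u)) * _ = _
    rw [ENNReal.ofReal_mul (hτ θ), ENNReal.ofReal_mul (hπ θ hθ)]
    ring
  · rw [indicator_of_notMem hθ, fiberIntegral_pairMap_of_notMem hθ]

/-- Disintegration of the fiber over `θ`, with a weight `τ` that serves as a test function for the
`θ`-marginal. Two-step integration applies after a cutoff; monotone convergence removes it.
Measurability comes from the same supremum of continuous functions. -/
theorem fiberIntegral_snd_mul_ambient (hnm : n ≤ m) (hρ : ∀ u ∈ Υ, 0 ≤ ρ u)
    (hπ : ∀ θ ∈ Θ, 0 ≤ π θ) (hcont : ContinuousOn (ambient ρ π) (jointSpace Υ Θ))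
    {τ : E q → ℝ} (hτc : Continuous τ) (hτ : ∀ θ, 0 ≤ τ θ) :
    Measurable (Θ.indicator fun θ => ENNReal.ofReal (τ θ) * (ENNReal.ofReal (π θ) *
        fiberIntegral (fun u => G u θ) Υ (m - n) (fun u => ENNReal.ofReal (ρ u)) y)) ∧
    fiberIntegral (jointMap G) (jointSpace Υ Θ) (m + q - n)
        (fun x => ENNReal.ofReal (τ x.snd * ambient ρ π x)) y =
      ∫⁻ θ in Θ, ENNReal.ofReal (τ θ) * (ENNReal.ofReal (π θ) *
        fiberIntegral (fun u => G u θ) Υ (m - n) (fun u => ENNReal.ofReal (ρ u)) y) := by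
  obtain ⟨χ, hχ⟩ := exists_isCutoffSeq h.isOpen
  have hb : ContinuousOn (fun x : Joint m q => τ x.snd * ambient ρ π x) (jointSpace Υ Θ) :=
    (hτc.comp (WithLp.sndL 2 ℝ (E m) (E q)).continuous).continuousOn.mul hcont
  have hb0 : ∀ x ∈ jointSpace Υ Θ, 0 ≤ τ x.snd * ambient ρ π x := fun x hx =>
    mul_nonneg (hτ _) (ambient_nonneg hρ hπ x hx)
  have hpc := contDiffOn_pairMap h.contDiffOn
  have hdim₂ : finrank ℝ (Joint m q) = finrank ℝ (Joint n q) + (m - n) := by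
    rw [(WithLp.linearEquiv 2 ℝ (E m × E q)).finrank_eq,
      (WithLp.linearEquiv 2 ℝ (E n × E q)).finrank_eq, finrank_prod, finrank_prod]
    simp only [finrank_euclideanSpace_fin]
    omega
  have hsup : ∀ θ, Θ.indicator (fun θ => ENNReal.ofReal (τ θ) * (ENNReal.ofReal (π θ) *
      fiberIntegral (fun u => G u θ) Υ (m - n) (fun u => ENNReal.ofReal (ρ u)) y)) θ =
      ⨆ k, fiberIntegral (pairMap G) (jointSpace Υ Θ) (m - n)
        (fun x => ENNReal.ofReal (χ k x * (τ x.snd * ambient ρ π x))) (WithLp.toLp 2 (y, θ)) := by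
    intro θ
    rw [← h.fiberIntegral_pairMap_ambient hπ hτ, fiberIntegral_eq_iSup h.isOpen hpc hχ hb]
  have hmeas : ∀ k, Measurable fun θ => fiberIntegral (pairMap G) (jointSpace Υ Θ) (m - n)
        (fun x => ENNReal.ofReal (χ k x * (τ x.snd * ambient ρ π x)))
          (WithLp.toLp 2 (y, θ)) := fun k =>
    ((coarea_of_hasCompactSupport h.isOpen hpc (fun x hx => h.surjective_pairMap hx) hdim₂
      (hχ.continuous_mul h.isOpen hb k) (hχ.hasCompactSupport_mul _ k) (hχ.tsupport_mul_subset _ k)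
      (hχ.mul_nonneg hb0 k)).1.comp
      ((WithLp.prod_continuous_toLp 2 (E n) (E q)).comp (by fun_prop))).measurable
  refine ⟨?_, ?_⟩
  · rw [funext hsup]
    exact Measurable.iSup hmeas
  · rw [fiberIntegral_eq_iSup h.isOpen h.contDiffOn hχ hb,
      ← lintegral_indicator h.isOpen_right.measurableSet, lintegral_congr hsup,
      lintegral_iSup hmeas fun i j hij θ => fiberIntegral_mono h.isOpen hpc _ fun x hx =>
        ENNReal.ofReal_le_ofReal (mul_le_mul_of_nonneg_right (hχ.mono x hij) (hb0 x hx))]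
    refine iSup_congr fun k => ?_
    exact fiberIntegral_eq_lintegral_fiberIntegral h.isOpen h.contDiffOn
      (fun x hx => h.surjective hx) (finrank_joint hnm) hpc
      (fun x hx => h.surjective_pairMap hx) hdim₂ (fun x => rfl)
      (hχ.continuous_mul h.isOpen hb k) (hχ.hasCompactSupport_mul _ k) (hχ.tsupport_mul_subset _ k)
      (hχ.mul_nonneg hb0 k) y

theorem aemeasurable_mul_fiberIntegral (hnm : n ≤ m) (hρ : ∀ u ∈ Υ, 0 ≤ ρ u)
    (hπ : ∀ θ ∈ Θ, 0 ≤ π θ) (hcont : ContinuousOn (ambient ρ π) (jointSpace Υ Θ)) :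
    AEMeasurable (fun θ => ENNReal.ofReal (π θ) *
      fiberIntegral (fun u => G u θ) Υ (m - n) (fun u => ENNReal.ofReal (ρ u)) y)
      (volume.restrict Θ) := by
  have h1 := (h.fiberIntegral_snd_mul_ambient (y := y) hnm hρ hπ hcont
    (τ := fun _ => 1) continuous_const fun _ => zero_le_one).1
  simp only [ENNReal.ofReal_one, one_mul] at h1
  exact (aemeasurable_indicator_iff h.isOpen_right.measurableSet).1 h1.aemeasurable

/-- The law of `θ` under the measure on the data generating manifold. -/
theorem map_snd_fiberMeasure (hnm : n ≤ m) (hρ : ∀ u ∈ Υ, 0 ≤ ρ u) (hπ : ∀ θ ∈ Θ, 0 ≤ π θ)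
    (hcont : ContinuousOn (ambient ρ π) (jointSpace Υ Θ))
    (hfin : fiberMeasure (jointMap G) (jointSpace Υ Θ) (m + q - n) (ambient ρ π) y univ ≠ ∞) :
    (fiberMeasure (jointMap G) (jointSpace Υ Θ) (m + q - n) (ambient ρ π) y).map
        (fun x => x.snd) =
      (volume.restrict Θ).withDensity fun θ => ENNReal.ofReal (π θ) *
        fiberIntegral (fun u => G u θ) Υ (m - n) (fun u => ENNReal.ofReal (ρ u)) y := by
  have : IsFiniteMeasure
      (fiberMeasure (jointMap G) (jointSpace Υ Θ) (m + q - n) (ambient ρ π) y) := ⟨hfin.lt_top⟩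
  have hsnd : Measurable fun x : Joint m q => x.snd :=
    (WithLp.sndL 2 ℝ (E m) (E q)).continuous.measurable
  refine ext_of_forall_lintegral_eq_of_IsFiniteMeasure fun f => ?_
  have hf : Measurable fun θ => (f θ : ℝ≥0∞) := f.continuous.measurable.coe_nnreal_ennreal
  rw [lintegral_map hf hsnd, lintegral_fiberMeasure h.isOpen h.contDiffOn hcont y
    (f := fun x => (f x.snd : ℝ≥0∞)) (hf.comp hsnd).aemeasurable,
    lintegral_withDensity_eq_lintegral_mul₀
    (h.aemeasurable_mul_fiberIntegral hnm hρ hπ hcont) hf.aemeasurable]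
  have h1 := (h.fiberIntegral_snd_mul_ambient (y := y) hnm hρ hπ hcont
    (τ := fun θ => (f θ : ℝ)) (by fun_prop) fun _ => NNReal.coe_nonneg _).2
  simp only [ENNReal.ofReal_mul (NNReal.coe_nonneg _), ENNReal.ofReal_coe_nnreal] at h1
  simpa only [Pi.mul_apply, mul_comm] using h1

/-- Tonelli's theorem: integrating out `u` first turns the tube mass into the prior average of the
probabilities entering the likelihood. -/
theorem ambient_tube_eq (hcont : ContinuousOn (ambient ρ π) (jointSpace Υ Θ))
    (hπ : ∀ θ ∈ Θ, 0 ≤ π θ) {s : Set (E n)} (hs : MeasurableSet s) :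
    AEMeasurable (fun θ => ENNReal.ofReal (π θ) * dataLaw Υ G ρ θ s) (volume.restrict Θ) ∧
    ∫⁻ x in jointSpace Υ Θ ∩ jointMap G ⁻¹' s, ENNReal.ofReal (ambient ρ π x) =
      ∫⁻ θ in Θ, ENNReal.ofReal (π θ) * dataLaw Υ G ρ θ s := by
  have hA := measurableSet_inter_preimage h.isOpen h.contDiffOn hs
  set A := jointSpace Υ Θ ∩ jointMap G ⁻¹' s with hAdef
  set f : Joint m q → ℝ≥0∞ := A.indicator fun x => ENNReal.ofReal (ambient ρ π x) with hf
  have hfm : AEMeasurable f := (aemeasurable_indicator_iff hA).2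
    ((hcont.aemeasurable h.isOpen.measurableSet).ennreal_ofReal.mono_measure
      (Measure.restrict_mono inter_subset_left le_rfl))
  have hmp := WithLp.volume_preserving_toLp (E m) (E q)
  have hfm' : AEMeasurable (fun p : E m × E q => f (WithLp.toLp 2 p)) (volume.prod volume) :=
    hfm.comp_quasiMeasurePreserving hmp.quasiMeasurePreserving
  have hin : ∀ θ, ∫⁻ u, f (WithLp.toLp 2 (u, θ)) =
      Θ.indicator (fun θ => ENNReal.ofReal (π θ) * dataLaw Υ G ρ θ s) θ := by
    intro θ
    by_cases hθ : θ ∈ Θ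
    · have hB := measurableSet_inter_preimage h.isOpen_left (h.contDiffOn_left hθ) hs
      rw [indicator_of_mem hθ, h.dataLaw_apply hθ ρ hs,
        ← lintegral_const_mul' _ _ ENNReal.ofReal_ne_top, ← lintegral_indicator hB]
      refine lintegral_congr fun u => ?_
      by_cases hu : u ∈ Υ ∩ (fun u => G u θ) ⁻¹' s
      · have : (WithLp.toLp 2 (u, θ) : Joint m q) ∈ A := ⟨⟨hu.1, hθ⟩, hu.2⟩
        rw [indicator_of_mem hu, hf, indicator_of_mem this]
        exact ENNReal.ofReal_mul (hπ θ hθ)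
      · have : (WithLp.toLp 2 (u, θ) : Joint m q) ∉ A := fun h' => hu ⟨h'.1.1, h'.2⟩
        rw [indicator_of_notMem hu, hf, indicator_of_notMem this]
    · rw [indicator_of_notMem hθ, ← lintegral_zero (α := E m) (μ := volume)]
      refine lintegral_congr fun u => ?_
      exact indicator_of_notMem (fun h' => hθ h'.1.2) _
  refine ⟨?_, ?_⟩
  · refine (aemeasurable_indicator_iff h.isOpen_right.measurableSet).1 ?_
    rw [← funext hin]
    exact hfm'.prod_swap.lintegral_prod_right'
  · rw [← lintegral_indicator hA, ← lintegral_indicator h.isOpen_right.measurableSet,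
      ← lintegral_congr hin, ← lintegral_prod_symm _ hfm',
      ← hmp.lintegral_comp_emb (MeasurableEquiv.toLp 2 (E m × E q)).measurableEmbedding f]
    rfl

/-- For almost every `θ`, the likelihood is given by the integral over the `θ`-section. -/
theorem ae_likelihood_eq (hnm : n ≤ m) (hρ : ∀ u ∈ Υ, 0 ≤ ρ u) (hρc : ContinuousOn ρ Υ)
    (hπ : ∀ θ ∈ Θ, 0 ≤ π θ) (hcont : ContinuousOn (ambient ρ π) (jointSpace Υ Θ))
    (hfin : fiberMeasure (jointMap G) (jointSpace Υ Θ) (m + q - n) (ambient ρ π) y univ ≠ ∞)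
    (hlim : Tendsto (fun ε : ℝ => (∫⁻ x in jointSpace Υ Θ ∩ jointMap G ⁻¹' Metric.closedBall y ε,
        ENNReal.ofReal (ambient ρ π x)) / volume (Metric.closedBall y ε)) (𝓝[>] 0)
      (𝓝 (fiberMeasure (jointMap G) (jointSpace Υ Θ) (m + q - n) (ambient ρ π) y univ))) :
    ∀ᵐ θ ∂(volume.restrict Θ), ENNReal.ofReal (π θ) * likelihood Υ G ρ y θ =
      ENNReal.ofReal (π θ) *
        fiberIntegral (fun u => G u θ) Υ (m - n) (fun u => ENNReal.ofReal (ρ u)) y := by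
  -- Along a sequence, Fatou's lemma applies and the lower limit is measurable in `θ`; it dominates
  -- the lower limit defining the likelihood.
  set ε : ℕ → ℝ := fun k => 1 / ((k : ℝ) + 1) with hε
  have hεlim : Tendsto ε atTop (𝓝[>] 0) :=
    tendsto_nhdsWithin_iff.2 ⟨tendsto_one_div_add_atTop_nhds_zero_nat,
      Eventually.of_forall fun k => by
        simp only [hε, mem_Ioi]
        positivity⟩
  set v : ℕ → ℝ≥0∞ := fun k => volume (Metric.closedBall y (ε k)) with hv
  set r : ℕ → E q → ℝ≥0∞ := fun k θ =>
    ENNReal.ofReal (π θ) * dataLaw Υ G ρ θ (Metric.closedBall y (ε k)) / v k with hr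
  have hrm : ∀ k, AEMeasurable (r k) (volume.restrict Θ) := fun k =>
    (h.ambient_tube_eq hcont hπ Metric.isClosed_closedBall.measurableSet).1.div_const _
  have hint : ∀ k, ∫⁻ θ in Θ, r k θ = (∫⁻ x in jointSpace Υ Θ ∩
      jointMap G ⁻¹' Metric.closedBall y (ε k), ENNReal.ofReal (ambient ρ π x)) / v k := by
    intro k
    rw [(h.ambient_tube_eq hcont hπ Metric.isClosed_closedBall.measurableSet).2]
    simp only [hr, div_eq_mul_inv]
    rw [lintegral_mul_const'' _
      (h.ambient_tube_eq hcont hπ Metric.isClosed_closedBall.measurableSet).1]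
  have hle : ∀ θ, ENNReal.ofReal (π θ) * likelihood Υ G ρ y θ ≤
      liminf (fun k => r k θ) atTop := by
    intro θ
    have h1 : likelihood Υ G ρ y θ ≤
        liminf (fun k => dataLaw Υ G ρ θ (Metric.closedBall y (ε k)) / v k) atTop :=
      (liminf_le_liminf_of_le hεlim).trans_eq (liminf_comp _ ε atTop).symm
    refine (mul_le_mul_right h1 _).trans_eq ?_
    have h2 := Monotone.map_liminf_of_continuousAt (F := atTop)
      (f := fun t : ℝ≥0∞ => ENNReal.ofReal (π θ) * t) (fun a b hab => mul_le_mul_right hab _)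
      (fun k => dataLaw Υ G ρ θ (Metric.closedBall y (ε k)) / v k)
      (ENNReal.continuous_const_mul ENNReal.ofReal_ne_top).continuousAt
    rw [h2]
    simp only [hr, Function.comp_def, mul_div_assoc]
  have hge : ∀ θ ∈ Θ, ENNReal.ofReal (π θ) *
      fiberIntegral (fun u => G u θ) Υ (m - n) (fun u => ENNReal.ofReal (ρ u)) y ≤
      ENNReal.ofReal (π θ) * likelihood Υ G ρ y θ := fun θ hθ =>
    mul_le_mul_right (h.fiberIntegral_le_likelihood hρ hρc hnm hθ y) _
  have htot : ∫⁻ θ in Θ, ENNReal.ofReal (π θ) *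
      fiberIntegral (fun u => G u θ) Υ (m - n) (fun u => ENNReal.ofReal (ρ u)) y =
      fiberMeasure (jointMap G) (jointSpace Υ Θ) (m + q - n) (ambient ρ π) y univ := by
    have h1 := (h.fiberIntegral_snd_mul_ambient (y := y) hnm hρ hπ hcont
      (τ := fun _ => 1) continuous_const fun _ => zero_le_one).2
    simp only [ENNReal.ofReal_one, one_mul] at h1
    rw [fiberMeasure_univ, h1]
  have hfatou : ∫⁻ θ in Θ, liminf (fun k => r k θ) atTop ≤
      ∫⁻ θ in Θ, ENNReal.ofReal (π θ) *
        fiberIntegral (fun u => G u θ) Υ (m - n) (fun u => ENNReal.ofReal (ρ u)) y := by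
    refine (lintegral_liminf_le' hrm).trans_eq ?_
    rw [htot, ← (hlim.comp hεlim).liminf_eq]
    exact congrArg (fun g => liminf g atTop) (funext hint)
  have hmem := ae_restrict_mem (μ := volume) h.isOpen_right.measurableSet
  have hlm : AEMeasurable (fun θ => liminf (fun k => r k θ) atTop) (volume.restrict Θ) := by
    simp only [liminf_eq_iSup_iInf_of_nat]
    exact AEMeasurable.iSup fun k => AEMeasurable.biInf _ (to_countable _) fun i _ => hrm i
  -- The likelihood is squeezed between the section integral and the sequential lower limit. The
  -- extremes agree almost everywhere: they are ordered, the smaller integral is finite, and Fatou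
  -- bounds the larger by it. Measurability of the likelihood itself is not needed.
  have heq := ae_eq_of_ae_le_of_lintegral_le
    (hmem.mono fun θ hθ => (hge θ hθ).trans (hle θ)) (htot ▸ hfin)
    hlm hfatou
  filter_upwards [heq, hmem] with θ h1 hθ
  exact le_antisymm ((hle θ).trans_eq h1.symm) (hge θ hθ)

end IsRegularModel

end ABC

end Parameter

/-! ### The law of `u` -/

section Projection

open Module Set

namespace ABC

theorem hasDensityPropTo_of_eq_withDensity {V : Type*} [MeasurableSpace V] {P μ ν : Measure V}
    {g : V → ℝ≥0∞} {c : ℝ≥0∞} (hP : P = c⁻¹ • ν) (hν : ν = μ.withDensity g)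
    (hg : AEMeasurable g μ) (hc : ν univ = c) (h0 : c ≠ 0) (ht : c ≠ ∞) :
    HasDensityPropTo P μ g := by
  have hint : ∫⁻ x, g x ∂μ = c := by
    rw [← hc, hν, withDensity_apply _ MeasurableSet.univ, Measure.restrict_univ]
  refine ⟨hg, hint ▸ h0, hint ▸ ht, ?_⟩
  rw [hP, hν, hint, ← withDensity_smul' _ _ (ENNReal.inv_ne_top.2 h0)]
  congr 1
  ext x
  rw [Pi.smul_apply, smul_eq_mul, ENNReal.div_eq_inv_mul]

theorem continuous_borderedDet {m n q : ℕ} :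
    Continuous fun p : Matrix (Fin n) (Fin m) ℝ × Matrix (Fin n) (Fin q) ℝ =>
      borderedDet p.1 p.2 :=
  Continuous.matrix_det (Continuous.matrix_fromBlocks
    (continuous_fst.matrix_mul continuous_fst.matrix_transpose) continuous_snd
    continuous_snd.matrix_transpose.neg continuous_const)

variable {m n q : ℕ} {Υ : Set (E m)} {Θ : Set (E q)} {G : E m → E q → E n} {y : E n}
  {θhat : E m → E q}

/-- On the manifold the distance to `y` is zero at `θ`, so `θ` is a minimizer and uniqueness
applies. -/
theorem argmin_eq_snd (hθhat : ∀ u ∈ Υ, IsUniqueArgmin Θ G y u (θhat u)) {x : Joint m q}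
    (hx : x ∈ dgm Υ Θ G y) : θhat x.fst = x.snd := by
  refine ((hθhat x.fst hx.1.1).2.2 x.snd hx.1.2 fun t _ => ?_).symm
  change ‖G x.fst x.snd - y‖ ≤ _
  rw [hx.2, sub_self, norm_zero]
  exact norm_nonneg _

theorem toLp_argmin_eq (hθhat : ∀ u ∈ Υ, IsUniqueArgmin Θ G y u (θhat u)) {x : Joint m q}
    (hx : x ∈ dgm Υ Θ G y) : (WithLp.toLp 2 (x.fst, θhat x.fst) : Joint m q) = x := by
  rw [argmin_eq_snd hθhat hx]
  rfl

theorem injOn_fst_dgm (hθhat : ∀ u ∈ Υ, IsUniqueArgmin Θ G y u (θhat u)) :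
    InjOn (WithLp.fstL 2 ℝ (E m) (E q)) (dgm Υ Θ G y) := by
  intro x hx x' hx' he
  have he' : x.fst = x'.fst := he
  rw [← toLp_argmin_eq hθhat hx, ← toLp_argmin_eq hθhat hx', he']

theorem uProj_eq_image : uProj Υ Θ G y = WithLp.fstL 2 ℝ (E m) (E q) '' dgm Υ Θ G y := by
  ext u
  constructor
  · rintro ⟨hu, θ, hθ, he⟩
    exact ⟨WithLp.toLp 2 (u, θ), ⟨⟨hu, hθ⟩, he⟩, rfl⟩
  · rintro ⟨x, hx, rfl⟩
    exact ⟨hx.1.1, x.snd, hx.1.2, hx.2⟩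

namespace IsRegularModel

variable (h : IsRegularModel Υ Θ G)

include h

theorem measurableSet_dgm : MeasurableSet (dgm Υ Θ G y) :=
  measurableSet_inter_preimage h.isOpen h.contDiffOn (measurableSet_singleton y)

/-- An injective continuous image of a Borel set is Borel (Lusin–Souslin); this gives measurability
of the minimizer on `𝒰(y)` without regularity assumptions on it. -/
theorem measurableSet_image_fst (hθhat : ∀ u ∈ Υ, IsUniqueArgmin Θ G y u (θhat u))
    {t : Set (Joint m q)} (ht : MeasurableSet t) :
    MeasurableSet (WithLp.fstL 2 ℝ (E m) (E q) '' (dgm Υ Θ G y ∩ t)) :=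
  (h.measurableSet_dgm.inter ht).image_of_continuousOn_injOn
    (WithLp.fstL 2 ℝ (E m) (E q)).continuous.continuousOn
    ((injOn_fst_dgm hθhat).mono inter_subset_left)

theorem measurableSet_uProj (hθhat : ∀ u ∈ Υ, IsUniqueArgmin Θ G y u (θhat u)) :
    MeasurableSet (uProj Υ Θ G y) := by
  have := h.measurableSet_image_fst hθhat (MeasurableSet.univ)
  rwa [inter_univ, ← uProj_eq_image] at this

/-- The measurable parametrization of the data generating manifold by `u`. -/
theorem measurable_argmin (hθhat : ∀ u ∈ Υ, IsUniqueArgmin Θ G y u (θhat u)) :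
    Measurable fun u : uProj Υ Θ G y => (WithLp.toLp 2 (u.1, θhat u.1) : Joint m q) := by
  intro t ht
  have h1 : (fun u : uProj Υ Θ G y => (WithLp.toLp 2 (u.1, θhat u.1) : Joint m q)) ⁻¹' t =
      Subtype.val ⁻¹' (WithLp.fstL 2 ℝ (E m) (E q) '' (dgm Υ Θ G y ∩ t)) := by
    ext ⟨u, hu⟩
    obtain ⟨x, hx, rfl⟩ := uProj_eq_image ▸ hu
    change (WithLp.toLp 2 (x.fst, θhat x.fst) : Joint m q) ∈ t ↔ _
    rw [toLp_argmin_eq hθhat hx]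
    constructor
    · exact fun hxt => ⟨x, ⟨hx, hxt⟩, rfl⟩
    · rintro ⟨x', ⟨hx', hxt'⟩, he⟩
      rwa [← injOn_fst_dgm hθhat hx' hx he]
  rw [h1]
  exact measurable_subtype_coe (h.measurableSet_image_fst hθhat ht)

theorem continuousOn_borderedDet : ContinuousOn
    (fun x : Joint m q => borderedDet (jacU G x.fst x.snd) (jacTheta G x.fst x.snd))
    (jointSpace Υ Θ) := by
  have hd := h.contDiffOn.continuousOn_fderiv_of_isOpen h.isOpen le_rfl
  have hentry : ∀ (v : Joint m q) (i : Fin n),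
      ContinuousOn (fun x => fderiv ℝ (jointMap G) x v i) (jointSpace Υ Θ) := fun v i =>
    (EuclideanSpace.proj (𝕜 := ℝ) i).continuous.comp_continuousOn
      (hd.clm_apply continuousOn_const)
  have h1 : ContinuousOn (fun x : Joint m q => jacU G x.fst x.snd) (jointSpace Υ Θ) :=
    continuousOn_pi.2 fun i => continuousOn_pi.2 fun j =>
      (hentry (WithLp.toLp 2 (EuclideanSpace.single j 1, 0)) i).congr fun x hx =>
        congrArg (fun w : E n => w i) (fderiv_left (h.differentiableAt hx) _)
  have h2 : ContinuousOn (fun x : Joint m q => jacTheta G x.fst x.snd) (jointSpace Υ Θ) :=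
    continuousOn_pi.2 fun i => continuousOn_pi.2 fun j =>
      (hentry (WithLp.toLp 2 (0, EuclideanSpace.single j 1)) i).congr fun x hx =>
        congrArg (fun w : E n => w i) (fderiv_right (h.differentiableAt hx) _)
  exact continuous_borderedDet.comp_continuousOn
    (f := fun x : Joint m q => (jacU G x.fst x.snd, jacTheta G x.fst x.snd)) (h1.prodMk h2)

variable {ρ : E m → ℝ} {π : E q → ℝ} {B : E m → E q → Matrix (Fin n) (Fin (n - q)) ℝ}

/-- The choice of `B` need not be measurable, but the density does not depend on it: it is a
continuous function on `X` composed with the measurable parametrization of the manifold. -/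
theorem aemeasurable_densU (hθhat : ∀ u ∈ Υ, IsUniqueArgmin Θ G y u (θhat u))
    (hcont : ContinuousOn (ambient ρ π) (jointSpace Υ Θ)) (hqn : q ≤ n)
    (hB : ∀ u ∈ Υ, ∀ θ ∈ Θ, IsOrthComplement (jacTheta G u θ) (B u θ)) (ν : Measure (E m)) :
    AEMeasurable (fun u => ENNReal.ofReal (densU G ρ π (B u (θhat u)) u (θhat u)))
      (ν.restrict (uProj Υ Θ G y)) := by
  refine aemeasurable_restrict_of_measurable_subtype (h.measurableSet_uProj hθhat) ?_
  have hmem : ∀ u : uProj Υ Θ G y,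
      (WithLp.toLp 2 (u.1, θhat u.1) : Joint m q) ∈ jointSpace Υ Θ := by
    rintro ⟨u, hu⟩
    obtain ⟨x, hx, rfl⟩ := uProj_eq_image ▸ hu
    change (WithLp.toLp 2 (x.fst, θhat x.fst) : Joint m q) ∈ _
    rw [toLp_argmin_eq hθhat hx]
    exact hx.1
  have hσ : Measurable fun u : uProj Υ Θ G y =>
      (⟨WithLp.toLp 2 (u.1, θhat u.1), hmem u⟩ : jointSpace Υ Θ) :=
    (h.measurable_argmin hθhat).subtype_mk
  have hk : Measurable fun x : jointSpace Υ Θ => ENNReal.ofReal (ambient ρ π x *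
      borderedDet (jacU G x.1.fst x.1.snd) (jacTheta G x.1.fst x.1.snd) ^ (-(1 / 2) : ℝ)) := by
    have h1 := (continuousOn_iff_continuous_domRestrict.1 hcont).measurable
    have h2 := (continuousOn_iff_continuous_domRestrict.1 h.continuousOn_borderedDet).measurable
    exact (h1.mul (h2.pow_const _)).ennreal_ofReal
  convert! hk.comp hσ using 1
  funext u
  have hx : u.1 ∈ Υ ∧ θhat u.1 ∈ Θ := hmem u
  rw [densU_eq hqn (h.rank_left _ hx.1 _ hx.2) (hB _ hx.1 _ hx.2), mul_comm (ρ _)]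
  rfl

/-- The law of `u` under the measure on the data generating manifold. -/
theorem map_fst_fiberMeasure (hθhat : ∀ u ∈ Υ, IsUniqueArgmin Θ G y u (θhat u))
    (hnm : n ≤ m) (hqn : q ≤ n) (hρ : ∀ u ∈ Υ, 0 ≤ ρ u) (hπ : ∀ θ ∈ Θ, 0 ≤ π θ)
    (hB : ∀ u ∈ Υ, ∀ θ ∈ Θ, IsOrthComplement (jacTheta G u θ) (B u θ)) :
    (fiberMeasure (jointMap G) (jointSpace Υ Θ) (m + q - n) (ambient ρ π) y).map
        (fun x => x.fst) =
      (riemannianMeasure (m + q - n) (uProj Υ Θ G y)).withDensity fun u =>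
        ENNReal.ofReal (densU G ρ π (B u (θhat u)) u (θhat u)) := by
  have hfst : Measurable fun x : Joint m q => x.fst :=
    (WithLp.fstL 2 ℝ (E m) (E q)).continuous.measurable
  refine Measure.ext fun s hs => ?_
  have hset : s ∩ uProj Υ Θ G y =
      WithLp.fstL 2 ℝ (E m) (E q) '' (dgm Υ Θ G y ∩ (fun x : Joint m q => x.fst) ⁻¹' s) := by
    rw [uProj_eq_image]
    ext u
    constructor
    · rintro ⟨hu, x, hx, rfl⟩
      exact ⟨x, ⟨hx, hu⟩, rfl⟩
    · rintro ⟨x, ⟨hx, hxs⟩, rfl⟩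
      exact ⟨hxs, x, hx, rfl⟩
  rw [Measure.map_apply hfst hs, fiberMeasure, withDensity_apply _ (hfst hs),
    Measure.restrict_restrict (hfst hs), withDensity_apply _ hs, riemannianMeasure,
    Measure.restrict_restrict hs, hset, inter_comm, dgm_eq]
  refine (setLIntegral_image_fiber h.isOpen h.contDiffOn (fun x hx => h.surjective hx)
    (finrank_joint hnm) (WithLp.fstL 2 ℝ (E m) (E q)) y (injOn_fst_dgm hθhat) ?_
    (hfst hs)).symm
  intro x hx L hL hker
  have hr := h.rank_left _ hx.1.1 _ hx.1.2
  obtain ⟨hinj, hdet⟩ := normDet_fst_comp (h.differentiableAt hx.1) hr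
    (h.rank_right _ hx.1.1 _ hx.1.2) L hL hker
  refine ⟨hinj, ?_⟩
  change _ = _ * ENNReal.ofReal (densU G ρ π (B x.fst (θhat x.fst)) x.fst (θhat x.fst))
  rw [argmin_eq_snd hθhat hx, densU_eq hqn hr (hB _ hx.1.1 _ hx.1.2)]
  have hl : 0 < L.toLinearMap.normDet := normDet_pos hL
  have hp : 0 < (WithLp.fstL 2 ℝ (E m) (E q) ∘L L).toLinearMap.normDet := normDet_pos hinj
  have hc : 0 < coareaFactor (jointMap G) x := coareaFactor_pos (h.surjective hx.1)
  set l := L.toLinearMap.normDet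
  set p := (WithLp.fstL 2 ℝ (E m) (E q) ∘L L).toLinearMap.normDet
  set c := coareaFactor (jointMap G) x
  -- The quotient `p c / l` is the positive square root of the bordered determinant, so its inverse
  -- is the power in `densU_eq`.
  have hK : (p * c / l) ^ 2 = borderedDet (jacU G x.fst x.snd) (jacTheta G x.fst x.snd) := by
    rw [div_pow, mul_pow, ← hdet]
    field_simp
  rw [rpow_neg_half_of_sq_eq (by positivity) hK, ← ENNReal.ofReal_inv_of_pos hc,
    ← ENNReal.ofReal_mul (ambient_nonneg hρ hπ x hx.1), ← ENNReal.ofReal_mul hl.le,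
    ← ENNReal.ofReal_mul hp.le, ambient]
  congr 1
  field_simp

end IsRegularModel

end ABC

end Projection

/-! ### Assembly of the theorem -/

theorem proposition1 {m n q : ℕ} (hm : 0 < m) (hn : 0 < n) (hq : 0 < q)
    (Υ : Set (ABC.E m)) (Θ : Set (ABC.E q)) (hΥ : IsOpen Υ) (hΘ : IsOpen Θ)
    -- the data generating equation and the observed data
    (G : ABC.E m → ABC.E q → ABC.E n) (y : ABC.E n)
    (hG : ContDiffOn ℝ 3 (fun x : ABC.Joint m q => G x.fst x.snd) (ABC.jointSpace Υ Θ))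
    (hrow : ∀ u ∈ Υ, ∀ θ ∈ Θ, (ABC.jacU G u θ).rank = n)
    (hcol : ∀ u ∈ Υ, ∀ θ ∈ Θ, (ABC.jacTheta G u θ).rank = q)
    (θhat : ABC.E m → ABC.E q) (hθhat : ∀ u ∈ Υ, ABC.IsUniqueArgmin Θ G y u (θhat u))
    -- the density of `U` and the (possibly improper) prior density
    (ρ : ABC.E m → ℝ) (hρ : ∀ u ∈ Υ, 0 ≤ ρ u) (hρ1 : ∫⁻ u in Υ, ENNReal.ofReal (ρ u) = 1)
    (π : ABC.E q → ℝ) (hπ : ∀ θ ∈ Θ, 0 ≤ π θ)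
    -- the ambient density
    (hcont : ContinuousOn (ABC.ambient ρ π) (ABC.jointSpace Υ Θ))
    (hsupp : 0 < ABC.riemannianMeasure (m + q - n) (ABC.dgm Υ Θ G y)
      {x | 0 < ABC.ambient ρ π x})
    (hmass : ∀ ε : ℝ, 0 < ε →
      0 < ∫⁻ x in ABC.dgmFat Υ Θ G y ε, ENNReal.ofReal (ABC.ambient ρ π x) ∧
      ∫⁻ x in ABC.dgmFat Υ Θ G y ε, ENNReal.ofReal (ABC.ambient ρ π x) < ∞)
    (htight : ABC.TightIn (ABC.jointSpace Υ Θ) (ABC.abcLaw Υ Θ G y ρ π)) :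
    -- the likelihood is a density of `Y = G(U, θ)`, given at `y` by an integral over `𝒢_θ(y)`
    (∀ θ ∈ Θ, ABC.dataLaw Υ G ρ θ =
      volume.withDensity fun y' => ABC.likelihood Υ G ρ y' θ) ∧
    (∀ᵐ θ ∂(volume.restrict Θ), 0 < π θ → ABC.likelihood Υ G ρ y θ =
      ∫⁻ u, ENNReal.ofReal (ABC.densSection G ρ θ u)
        ∂(ABC.riemannianMeasure (m - n) (ABC.thetaSection Υ G y θ))) ∧
    ∃ P₀ : Measure (ABC.Joint m q), IsProbabilityMeasure P₀ ∧
      -- the weak limit and its density on `𝒢(y)`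
      ABC.WeakLimitIn (ABC.jointSpace Υ Θ) (ABC.abcLaw Υ Θ G y ρ π) P₀ ∧
      ABC.HasDensityPropTo P₀ (ABC.riemannianMeasure (m + q - n) (ABC.dgm Υ Θ G y))
        (fun x => ENNReal.ofReal (ABC.densG G ρ π x)) ∧
      -- the equivalent description on `𝒰(y)`
      (∀ B : ABC.E m → ABC.E q → Matrix (Fin n) (Fin (n - q)) ℝ,
        (∀ u ∈ Υ, ∀ θ ∈ Θ, ABC.IsOrthComplement (ABC.jacTheta G u θ) (B u θ)) →
        ABC.HasDensityPropTo (P₀.map fun x => x.fst)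
          (ABC.riemannianMeasure (m + q - n) (ABC.uProj Υ Θ G y))
          (fun u => ENNReal.ofReal (ABC.densU G ρ π (B u (θhat u)) u (θhat u)))) ∧
      P₀ = (P₀.map fun x => x.fst).map (fun u => WithLp.toLp 2 (u, θhat u)) ∧
      -- the law of `θ`, and of `θ̂(y, u)`: the posterior
      ABC.HasDensityPropTo (P₀.map fun x => x.snd) (volume.restrict Θ)
        (fun θ => ENNReal.ofReal (π θ) * ABC.likelihood Υ G ρ y θ) ∧
      ABC.HasDensityPropTo ((P₀.map fun x => x.fst).map θhat) (volume.restrict Θ)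
        (fun θ => ENNReal.ofReal (π θ) * ABC.likelihood Υ G ρ y θ) := by
  have hreg : ABC.IsRegularModel Υ Θ G :=
    ⟨hΥ, hΘ, hG.of_le (by norm_num), hrow, hcol⟩
  set X := ABC.jointSpace Υ Θ
  set F := ABC.jointMap G
  set a := ABC.ambient ρ π
  set L := ABC.fiberMeasure F X (m + q - n) a y with hL
  have ha0 : ∀ x ∈ X, 0 ≤ a x := ABC.ambient_nonneg hρ hπ
  have hdgm : MeasurableSet (ABC.dgm Υ Θ G y) := hreg.measurableSet_dgm
  -- A point of the manifold with positive density: its ranks give `n ≤ m` and `q ≤ n`, which make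
  -- the natural number subtractions honest.
  obtain ⟨x₀, hax₀, hx₀⟩ : ({x | 0 < a x} ∩ ABC.dgm Υ Θ G y).Nonempty := by
    rw [ABC.riemannianMeasure, Measure.restrict_apply' hdgm] at hsupp
    exact nonempty_of_measure_ne_zero hsupp.ne'
  have hnm : n ≤ m := hreg.le_left hx₀.1.1 hx₀.1.2
  have hqn : q ≤ n := hreg.right_le hx₀.1.1 hx₀.1.2
  -- Only the product `π ρ` is assumed continuous; freezing `θ` at a value where `π` is nonzero and
  -- dividing by it isolates `ρ`.
  have hρc : ContinuousOn ρ Υ := by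
    have hpos₀ : 0 < π x₀.snd * ρ x₀.fst := hax₀
    have h1 : ContinuousOn (fun u => a (WithLp.toLp 2 (u, x₀.snd))) Υ :=
      hcont.comp (ABC.isometry_toLp_left x₀.snd).continuous.continuousOn
        fun u hu => ⟨hu, hx₀.1.2⟩
    have h2 : π x₀.snd ≠ 0 := left_ne_zero_of_mul hpos₀.ne'
    exact (h1.div_const (π x₀.snd)).congr fun u _ => (mul_div_cancel_left₀ (ρ u) h2).symm
  have hLdens : L = (ABC.riemannianMeasure (m + q - n) (ABC.dgm Υ Θ G y)).withDensity
      fun x => ENNReal.ofReal (ABC.densG G ρ π x) :=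
    withDensity_congr_ae ((ae_restrict_mem hdgm).mono fun x hx =>
      (ABC.ofReal_densG (hreg.differentiableAt hx.1) (hrow _ hx.1.1 _ hx.1.2) (ha0 x hx.1)).symm)
  have hdens : AEMeasurable (fun x => ENNReal.ofReal (ABC.densG G ρ π x))
      (ABC.riemannianMeasure (m + q - n) (ABC.dgm Υ Θ G y)) :=
    (ABC.aemeasurable_ofReal_fiber hreg.isOpen hreg.contDiffOn hcont y).congr
      ((ae_restrict_mem hdgm).mono fun x hx => (ABC.ofReal_densG (hreg.differentiableAt hx.1)
        (hrow _ hx.1.1 _ hx.1.2) (ha0 x hx.1)).symm)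
  have hpos : L Set.univ ≠ 0 := by
    intro h0
    rw [hL, ABC.fiberMeasure_univ, ABC.fiberIntegral, lintegral_eq_zero_iff'
      (ABC.aemeasurable_ofReal_fiber hreg.isOpen hreg.contDiffOn hcont y)] at h0
    refine hsupp.ne' (measure_mono_null (fun x hx => ?_) (ae_iff.1 h0))
    exact mul_ne_zero (ENNReal.ofReal_pos.2 hx).ne' (ENNReal.inv_ne_zero.2 ENNReal.ofReal_ne_top)
  have hlaw : ABC.abcLaw Υ Θ G y ρ π =
      fun ε => ABC.truncation volume a (X ∩ F ⁻¹' Metric.closedBall y ε) :=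
    funext fun ε => by rw [ABC.abcLaw, ABC.dgmFat_eq]
  simp only [ABC.dgmFat_eq] at hmass
  obtain ⟨hfin, hlim, hweak⟩ := ABC.weakLimitIn_truncation hreg.isOpen hreg.contDiffOn
    (fun x hx => hreg.surjective hx) (ABC.finrank_joint hnm) hcont ha0 hmass (hlaw ▸ htight) hpos
  have hlik := hreg.ae_likelihood_eq hnm hρ hρc hπ hcont hfin hlim
  have hfst : Measurable fun x : ABC.Joint m q => x.fst :=
    (WithLp.fstL 2 ℝ (ABC.E m) (ABC.E q)).continuous.measurable
  have hsnd : Measurable fun x : ABC.Joint m q => x.snd :=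
    (WithLp.sndL 2 ℝ (ABC.E m) (ABC.E q)).continuous.measurable
  set P₀ := (L Set.univ)⁻¹ • L with hP₀
  have hP₀mem : ∀ᵐ x ∂P₀, x ∈ ABC.dgm Υ Θ G y :=
    (Measure.smul_absolutelyContinuous).ae_le
      (ABC.ae_fiberMeasure_mem hreg.isOpen hreg.contDiffOn a y)
  -- Nothing is known about `θhat` off `𝒰(y)`, but the `u`-marginal is carried by `𝒰(y)`, where the
  -- parametrization is measurable.
  have hσ : AEMeasurable (fun u => (WithLp.toLp 2 (u, θhat u) : ABC.Joint m q))
      (P₀.map fun x => x.fst) := by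
    have h1 : ∀ᵐ u ∂(P₀.map fun x => x.fst), u ∈ ABC.uProj Υ Θ G y :=
      (ae_map_iff hfst.aemeasurable (hreg.measurableSet_uProj hθhat)).2 (hP₀mem.mono fun x hx =>
        ⟨hx.1.1, x.snd, hx.1.2, hx.2⟩)
    rw [← Measure.restrict_eq_self_of_ae_mem h1]
    exact aemeasurable_restrict_of_measurable_subtype (hreg.measurableSet_uProj hθhat)
      (hreg.measurable_argmin hθhat)
  have hθhatm : AEMeasurable θhat (P₀.map fun x => x.fst) := hsnd.comp_aemeasurable hσ
  have hthetaDens : ABC.HasDensityPropTo (P₀.map fun x => x.snd) (volume.restrict Θ)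
      (fun θ => ENNReal.ofReal (π θ) * ABC.likelihood Υ G ρ y θ) := by
    refine ABC.hasDensityPropTo_of_eq_withDensity (Measure.map_smul ..)
      ((hreg.map_snd_fiberMeasure hnm hρ hπ hcont hfin).trans
        (withDensity_congr_ae (EventuallyEq.symm hlik)))
      ((hreg.aemeasurable_mul_fiberIntegral hnm hρ hπ hcont).congr (EventuallyEq.symm hlik))
      ?_ hpos hfin
    rw [Measure.map_apply hsnd MeasurableSet.univ, Set.preimage_univ]
  refine ⟨fun θ hθ => hreg.dataLaw_eq_withDensity_likelihood hρ1 hθ, ?_, P₀, ?_, ?_, ?_, ?_, ?_,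
    hthetaDens, ?_⟩
  · filter_upwards [hlik, ae_restrict_mem hΘ.measurableSet] with θ h1 hθ hπθ
    rw [hreg.lintegral_densSection hρ hθ]
    exact (ENNReal.mul_right_inj (ENNReal.ofReal_pos.2 hπθ).ne' ENNReal.ofReal_ne_top).1 h1
  · exact ⟨by rw [hP₀, Measure.smul_apply, smul_eq_mul, ENNReal.inv_mul_cancel hpos hfin]⟩
  · rw [hlaw]
    exact hweak
  · exact ABC.hasDensityPropTo_of_eq_withDensity hP₀ hLdens hdens rfl hpos hfin
  · intro B hB
    refine ABC.hasDensityPropTo_of_eq_withDensity (Measure.map_smul ..)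
      (hreg.map_fst_fiberMeasure hθhat hnm hqn hρ hπ hB)
      (hreg.aemeasurable_densU hθhat hcont hqn hB _) ?_ hpos hfin
    rw [Measure.map_apply hfst MeasurableSet.univ, Set.preimage_univ]
  · rw [AEMeasurable.map_map_of_aemeasurable hσ hfst.aemeasurable,
      Measure.map_congr (g := id) ?_, Measure.map_id]
    exact hP₀mem.mono fun x hx => ABC.toLp_argmin_eq hθhat hx
  · rw [AEMeasurable.map_map_of_aemeasurable hθhatm hfst.aemeasurable,
      Measure.map_congr (g := fun x => x.snd) ?_]
    · exact hthetaDens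
    · exact hP₀mem.mono fun x hx => ABC.argmin_eq_snd hθhat hx
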